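/- Let $p$ be a prime, $K$ a number field with absolute Galois group $G_K=\mathrm{Gal}(\overline K/K)$, $E$ a number field that is Galois over $\mathbb{Q}$, $E_p=E\otimes_{\mathbb Q}\mathbb Q_p$ with its $p$-adic topology, and $n\ge 1$. Let $\rho:G_K\to \mathrm{GL}_n(E_p)$ be a continuous representation (for instance, for $K$ totally real, the representation $\rho_{\pi,p}$ attached to a regular algebraic cuspidal automorphic representation $\pi$ of $\mathrm{GL}_n(\mathbb A_K)$ with central character $|\cdot|^m\omega$, $\omega$ of finite order). Let $M/K$ be a finite extension inside $\overline K$ such that the $p$-adic cyclotomic character $\epsilon_p$ of $G_M$ has a continuous $n$-th root $\epsilon_p^{1/n}:G_M\to\mathbb Z_p^\times$, fix such a root, let $m$ be a non-zero integer and put $\rho'=\rho|_{G_M}\otimes(\epsilon_p^{1/n})^{-m}:G_M\to\mathrm{GL}_n(E_p)$. For an embedding $\lambda:E\hookrightarrow\overline{\mathbb Q}_p$ let $\rho'_\lambda:G_M\to \mathrm{GL}_n(\overline{\mathbb Q}_p)$ be the base change of $\rho'$ along $E_p\to\overline{\mathbb Q}_p$. Call $\rho'$ *valid* if: 1. there is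 a finite set $S$ of places of $M$, containing the Archimedean places and those above $p$, such that every $\rho'_\lambda$ is continuous and unramified outside $S$, and for $v\notin S$ the characteristic polynomial of $\rho'(\mathrm{Frob}_v)$ has coefficients in $E$; 2. no $\rho'_\lambda$ is isomorphic to $\rho'_\lambda\otimes\chi$ for a non-trivial continuous character $\chi$ and, if $n>2$, no $\rho'_\lambda$ is isomorphic to $(\rho'_\lambda)^\vee\otimes\eta$ for a continuous character $\eta$; 3. $\det\rho'=1$; 4. for every $\lambda$ the $\overline{\mathbb Q}_p$-span of the Lie algebra of the $p$-adic Lie group $\rho'_\lambda(G_M)$ is $\mathfrak{sl}_n(\overline{\mathbb Q}_p)$. An inner-twist (respectively outer-twist) of $\rho'$ is a pair $(\sigma,\chi)$ with $\sigma\in\mathrm{Aut}(E)$ and $\chi:G_M\to E_p^\times$ a continuous character such that ${}^\sigma\rho'\cong\rho'\otimes\chi$ (respectively ${}^\sigma\rho'\cong\rho'^\vee\otimes\chi$); an extra-twist is an inner- or outer-twist. Let $\Gamma\subseteq\mathrm{Aut}(E)$ be the set of all $\sigma$ that occur in extra-twists, $F=E^\Gamma$, $F_p=F\otimes_{\mathbb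 Q}\mathbb Q_p$, and let $N\subseteq G_M$ be the intersection of the kernels of the characters of all extra-twists. For each $\sigma\in\Gamma$ there is $\alpha_\sigma\in\mathrm{GL}_n(E_p)$ such that $f_\sigma({}^\sigma\rho'(h))=\rho'(h)$ for all $h\in N$, where $f_\sigma=\mathrm{ad}(\alpha_\sigma)$ if $\sigma$ occurs in an inner-twist, or $f_\sigma=\mathrm{ad}(\alpha_\sigma)\circ(\cdot)^{-T}$ if $\sigma$ occurs in an outer-twist. For such a choice of $f=(f_\sigma)_{\sigma\in\Gamma}$ let $H_p$ be the group over $F_p$ with $$H_p(R)=\{g\in \mathrm{SL}_n(E_p\otimes_{F_p}R) : f_\sigma({}^\sigma g)=g\text{ for all }\sigma\in\Gamma\}$$ for every $F_p$-algebra $R$, so that $H_p(F_p)\subseteq\mathrm{SL}_n(E_p)$. **Claim.** If $\rho'$ is valid, then such families $f$ exist, and for each of them there is a finite extension $L/K$ inside $\overline K$ such that $\rho(G_L)$ is contained in $H_p(F_p)\cdot\mathbb Q_p^\times\subseteq\mathrm{GL}_n(E_p)$ and is open in it for the $p$-adic topology. -/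

import Mathlib

open scoped TensorProduct Pointwise
open Matrix NumberField

noncomputable section

namespace BigImage

/-! ### Matrix-valued representations -/

section Reps

variable {G A : Type*} [Group G] [CommRing A] {n : ℕ}

/-- The automorphism `g ↦ (g⁻¹)ᵀ` of `GL_n(A)`. -/
def invTranspose : GL (Fin n) A →* GL (Fin n) A where
  toFun g := ⟨(g⁻¹).valᵀ, g.valᵀ,
    by rw [← transpose_mul, ← Units.val_mul, mul_inv_cancel, Units.val_one, transpose_one],
    by rw [← transpose_mul, ← Units.val_mul, inv_mul_cancel, Units.val_one, transpose_one]⟩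
  map_one' := by ext1; simp
  map_mul' g h := by ext1; simp only [_root_.mul_inv_rev, Units.val_mul, transpose_mul]

/-- The twist `ρ ⊗ χ` of a representation by a character. -/
def twist (ρ : G →* GL (Fin n) A) (χ : G →* Aˣ) : G →* GL (Fin n) A where
  toFun g := GeneralLinearGroup.scalar (Fin n) (χ g) * ρ g
  map_one' := by simp
  map_mul' g h := by
    rw [map_mul, map_mul, map_mul, mul_assoc, mul_assoc, ← mul_assoc _ (ρ g) (ρ h),
      GeneralLinearGroup.scalar_commute (χ h) (ρ g), mul_assoc]

/-- The dual representation `ρ^∨`, in matrix form `g ↦ (ρ(g)⁻¹)ᵀ`. -/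
def dual (ρ : G →* GL (Fin n) A) : G →* GL (Fin n) A := invTranspose.comp ρ

/-- Isomorphism of the representations of `G` on `A^n` given by `ρ₁` and `ρ₂`. -/
def Iso (ρ₁ ρ₂ : G →* GL (Fin n) A) : Prop :=
  ∃ P : GL (Fin n) A, ∀ g, ρ₂ g = P * ρ₁ g * P⁻¹

/-- `ρ ≅ ρ ⊗ χ` for a non-trivial continuous character `χ`. -/
def IsSelfTwist [TopologicalSpace G] [TopologicalSpace A] (ρ : G →* GL (Fin n) A) : Prop :=
  ∃ χ : G →* Aˣ, Continuous χ ∧ χ ≠ 1 ∧ Iso ρ (twist ρ χ)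

/-- `ρ ≅ ρ^∨ ⊗ η` for some continuous character `η`. -/
def IsEssentiallySelfDual [TopologicalSpace G] [TopologicalSpace A]
    (ρ : G →* GL (Fin n) A) : Prop :=
  ∃ η : G →* Aˣ, Continuous η ∧ Iso ρ (twist (dual ρ) η)

end Reps

/-! ### Ramification and Frobenius elements

`k` is a number field and `Ω` an algebraic closure of it, so that `Gal(Ω/k)` is the absolute Galois
group and `𝓞 Ω` is the ring of all algebraic integers. The primes `w` of `𝓞 Ω` above a finite place
`v` of `k` correspond to the choices of a decomposition group at `v`. -/

section Places

variable {k Ω : Type*} [Field k] [Field Ω] [Algebra k Ω]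

/-- `w` is a prime of `𝓞 Ω` above the finite place `v` of `k`. -/
def IsPrimeAbove (v : IsDedekindDomain.HeightOneSpectrum (𝓞 k)) (w : Ideal (𝓞 Ω)) : Prop :=
  w.IsPrime ∧ w.under (𝓞 k) = v.asIdeal

/-- `σ` lies in the inertia group of the prime `w` of `𝓞 Ω`. -/
def IsInertiaAt (σ : Gal(Ω/k)) (w : Ideal (𝓞 Ω)) : Prop :=
  ∀ x : 𝓞 Ω, RingOfIntegers.mapAlgHom (k := k) σ x - x ∈ w

/-- `σ` is an arithmetic Frobenius element at the prime `w` of `𝓞 Ω`. -/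
def IsFrobeniusAt (σ : Gal(Ω/k)) (w : Ideal (𝓞 Ω)) : Prop :=
  (RingOfIntegers.mapAlgHom (k := k) σ : 𝓞 Ω →ₐ[𝓞 k] 𝓞 Ω).IsArithFrobAt w

/-- The homomorphism `ρ` is unramified at `v`: it kills all inertia groups at `v`. -/
def IsUnramifiedAt {H : Type*} [Group H] (ρ : Gal(Ω/k) →* H)
    (v : IsDedekindDomain.HeightOneSpectrum (𝓞 k)) : Prop :=
  ∀ w : Ideal (𝓞 Ω), IsPrimeAbove v w → ∀ σ : Gal(Ω/k), IsInertiaAt σ w → ρ σ = 1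

end Places

/-! ### The semi-local ring `E_p = E ⊗ ℚ_p` -/

section Semilocal

variable (p : ℕ) [Fact p.Prime] (E : Type*) [Field E] [CharZero E]

/-- `E_p = ℚ_p ⊗_ℚ E`. -/
abbrev Loc : Type _ := ℚ_[p] ⊗[ℚ] E

/-- The `p`-adic topology of `E_p`, a finite-dimensional `ℚ_p`-vector space when `E` is a number
field. -/
instance : TopologicalSpace (Loc p E) := moduleTopology ℚ_[p] (Loc p E)

instance : IsModuleTopology ℚ_[p] (Loc p E) := ⟨rfl⟩

variable {E}

/-- The action of `σ ∈ Aut(E)` on `E_p`. -/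
def locAut (σ : E ≃ₐ[ℚ] E) : Loc p E →ₐ[ℚ_[p]] Loc p E :=
  Algebra.TensorProduct.map (AlgHom.id ℚ_[p] ℚ_[p]) σ.toAlgHom

/-- For a subfield `F` of `E`, the ring `E_p` is an algebra over `F_p`. -/
instance locAlgebra (F : IntermediateField ℚ E) : Algebra (Loc p F) (Loc p E) :=
  (Algebra.TensorProduct.map (AlgHom.id ℚ_[p] ℚ_[p]) F.val.toRingHom.toRatAlgHom).toRingHom.toAlgebra

/-- If `σ` fixes `F` pointwise then its action on `E_p` is `F_p`-linear. -/
def locAutOver (F : IntermediateField ℚ E) (σ : E ≃ₐ[ℚ] E) (hσ : ∀ x ∈ F, σ x = x) :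
    Loc p E →ₐ[Loc p F] Loc p E where
  toRingHom := (locAut p σ).toRingHom
  commutes' x := by
    change (locAut p σ) (Algebra.TensorProduct.map (AlgHom.id ℚ_[p] ℚ_[p]) F.val.toRingHom.toRatAlgHom x) =
      Algebra.TensorProduct.map (AlgHom.id ℚ_[p] ℚ_[p]) F.val.toRingHom.toRatAlgHom x
    induction x using TensorProduct.induction_on with
    | zero => simp
    | tmul a b => simp [locAut, hσ b b.2]
    | add a b ha hb => rw [map_add, map_add, ha, hb]

/-- The homomorphism `E_p → ℚ̄_p` induced by an embedding `λ : E → ℚ̄_p`. -/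
def locEmb (lam : E →ₐ[ℚ] PadicAlgCl p) : Loc p E →ₐ[ℚ_[p]] PadicAlgCl p :=
  Algebra.TensorProduct.lift (Algebra.ofId ℚ_[p] (PadicAlgCl p)) lam (fun _ _ => Commute.all _ _)

variable {p}

/-- The representation `ρ_λ` over `ℚ̄_p` obtained from `ρ` over `E_p` by base change along `λ`. -/
def repAt {G : Type*} [Group G] {n : ℕ} (ρ : G →* GL (Fin n) (Loc p E))
    (lam : E →ₐ[ℚ] PadicAlgCl p) : G →* GL (Fin n) (PadicAlgCl p) :=
  (GeneralLinearGroup.map (locEmb p lam).toRingHom).comp ρ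

/-- The conjugate `^σ ρ` of `ρ` by `σ ∈ Aut(E)` acting on the coefficients. -/
def conjRep {G : Type*} [Group G] {n : ℕ} (σ : E ≃ₐ[ℚ] E)
    (ρ : G →* GL (Fin n) (Loc p E)) : G →* GL (Fin n) (Loc p E) :=
  (GeneralLinearGroup.map (locAut p σ).toRingHom).comp ρ

end Semilocal

/-! ### The Lie algebra of a compact subgroup of `GL_n(ℚ̄_p)` -/

/-- The `ℚ_p`-Lie algebra of a `p`-adic Lie subgroup `G` of `GL_n(ℚ̄_p)`: all matrices `X` such that
`exp(tX) ∈ G` for all sufficiently small `t ∈ ℚ_p`. -/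
def lieAlg {p : ℕ} [Fact p.Prime] {n : ℕ} (G : Subgroup (GL (Fin n) (PadicAlgCl p))) :
    Set (Matrix (Fin n) (Fin n) (PadicAlgCl p)) :=
  {X | ∃ r : ℝ, 0 < r ∧ ∀ t : ℚ_[p], ‖t‖ < r →
    ∃ g ∈ G, (g : Matrix (Fin n) (Fin n) (PadicAlgCl p)) = NormedSpace.exp (t • X)}

/-! ### Valid representations -/

/-- A representation `ρ : Gal(Ω/k) → GL_n(E_p)` of the absolute Galois group of the number field `k`
is valid. -/
structure IsValid {p : ℕ} [Fact p.Prime] {E k Ω : Type*} [Field E] [CharZero E] [Field k]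
    [Field Ω] [Algebra k Ω] {n : ℕ} (ρ : Gal(Ω/k) →* GL (Fin n) (Loc p E)) : Prop where
  continuous_repAt : ∀ lam : E →ₐ[ℚ] PadicAlgCl p, Continuous (repAt ρ lam)
  /-- Outside a finite set `S` of places that contains those above `p`, all `ρ_λ` are unramified and
  the characteristic polynomials of `ρ` at Frobenius elements have coefficients in `E`. -/
  unramified_rational : ∃ S : Set (IsDedekindDomain.HeightOneSpectrum (𝓞 k)), S.Finite ∧
    (∀ v, (p : 𝓞 k) ∈ v.asIdeal → v ∈ S) ∧
    (∀ v ∉ S, ∀ lam : E →ₐ[ℚ] PadicAlgCl p, IsUnramifiedAt (repAt ρ lam) v) ∧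
    ∀ v ∉ S, ∀ w : Ideal (𝓞 Ω), IsPrimeAbove v w → ∀ σ : Gal(Ω/k), IsFrobeniusAt σ w →
      ∃ f : Polynomial E, (ρ σ : Matrix (Fin n) (Fin n) (Loc p E)).charpoly =
        f.map (Algebra.TensorProduct.includeRight : E →ₐ[ℚ] Loc p E).toRingHom
  not_selfTwist : ∀ lam : E →ₐ[ℚ] PadicAlgCl p, ¬ IsSelfTwist (repAt ρ lam)
  not_essentiallySelfDual : 2 < n →
    ∀ lam : E →ₐ[ℚ] PadicAlgCl p, ¬ IsEssentiallySelfDual (repAt ρ lam)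
  det_eq_one : ∀ g, (ρ g : Matrix (Fin n) (Fin n) (Loc p E)).det = 1
  /-- The `ℚ̄_p`-Lie algebra of the image of `ρ_λ` is `sl_n(ℚ̄_p)`, the space of matrices of
  trace zero. -/
  lie_eq_sl : ∀ lam : E →ₐ[ℚ] PadicAlgCl p,
    Submodule.span (PadicAlgCl p) (lieAlg (repAt ρ lam).range) =
      LinearMap.ker (traceLinearMap (Fin n) (PadicAlgCl p) (PadicAlgCl p))

/-! ### Extra-twists and the form of `SL_n` defined by them -/

section Twists

variable {p : ℕ} [Fact p.Prime] {E : Type*} [Field E] [CharZero E]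
  {G : Type*} [Group G] [TopologicalSpace G] {n : ℕ}

/-- `(σ, χ)` is an inner-twist of `ρ`: `^σ ρ ≅ ρ ⊗ χ`. -/
def IsInnerTwist (ρ : G →* GL (Fin n) (Loc p E)) (σ : E ≃ₐ[ℚ] E) (χ : G →* (Loc p E)ˣ) : Prop :=
  Continuous χ ∧ Iso (twist ρ χ) (conjRep σ ρ)

/-- `(σ, χ)` is an outer-twist of `ρ`: `^σ ρ ≅ ρ^∨ ⊗ χ`. -/
def IsOuterTwist (ρ : G →* GL (Fin n) (Loc p E)) (σ : E ≃ₐ[ℚ] E) (χ : G →* (Loc p E)ˣ) : Prop :=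
  Continuous χ ∧ Iso (twist (dual ρ) χ) (conjRep σ ρ)

/-- `(σ, χ)` is an extra-twist of `ρ`. -/
def IsExtraTwist (ρ : G →* GL (Fin n) (Loc p E)) (σ : E ≃ₐ[ℚ] E) (χ : G →* (Loc p E)ˣ) : Prop :=
  IsInnerTwist ρ σ χ ∨ IsOuterTwist ρ σ χ

/-- `Γ ⊆ Aut(E)`: the automorphisms that occur in an extra-twist of `ρ`. -/
def extraTwists (ρ : G →* GL (Fin n) (Loc p E)) : Set (E ≃ₐ[ℚ] E) :=
  {σ | ∃ χ, IsExtraTwist ρ σ χ}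

/-- `F = E^Γ`. -/
def twistField (ρ : G →* GL (Fin n) (Loc p E)) : IntermediateField ℚ E :=
  IntermediateField.fixedField (Subgroup.closure (extraTwists ρ))

theorem apply_eq_of_mem_twistField {ρ : G →* GL (Fin n) (Loc p E)} {σ : E ≃ₐ[ℚ] E}
    (hσ : σ ∈ extraTwists ρ) : ∀ x ∈ twistField ρ, σ x = x :=
  fun _ hx => hx ⟨σ, Subgroup.subset_closure hσ⟩

/-- The intersection of the kernels of the characters of all extra-twists of `ρ`. -/
def twistKernel (ρ : G →* GL (Fin n) (Loc p E)) : Set G :=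
  {g | ∀ σ χ, IsExtraTwist ρ σ χ → χ g = 1}

/-- The automorphism `ad(a)`, or `ad(a) ∘ (·)^{-T}` if `out` is true. -/
def twistAut {B : Type*} [CommRing B] (out : Bool) (a : GL (Fin n) B) :
    GL (Fin n) B →* GL (Fin n) B :=
  (MulAut.conj a).toMonoidHom.comp (if out then invTranspose else MonoidHom.id _)

/-- The cocycle `σ ↦ f_σ` on `Γ` with values in the automorphisms of `SL_n` over `E_p`. Here `f_σ` is
`ad(α_σ)` if `σ` is treated as an inner-twist and `ad(α_σ) ∘ (·)^{-T}` if it is treated as an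
outer-twist, and `f_σ(^σ ρ(h)) = ρ(h)` for all `h` in the kernel of all twisting characters. -/
structure TwistCocycle (ρ : G →* GL (Fin n) (Loc p E)) where
  out : extraTwists ρ → Bool
  inner_of_out_eq_false : ∀ σ, out σ = false → ∃ χ, IsInnerTwist ρ σ χ
  outer_of_out_eq_true : ∀ σ, out σ = true → ∃ χ, IsOuterTwist ρ σ χ
  α : extraTwists ρ → GL (Fin n) (Loc p E)
  apply_conjRep : ∀ σ, ∀ h ∈ twistKernel ρ, twistAut (out σ) (α σ) (conjRep σ ρ h) = ρ h

namespace TwistCocycle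

variable {ρ : G →* GL (Fin n) (Loc p E)} (f : TwistCocycle ρ)

/-- The twisted action `g ↦ f_σ(^σ g)` of `σ ∈ Γ` on `GL_n(E_p ⊗_{F_p} R)`, for an `F_p`-algebra
`R`. -/
def act (R : Type*) [CommRing R] [Algebra (Loc p (twistField ρ)) R] (σ : extraTwists ρ) :
    GL (Fin n) (Loc p E ⊗[Loc p (twistField ρ)] R) →*
      GL (Fin n) (Loc p E ⊗[Loc p (twistField ρ)] R) :=
  (twistAut (f.out σ) (GeneralLinearGroup.map
      (Algebra.TensorProduct.includeLeftRingHom :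
        Loc p E →+* Loc p E ⊗[Loc p (twistField ρ)] R) (f.α σ))).comp
    (GeneralLinearGroup.map (Algebra.TensorProduct.map
      (locAutOver p (twistField ρ) σ (apply_eq_of_mem_twistField σ.2))
      (AlgHom.id (Loc p (twistField ρ)) R)).toRingHom)

/-- The `R`-points of the algebraic group `H = (Res^{E_p}_{F_p} SL_n)^{tw_f(Γ)}` over `F_p`, a
subgroup of `SL_n(E_p ⊗_{F_p} R)`. -/
def points (R : Type*) [CommRing R] [Algebra (Loc p (twistField ρ)) R] :
    Subgroup (SpecialLinearGroup (Fin n) (Loc p E ⊗[Loc p (twistField ρ)] R)) where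
  carrier := {g | ∀ σ, f.act R σ (SpecialLinearGroup.toGL g) = SpecialLinearGroup.toGL g}
  one_mem' σ := by rw [map_one, map_one]
  mul_mem' ha hb σ := by rw [map_mul, map_mul, ha σ, hb σ]
  inv_mem' ha σ := by rw [map_inv, map_inv, ha σ]

/-- `H(F_p)` as a subgroup of `GL_n(E_p)`, by means of `E_p = E_p ⊗_{F_p} F_p`. -/
def rationalPoints : Subgroup (GL (Fin n) (Loc p E)) :=
  ((f.points (Loc p (twistField ρ))).comap (SpecialLinearGroup.map
    (Algebra.TensorProduct.includeLeftRingHom :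
      Loc p E →+* Loc p E ⊗[Loc p (twistField ρ)] Loc p (twistField ρ)))).map
    SpecialLinearGroup.toGL

end TwistCocycle

end Twists

/-- The subgroup `ℚ_p^×` of scalar matrices in `GL_n(E_p)`. -/
def padicScalars (p : ℕ) [Fact p.Prime] (E : Type*) [Field E] [CharZero E] (n : ℕ) :
    Subgroup (GL (Fin n) (Loc p E)) :=
  ((GeneralLinearGroup.scalar (Fin n)).comp
    (Units.map (algebraMap ℚ_[p] (Loc p E)).toMonoidHom)).range

/-! ### Removing the determinant -/

section Determinant

variable {p : ℕ} [Fact p.Prime] {E K Ω : Type*} [Field E] [CharZero E] [Field K] [Field Ω]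
  [Algebra K Ω] {n : ℕ}

/-- The restriction of `ρ` from `G_K` to `G_M`. -/
def restrictTo (M : IntermediateField K Ω) (ρ : Gal(Ω/K) →* GL (Fin n) (Loc p E)) :
    Gal(Ω/M) →* GL (Fin n) (Loc p E) :=
  ρ.comp (AlgEquiv.restrictScalarsHom K)

/-- A `ℤ_p^×`-valued character regarded as an `E_p^×`-valued one. -/
def toLocChar {G : Type*} [Group G] (δ : G →* ℤ_[p]ˣ) : G →* (Loc p E)ˣ :=
  (Units.map ((algebraMap ℚ_[p] (Loc p E)).comp PadicInt.Coe.ringHom).toMonoidHom).comp δ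

/-- `δ` is an `n`-th root of the restriction to `G_M` of the `p`-adic cyclotomic character. -/
def IsCyclotomicRoot (n : ℕ) (M : IntermediateField K Ω) (δ : Gal(Ω/M) →* ℤ_[p]ˣ) : Prop :=
  Continuous δ ∧ ∀ g : Gal(Ω/M), δ g ^ n = cyclotomicCharacter Ω p g.toRingEquiv

/-- `ρ' = ρ|_{G_M} ⊗ δ^{-m}`, where `δ` is an `n`-th root of the cyclotomic character of `G_M`. -/
def detTwist (M : IntermediateField K Ω) (ρ : Gal(Ω/K) →* GL (Fin n) (Loc p E))
    (δ : Gal(Ω/M) →* ℤ_[p]ˣ) (m : ℤ) : Gal(Ω/M) →* GL (Fin n) (Loc p E) :=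
  twist (restrictTo M ρ) (toLocChar (δ ^ (-m)))

end Determinant

end BigImage

end

open scoped TensorProduct Pointwise
open Matrix NumberField

noncomputable section

namespace BigImage

/-! ### The `p`-adic exponential and closed subgroups -/

section

open Filter Topology NormedSpace

section PadicExp

variable {p : ℕ} [Fact p.Prime]

/-! Let `W` be the `ℚ_p`-Lie algebra of the compact image of the valid representation `ρ'`; by the
`p`-adic closed subgroup theorem the image is `exp W` near the identity. Over `ℚ̄_p` the ring `E_p`
becomes a product over the embeddings of `E`, and the span `g` of `W` in the corresponding product
of matrix algebras projects onto `sl_n` in every factor. As `sl_n` is simple, Goursat's argument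
(`exists_finset_conjRelated`) shows that `g` is as large as possible, except that some pairs of
factors are linked by an automorphism of `sl_n`, which is a conjugation or minus a conjugated
transpose (`exists_conj_or_transpose`).

Every such link comes from an extra-twist (`exists_extraTwist_of_conjRelated`). If the factors `l =
m ∘ σ` and `m` are linked, then near the identity `l (tr ρ'(u))` equals `m` of the trace of `ρ'(u)`
or of its inverse. An embedding is injective on `E` but not on `E_p`, so this becomes an identity in
`E_p` only where the traces lie in `E`; powers of Frobenius elements provide a dense supply of such
points. A weak form of Frobenius density is enough: near the identity the image consists of
`ℤ_p`-powers, so only elements of `p`-power order modulo an open subgroup have to be approximated,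
and for these the simple pole at 1 of Dedekind zeta functions suffices. Equal traces on an open
subgroup whose image spans the matrix ring give an isomorphism there (`iso_of_trace_eq`), and
Schur's lemma extends it to the whole group up to a character (`exists_iso_twist`).

Conversely, each extra-twist imposes on `W` the linear relation obtained by differentiating `f_σ(^σ
g) = g`. Hence a traceless matrix satisfying all these relations has the same components as an
element of the span of `[g, g]`, and by descent to `ℚ_p` it lies in the span of `[W, W]`
(`IsLieOf.mem_span_lie_of_twistTangent_eq`). So `W` is the Lie algebra of `H` and is perfect.

Finally `ρ` restricted to `G_M` is the twist of `ρ'` by `δ^m`. Since `det ρ' = 1`, the twisting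
characters take values in `n`-th roots of unity, and all of them are trivial on some open subgroup
`N`. The Lie algebra `W'` of `ρ(N)` contains `W`, because scalars drop out of brackets and `W` is
perfect, and it contains `ℚ_p`, because `δ^m` is non-trivial arbitrarily close to 1. An element of
`H(F_p) · ℚ_p^×` near 1 has its logarithm in `W + ℚ_p ⊆ W'`, so it lies in `ρ(N)`. -/

theorem norm_inv_factorial_le (k : ℕ) : ‖((k.factorial : ℚ_[p])⁻¹)‖ ≤ (p : ℝ) ^ k := by
  have hp : (1 : ℝ) < p := by exact_mod_cast (Fact.out : p.Prime).one_lt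
  have hk : k.factorial ≠ 0 := k.factorial_ne_zero
  have h := sub_one_mul_padicValNat_factorial (p := p) k
  have hle : padicValNat p k.factorial ≤ k := by
    have h1 : 1 ≤ p - 1 := Nat.le_sub_one_of_lt (Fact.out : p.Prime).one_lt
    calc padicValNat p k.factorial ≤ (p - 1) * padicValNat p k.factorial :=
          Nat.le_mul_of_pos_left _ h1
      _ ≤ k := by rw [h]; exact Nat.sub_le _ _
  rw [norm_inv, Padic.norm_eq_zpow_neg_valuation (by exact_mod_cast hk), Padic.valuation_natCast,
    _root_.zpow_neg, inv_inv, zpow_natCast]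
  exact pow_le_pow_right₀ hp.le hle

variable (p) in
-- The crude estimate `v_p(k!) ≤ k` gives radius at least `1/p`, which is all that is needed.
theorem expSeries_radius_pos (A : Type*) [NormedRing A] [NormedAlgebra ℚ_[p] A] :
    0 < (expSeries ℚ_[p] A).radius := by
  have hp : (0 : ℝ) < p := by exact_mod_cast (Fact.out : p.Prime).pos
  refine lt_of_lt_of_le ?_ ((expSeries ℚ_[p] A).le_radius_of_bound (max 1 ‖(1 : A)‖)
    (r := (p : NNReal)⁻¹) fun k => ?_)
  · simp
  · have h1 : ‖expSeries ℚ_[p] A k‖ ≤ (p : ℝ) ^ k * max 1 ‖(1 : A)‖ := by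
      refine (norm_smul_le ((k.factorial : ℚ_[p])⁻¹)
        (ContinuousMultilinearMap.mkPiAlgebraFin ℚ_[p] k A)).trans ?_
      refine mul_le_mul (norm_inv_factorial_le k) ?_ (norm_nonneg _) (by positivity)
      rcases Nat.eq_zero_or_pos k with rfl | hk
      · rw [ContinuousMultilinearMap.norm_mkPiAlgebraFin_zero]; exact le_max_right _ _
      · exact (ContinuousMultilinearMap.norm_mkPiAlgebraFin_le_of_pos hk).trans (le_max_left _ _)
    calc _ ≤ ((p : ℝ) ^ k * max 1 ‖(1 : A)‖) * ((p : NNReal)⁻¹ : NNReal) ^ k := by gcongr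
      _ = max 1 ‖(1 : A)‖ := by
        push_cast
        rw [mul_comm, ← mul_assoc, ← mul_pow, inv_mul_cancel₀ hp.ne', one_pow, one_mul]

/-- A neighbourhood of zero in a topological `ℚ_p`-algebra, stable under `ℤ_p`, on which the
exponential series converges to a continuous injective function with the usual functional
equation. -/
structure IsExpNhd {B : Type*} [Ring B] [Algebra ℚ_[p] B] [TopologicalSpace B]
    [IsTopologicalRing B] (U : Set B) : Prop where
  mem_nhds : U ∈ 𝓝 0
  smul_mem : ∀ t : ℚ_[p], ‖t‖ ≤ 1 → ∀ x ∈ U, t • x ∈ U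
  summable : ∀ x ∈ U, Summable fun k : ℕ => ((k.factorial : ℚ_[p])⁻¹) • x ^ k
  exp_add : ∀ x ∈ U, ∀ y ∈ U, Commute x y → exp (x + y) = exp x * exp y
  continuousOn : ContinuousOn (exp : B → B) U
  injOn : Set.InjOn (exp : B → B) U

namespace IsExpNhd

variable {B : Type*} [Ring B] [Algebra ℚ_[p] B] [TopologicalSpace B] [IsTopologicalRing B]
  {U : Set B}

theorem exp_natCast_smul (hU : IsExpNhd (p := p) U) {x : B} (hx : x ∈ U) (k : ℕ) :
    exp ((k : ℚ_[p]) • x) = exp x ^ k := by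
  induction k with
  | zero => simp
  | succ k ih =>
    rw [Nat.cast_succ, add_smul, one_smul, hU.exp_add _ (hU.smul_mem _ ?_ _ hx) _ hx
      ((Commute.refl x).smul_left _), ih, pow_succ]
    exact_mod_cast (PadicInt.norm_le_one (k : ℤ_[p]))

theorem neg_mem (hU : IsExpNhd (p := p) U) {x : B} (hx : x ∈ U) : -x ∈ U := by
  have := hU.smul_mem (-1) (by simp) x hx
  simpa using this

theorem exp_mul_exp_neg (hU : IsExpNhd (p := p) U) {x : B} (hx : x ∈ U) :
    exp x * exp (-x) = 1 := by
  rw [← hU.exp_add _ hx _ (hU.neg_mem hx) ((Commute.refl x).neg_right), add_neg_cancel, exp_zero]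

theorem exp_neg_mul_exp (hU : IsExpNhd (p := p) U) {x : B} (hx : x ∈ U) :
    exp (-x) * exp x = 1 := by
  rw [← hU.exp_add _ (hU.neg_mem hx) _ hx ((Commute.refl x).neg_left), neg_add_cancel, exp_zero]

theorem map_exp (hU : IsExpNhd (p := p) U) {C : Type*} [Ring C] [Algebra ℚ_[p] C]
    [TopologicalSpace C] [IsTopologicalRing C] [T2Space C] (f : B →+* C) (hf : Continuous f)
    {x : B} (hx : x ∈ U) [T2Space B] : f (exp x) = exp (f x) := by
  rw [exp_eq_tsum ℚ_[p], exp_eq_tsum ℚ_[p]]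
  refine ((hU.summable x hx).hasSum.map f hf).tsum_eq.symm.trans ?_
  dsimp only [Function.comp_def]
  simp_rw [map_inv_natCast_smul f ℚ_[p] ℚ_[p], map_pow]

theorem continuous_exp_smul (hU : IsExpNhd (p := p) U) [ContinuousSMul ℚ_[p] B]
    {x : B} (hx : x ∈ U) :
    Continuous fun t : ℤ_[p] => exp ((t : ℚ_[p]) • x) :=
  hU.continuousOn.comp_continuous (by fun_prop) fun t => hU.smul_mem _ (PadicInt.norm_le_one t) x hx

end IsExpNhd

section Normed

variable {A : Type*} [NormedRing A] [NormedAlgebra ℚ_[p] A] [CompleteSpace A]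

variable (p A) in
theorem hasStrictFDerivAt_exp :
    HasStrictFDerivAt (exp : A → A) ((ContinuousLinearEquiv.refl ℚ_[p] A : A →L[ℚ_[p]] A)) 0 :=
  hasStrictFDerivAt_exp_zero_of_radius_pos (expSeries_radius_pos p A)

variable (p) in
-- A small ball inside the disc of convergence works; injectivity holds because the strict
-- derivative of `exp` at 0 is the identity.
theorem exists_isExpNhd_of_complete {V : Set A} (hV : V ∈ 𝓝 0) :
    ∃ U ⊆ V, IsExpNhd (p := p) U := by
  obtain ⟨T, hT, hinj⟩ : ∃ T ∈ 𝓝 (0 : A), Set.InjOn (exp : A → A) T := by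
    have h := (hasStrictFDerivAt_exp p A).eventually_left_inverse
    exact ⟨_, h, fun x hx y hy hxy => by rw [← hx, ← hy, hxy]⟩
  have hb : Metric.eball (0 : A) (expSeries ℚ_[p] A).radius ∈ 𝓝 0 :=
    Metric.eball_mem_nhds _ (expSeries_radius_pos p A)
  obtain ⟨ε, hε, hsub⟩ := Metric.mem_nhds_iff.1 (inter_mem hV (inter_mem hT hb))
  refine ⟨Metric.ball 0 ε, fun x hx => (hsub hx).1, Metric.ball_mem_nhds _ hε, ?_, ?_, ?_, ?_, ?_⟩
  · intro t ht x hx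
    rw [mem_ball_zero_iff] at hx ⊢
    rw [norm_smul]
    exact (mul_le_of_le_one_left (norm_nonneg _) ht).trans_lt hx
  · exact fun x hx => expSeries_summable_of_mem_ball' x (hsub hx).2.2
  · exact fun x hx y hy h => exp_add_of_commute_of_mem_ball h (hsub hx).2.2 (hsub hy).2.2
  · exact (continuousOn_exp (𝕂 := ℚ_[p])).mono fun x hx => (hsub hx).2.2
  · exact hinj.mono fun x hx => (hsub hx).2.1

theorem map_exp_nhds_zero_of_complete (p : ℕ) [Fact p.Prime] (A : Type*) [NormedRing A]
    [NormedAlgebra ℚ_[p] A] [CompleteSpace A] : map (exp : A → A) (𝓝 0) = 𝓝 1 := by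
  have := (hasStrictFDerivAt_exp p A).map_nhds_eq_of_equiv
  rwa [exp_zero] at this

variable (p) in
theorem hasDerivAt_exp_smul (x : A) : HasDerivAt (fun t : ℚ_[p] => exp (t • x)) x 0 := by
  have h1 : HasDerivAt (fun t : ℚ_[p] => t • x) x 0 := by
    simpa using (hasDerivAt_id (0 : ℚ_[p])).smul_const x
  have h2 : HasFDerivAt (exp : A → A) (ContinuousLinearEquiv.refl ℚ_[p] A : A →L[ℚ_[p]] A)
      ((0 : ℚ_[p]) • x) := by
    rw [zero_smul]; exact (hasStrictFDerivAt_exp p A).hasFDerivAt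
  exact h2.comp_hasDerivAt (0 : ℚ_[p]) h1

/-- At a point where all factors equal 1 the non-commutative Leibniz rule loses its side factors. -/
theorem hasStrictFDerivAt_list_prod_of_eq_one {V ι : Type*} [NormedAddCommGroup V]
    [NormedSpace ℚ_[p] V] {f : ι → V → A} {f' : ι → V →L[ℚ_[p]] A} {x : V} (l : List ι)
    (hf : ∀ i, HasStrictFDerivAt (f i) (f' i) x) (hx : ∀ i, f i x = 1) :
    HasStrictFDerivAt (fun v => (l.map fun i => f i v).prod) (l.map f').sum x := by
  induction l with
  | nil => simpa using hasStrictFDerivAt_const (1 : A) x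
  | cons i l ih =>
    simp only [List.map_cons, List.prod_cons, List.sum_cons]
    refine ((hf i).mul' ih).congr_fderiv ?_
    ext v
    simp [hx, add_comm]

section ClosedSubgroup

variable [FiniteDimensional ℚ_[p] A] (H : Subgroup Aˣ)

/-- A closed subgroup of the unit group of a finite-dimensional `ℚ_p`-algebra is, near the
identity, the exponential of a `ℚ_p`-subspace that is closed under commutators. -/
theorem exists_lie_submodule_of_complete (hH : IsClosed (Units.val '' (H : Set Aˣ))) :
    ∃ W : Submodule ℚ_[p] A,
      (∀ᶠ x in 𝓝 (0 : A), exp x ∈ Units.val '' (H : Set Aˣ) ↔ x ∈ W) ∧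
      ∀ x ∈ W, ∀ y ∈ W, x * y - y * x ∈ W := by
  set S : Set A := Units.val '' (H : Set Aˣ) with hS
  have hmul : ∀ a ∈ S, ∀ b ∈ S, a * b ∈ S := by
    rintro _ ⟨a, ha, rfl⟩ _ ⟨b, hb, rfl⟩
    exact ⟨a * b, H.mul_mem ha hb, by simp⟩
  have hone : (1 : A) ∈ S := ⟨1, H.one_mem, rfl⟩
  obtain ⟨U, -, hU⟩ := exists_isExpNhd_of_complete p (A := A) univ_mem
  set Λ : Set A := {x | x ∈ U ∧ exp x ∈ S} with hΛ
  have hpow : ∀ a ∈ S, ∀ k : ℕ, a ^ k ∈ S := by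
    intro a ha k
    induction k with
    | zero => simpa using hone
    | succ k ih => rw [pow_succ]; exact hmul _ ih _ ha
  have hsmul : ∀ t : ℚ_[p], ‖t‖ ≤ 1 → ∀ x ∈ Λ, t • x ∈ Λ := by
    intro t ht x hx
    refine ⟨hU.smul_mem t ht x hx.1, ?_⟩
    -- Stability under natural multiples is clear from powers; closedness of `S` and density of `ℕ`
    -- in `ℤ_p` extend it to `ℤ_p`.
    have hcl : IsClosed {t : ℤ_[p] | exp ((t : ℚ_[p]) • x) ∈ S} :=
      hH.preimage (hU.continuous_exp_smul hx.1)
    have := (hcl.closure_subset_iff (s := Set.range ((↑) : ℕ → ℤ_[p]))).2 ?_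
    · rw [PadicInt.denseRange_natCast.closure_range] at this
      exact this (Set.mem_univ ⟨t, ht⟩)
    · rintro _ ⟨k, rfl⟩
      simpa [hU.exp_natCast_smul hx.1] using hpow _ hx.2 k
  -- `Λ` is not yet known to be additive. That its span contains no further small elements is what
  -- the chart below establishes.
  set W := Submodule.span ℚ_[p] Λ with hW
  obtain ⟨d, b, hbΛ, hbspan⟩ : ∃ (d : ℕ) (b : Fin d → A), (∀ i, b i ∈ Λ) ∧
      Submodule.span ℚ_[p] (Set.range b) = W :=
    let ⟨b, h1, h2, _⟩ := Submodule.exists_fun_fin_finrank_span_eq ℚ_[p] Λ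
    ⟨_, b, h1, h2⟩
  have : CompleteSpace W := FiniteDimensional.complete ℚ_[p] W
  -- the chart of the second kind
  let Ψ : (Fin d → ℚ_[p]) → A := fun t => ((List.finRange d).map fun i => exp (t i • b i)).prod
  have hΨ0 : Ψ 0 = 1 := by simp [Ψ]
  let L : (Fin d → ℚ_[p]) →L[ℚ_[p]] A :=
    ∑ i, (ContinuousLinearMap.proj i : (Fin d → ℚ_[p]) →L[ℚ_[p]] ℚ_[p]).smulRight (b i)
  have hexp : ∀ i, HasStrictFDerivAt (fun t : Fin d → ℚ_[p] => exp (t i • b i))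
      ((ContinuousLinearMap.proj i : (Fin d → ℚ_[p]) →L[ℚ_[p]] ℚ_[p]).smulRight (b i)) 0 := by
    intro i
    have h1 := ((ContinuousLinearMap.proj i :
      (Fin d → ℚ_[p]) →L[ℚ_[p]] ℚ_[p]).smulRight (b i)).hasStrictFDerivAt (x := 0)
    have h2 : HasStrictFDerivAt (exp : A → A) (ContinuousLinearEquiv.refl ℚ_[p] A : A →L[ℚ_[p]] A)
        (((ContinuousLinearMap.proj i :
          (Fin d → ℚ_[p]) →L[ℚ_[p]] ℚ_[p]).smulRight (b i)) 0) := by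
      rw [map_zero]; exact hasStrictFDerivAt_exp p A
    exact h2.comp _ h1
  have hΨ : HasStrictFDerivAt Ψ L 0 := by
    have := hasStrictFDerivAt_list_prod_of_eq_one (List.finRange d) hexp (by simp)
    rwa [← Fin.sum_univ_def] at this
  let log : A → A := (hasStrictFDerivAt_exp p A).localInverse _ _ _
  have hlog : HasStrictFDerivAt log (ContinuousLinearEquiv.refl ℚ_[p] A : A →L[ℚ_[p]] A) 1 := by
    have := (hasStrictFDerivAt_exp p A).to_localInverse
    rwa [exp_zero] at this
  have hlog1 : log 1 = 0 := by
    have := (hasStrictFDerivAt_exp p A).localInverse_apply_image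
    rwa [exp_zero] at this
  have hexplog : ∀ᶠ y in 𝓝 (1 : A), exp (log y) = y := by
    have := (hasStrictFDerivAt_exp p A).eventually_right_inverse
    rwa [exp_zero] at this
  obtain ⟨q, hq⟩ := W.subtype.exists_leftInverse_of_injective W.ker_subtype
  have hq' : ∀ x (hx : x ∈ W), q x = ⟨x, hx⟩ := fun x hx => LinearMap.congr_fun hq ⟨x, hx⟩
  -- That `log (Ψ t)` lies in `W` is known only for small `t`. Projecting to `W` gives a map whose
  -- derivative at 0 is onto, as the `b i` span `W`, so it carries neighbourhoods of 0 onto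
  -- neighbourhoods of 0 in `W`. For small `t` the projection changes nothing, and every small
  -- element of `W` is thus a logarithm of an element of `S`.
  let π : A →L[ℚ_[p]] W := LinearMap.toContinuousLinearMap q
  have hF : HasStrictFDerivAt (fun t => π (log (Ψ t))) (π.comp L) 0 := by
    have h1 : HasStrictFDerivAt log (ContinuousLinearEquiv.refl ℚ_[p] A : A →L[ℚ_[p]] A) (Ψ 0) := by
      rw [hΨ0]; exact hlog
    exact π.hasStrictFDerivAt.comp _ (h1.comp _ hΨ)
  have hsurj : (π.comp L).range = ⊤ := by
    rw [LinearMap.range_eq_top]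
    rintro ⟨w, hw⟩
    have hw' := hw
    rw [← hbspan] at hw'
    obtain ⟨c, hc⟩ := (Submodule.mem_span_range_iff_exists_fun _).1 hw'
    refine ⟨c, ?_⟩
    have hLc : L c = w := by simpa [L] using hc
    change q (L c) = _
    rw [hLc, hq' w hw]
  have hmap := hF.map_nhds_eq_of_surj hsurj
  simp only [hΨ0, hlog1, map_zero] at hmap
  have hev : ∀ᶠ t in 𝓝 (0 : Fin d → ℚ_[p]), exp (π (log (Ψ t)) : A) ∈ S := by
    have hΨc : Tendsto Ψ (𝓝 0) (𝓝 1) := by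
      simpa [hΨ0] using hΨ.continuousAt.tendsto
    have hlogc : Tendsto log (𝓝 1) (𝓝 0) := by
      simpa [hlog1] using hlog.continuousAt.tendsto
    filter_upwards [hΨc.eventually hexplog, (hlogc.comp hΨc).eventually hU.mem_nhds,
      Metric.ball_mem_nhds (0 : Fin d → ℚ_[p]) one_pos] with t h1 h2 h3
    have hΨS : Ψ t ∈ S := by
      have : ∀ l : List (Fin d), (l.map fun i => exp (t i • b i)).prod ∈ S := by
        intro l
        induction l with
        | nil => simpa using hone
        | cons i l ih =>
          rw [List.map_cons, List.prod_cons]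
          refine hmul _ (hsmul (t i) ?_ _ (hbΛ i)).2 _ ih
          exact (norm_le_pi_norm t i).trans (mem_ball_zero_iff.1 h3).le
      exact this _
    have hmem : log (Ψ t) ∈ W := Submodule.subset_span ⟨h2, by rw [h1]; exact hΨS⟩
    have : (π (log (Ψ t)) : A) = log (Ψ t) := by
      change ((q (log (Ψ t)) : W) : A) = _
      rw [hq' _ hmem]
    rw [this, h1]; exact hΨS
  have hev' : ∀ᶠ w : W in 𝓝 0, exp (w : A) ∈ S := by
    rw [← hmap]; exact hev
  refine ⟨W, ?_, ?_⟩
  · rw [show 𝓝 (0 : W) = comap Subtype.val (𝓝 (0 : A)) from nhds_induced _ _,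
      eventually_comap] at hev'
    filter_upwards [hev', hU.mem_nhds] with x h1 h2
    exact ⟨fun h => Submodule.subset_span ⟨h2, h⟩, fun h => h1 ⟨x, h⟩ rfl⟩
  -- The curve `exp(tx) y exp(-tx)` stays in the closed subspace `W`, and its derivative at 0 is the
  -- bracket.
  · have key : ∀ x ∈ Λ, ∀ y ∈ Λ, x * y - y * x ∈ W := by
      intro x hx y hy
      have hmem : ∀ t : ℚ_[p], ‖t‖ ≤ 1 → exp (t • x) * y * exp (-(t • x)) ∈ W := by
        intro t ht
        have htx := hsmul t ht x hx
        obtain ⟨h, hh, hhx⟩ := htx.2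
        have hinv : ((h⁻¹ : Aˣ) : A) = exp (-(t • x)) := by
          rw [← mul_one ((h⁻¹ : Aˣ) : A), ← hU.exp_mul_exp_neg htx.1, ← mul_assoc, ← hhx,
            Units.inv_mul, one_mul]
        rw [← hhx, ← hinv]
        -- The conjugate of `y` may be too large for the exponential; it is scaled down by some `s ≠
        -- 0` and scaled back inside `W`.
        have htend : Tendsto (fun s : ℚ_[p] => s • ((h : A) * y * ((h⁻¹ : Aˣ) : A))) (𝓝[≠] 0)
            (𝓝 0) := by
          refine (Continuous.tendsto' (by fun_prop) _ _ (by simp)).mono_left nhdsWithin_le_nhds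
        obtain ⟨s, hs1, hs2, hs3⟩ := ((htend.eventually hU.mem_nhds).and
          ((eventually_mem_nhdsWithin).and (nhdsWithin_le_nhds
            (Metric.closedBall_mem_nhds (0 : ℚ_[p]) one_pos)))).exists
        have hs3' : ‖s‖ ≤ 1 := by simpa using hs3
        have hconj : exp (s • ((h : A) * y * ((h⁻¹ : Aˣ) : A))) =
            (h : A) * exp (s • y) * ((h⁻¹ : Aˣ) : A) := by
          have := hU.map_exp ((MulSemiringAction.toRingHom (ConjAct Aˣ) A (ConjAct.toConjAct h)))
            (continuous_const_smul _) (hU.smul_mem s hs3' y hy.1)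
          simp only [MulSemiringAction.toRingHom_apply, ConjAct.units_smul_def,
            ConjAct.ofConjAct_toConjAct] at this
          rw [this, mul_smul_comm, smul_mul_assoc]
        have hin : s • ((h : A) * y * ((h⁻¹ : Aˣ) : A)) ∈ Λ := by
          refine ⟨hs1, ?_⟩
          rw [hconj]
          exact hmul _ (hmul _ ⟨h, hh, rfl⟩ _ (hsmul s hs3' y hy).2) _ ⟨h⁻¹, H.inv_mem hh, rfl⟩
        have := W.smul_mem s⁻¹ (Submodule.subset_span hin)
        rwa [smul_smul, inv_mul_cancel₀ hs2, one_smul] at this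
      have hd : HasDerivAt (fun t : ℚ_[p] => exp (t • x) * y * exp (t • (-x)))
          (x * y - y * x) 0 := by
        have := ((hasDerivAt_exp_smul p x).mul_const y).mul (hasDerivAt_exp_smul p (-x))
        refine this.congr_deriv ?_
        simp [sub_eq_add_neg]
      rw [hasDerivAt_iff_tendsto_slope] at hd
      refine W.closed_of_finiteDimensional.mem_of_tendsto hd ?_
      filter_upwards [nhdsWithin_le_nhds (Metric.closedBall_mem_nhds (0 : ℚ_[p]) one_pos)] with t ht
      rw [slope_def_module]
      refine W.smul_mem _ (W.sub_mem ?_ ?_)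
      · simpa using hmem t (by simpa using ht)
      · simpa using Submodule.subset_span hy
    intro x hx y hy
    induction hx using Submodule.span_induction with
    | zero => simp
    | add x x' _ _ h h' =>
      have := W.add_mem h h'
      rwa [show (x * y - y * x) + (x' * y - y * x') = (x + x') * y - y * (x + x') by
        noncomm_ring] at this
    | smul c x _ h => simpa [smul_sub] using W.smul_mem c h
    | mem x hx =>
      induction hy using Submodule.span_induction with
      | zero => simp
      | add y y' _ _ h h' =>
        have := W.add_mem h h'
        rwa [show (x * y - y * x) + (x * y' - y' * x) = x * (y + y') - (y + y') * x by
          noncomm_ring] at this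
      | smul c y _ h => simpa [smul_sub] using W.smul_mem c h
      | mem y hy => exact key x hx y hy

end ClosedSubgroup

end Normed

section Topological

/-- The local theory of the exponential map of a finite-dimensional `ℚ_p`-algebra. -/
structure HasPadicExp (p : ℕ) [Fact p.Prime] (B : Type*) [Ring B] [Algebra ℚ_[p] B]
    [TopologicalSpace B] [IsTopologicalRing B] : Prop where
  exists_isExpNhd : ∀ V ∈ 𝓝 (0 : B), ∃ U ⊆ V, IsExpNhd (p := p) U
  map_exp_nhds_zero : map (exp : B → B) (𝓝 0) = 𝓝 1
  tendsto_slope : ∀ x : B, Tendsto (fun t : ℚ_[p] => t⁻¹ • (exp (t • x) - 1)) (𝓝[≠] 0) (𝓝 x)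
  exists_lie_submodule : ∀ H : Subgroup Bˣ, IsClosed (Units.val '' (H : Set Bˣ)) →
    ∃ W : Submodule ℚ_[p] B,
      (∀ᶠ x in 𝓝 (0 : B), exp x ∈ Units.val '' (H : Set Bˣ) ↔ x ∈ W) ∧
      ∀ x ∈ W, ∀ y ∈ W, x * y - y * x ∈ W

theorem hasPadicExp_of_normed (A : Type*) [NormedRing A] [NormedAlgebra ℚ_[p] A]
    [FiniteDimensional ℚ_[p] A] : HasPadicExp p A := by
  have : CompleteSpace A := FiniteDimensional.complete ℚ_[p] A
  refine ⟨fun V hV => exists_isExpNhd_of_complete p hV, map_exp_nhds_zero_of_complete p A,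
    fun x => ?_, fun H => exists_lie_submodule_of_complete H⟩
  have := (hasDerivAt_exp_smul p x).tendsto_slope_zero
  simpa using this

theorem eq_moduleTopology_of_normed (A : Type*) [NormedRing A] [NormedAlgebra ℚ_[p] A]
    [FiniteDimensional ℚ_[p] A] :
    (inferInstance : TopologicalSpace A) = moduleTopology ℚ_[p] A :=
  have := isModuleTopologyOfFiniteDimensional (𝕜 := ℚ_[p]) (E := A)
  eq_moduleTopology ℚ_[p] A

/-- No norm is given on `B`. The left regular representation embeds it into an algebra of
endomorphisms and induces one, whose topology has to be the module topology. -/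
theorem hasPadicExp (B : Type*) [Ring B] [Algebra ℚ_[p] B] [FiniteDimensional ℚ_[p] B]
    [τ : TopologicalSpace B] [IsTopologicalRing B] [hτ : IsModuleTopology ℚ_[p] B] :
    HasPadicExp p B := by
  let b := Module.finBasis ℚ_[p] B
  let j : B →ₐ[ℚ_[p]] ((Fin (Module.finrank ℚ_[p] B) → ℚ_[p]) →L[ℚ_[p]]
      (Fin (Module.finrank ℚ_[p] B) → ℚ_[p])) :=
    ((Module.End.toContinuousLinearMap (𝕜 := ℚ_[p])
      (Fin (Module.finrank ℚ_[p] B) → ℚ_[p])).toAlgHom.comp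
      (Matrix.toLinAlgEquiv' : Matrix _ _ ℚ_[p] ≃ₐ[ℚ_[p]] _).toAlgHom).comp
      (Algebra.leftMulMatrix b)
  have hj : Function.Injective j := by
    intro x y hxy
    exact Algebra.leftMulMatrix_injective b (Matrix.toLinAlgEquiv'.injective
      ((Module.End.toContinuousLinearMap (𝕜 := ℚ_[p]) _).injective hxy))
  let nr : NormedRing B := NormedRing.induced B _ j hj
  let na : NormedAlgebra ℚ_[p] B := NormedAlgebra.induced ℚ_[p] B _ j
  have heq : τ = nr.toUniformSpace.toTopologicalSpace := by
    rw [@eq_moduleTopology ℚ_[p] _ B _ _ τ hτ]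
    exact (@eq_moduleTopology_of_normed p _ B nr na _).symm
  subst heq
  exact hasPadicExp_of_normed B

end Topological

end PadicExp

end

/-! ### Simplicity and automorphisms of `sl_n` -/

section

section SpecialLinear

variable {k ι : Type*} [Field k] [Fintype ι] [DecidableEq ι]

/-- Subtracting the same `single o o 1` from every diagonal unit changes `Z` by a multiple of its
trace. -/
theorem mem_of_trace_eq_zero (I : Submodule k (Matrix ι ι k))
    (h : ∀ i j, i ≠ j → single i j 1 ∈ I)
    (h' : ∀ i j, single i i 1 - single j j 1 ∈ I) {Z : Matrix ι ι k} (hZ : Z.trace = 0) :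
    Z ∈ I := by
  rcases isEmpty_or_nonempty ι with hι | ⟨⟨o⟩⟩
  · rw [Subsingleton.elim Z 0]; exact I.zero_mem
  have hsum : Z = ∑ i, ∑ j, Z i j • (single i j (1 : k) - if i = j then single o o 1 else 0) := by
    simp_rw [smul_sub, Finset.sum_sub_distrib]
    have : ∑ i, ∑ j, Z i j • (if i = j then single o o (1 : k) else 0) = 0 := by
      simp only [smul_ite, smul_zero, Finset.sum_ite_eq, Finset.mem_univ, if_true]
      rw [← Finset.sum_smul]
      have : ∑ i, Z i i = 0 := hZ
      rw [this, zero_smul]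
    rw [this, sub_zero]
    conv_lhs => rw [matrix_eq_sum_single Z]
    simp
  rw [hsum]
  refine I.sum_mem fun i _ => I.sum_mem fun j _ => I.smul_mem _ ?_
  split_ifs with hij
  · subst hij; exact h' i o
  · rw [sub_zero]; exact h i j hij

/-- Perfectness of `sl_n`: root vectors come from `[h, e] = 2e` and coroots from `[e, f] = h`. -/
theorem exists_mul_sub_mul_span [CharZero k] {Z : Matrix ι ι k} (hZ : Z.trace = 0) :
    Z ∈ Submodule.span k {C : Matrix ι ι k | ∃ A B : Matrix ι ι k, A.trace = 0 ∧ B.trace = 0 ∧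
      C = A * B - B * A} := by
  refine mem_of_trace_eq_zero _ (fun i j hij => ?_) (fun i j => ?_) hZ
  · have : single i j (1 : k) = (2 : k)⁻¹ • ((single i i 1 - single j j 1) * single i j 1 -
        single i j 1 * (single i i 1 - single j j 1)) := by
      have h2 : (2 : k)⁻¹ * (1 + 1) = 1 := by norm_num
      simp [sub_mul, mul_sub, hij.symm, ← single_add, h2]
    rw [this]
    refine Submodule.smul_mem _ _ (Submodule.subset_span ⟨_, _, ?_, ?_, rfl⟩)
    · simp [trace_sub]
    · exact trace_single_eq_of_ne _ _ _ hij
  · rcases eq_or_ne i j with rfl | hij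
    · simp
    · refine Submodule.subset_span ⟨single i j 1, single j i 1, trace_single_eq_of_ne _ _ _ hij,
        trace_single_eq_of_ne _ _ _ hij.symm, ?_⟩
      simp

/-- The Lie algebra of matrices of trace zero has no non-trivial ideals. -/
theorem mem_ideal_of_trace_eq_zero [CharZero k] (I : Submodule k (Matrix ι ι k))
    (hI : ∀ X ∈ I, X.trace = 0)
    (had : ∀ A : Matrix ι ι k, A.trace = 0 → ∀ X ∈ I, A * X - X * A ∈ I)
    (hne : ∃ X ∈ I, X ≠ 0) {Z : Matrix ι ι k} (hZ : Z.trace = 0) : Z ∈ I := by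
  obtain ⟨X, hX, hX0⟩ := hne
  have tr : ∀ {i j : ι}, i ≠ j → (single i j (1 : k)).trace = 0 :=
    fun hij => trace_single_eq_of_ne _ _ _ hij
  -- an elementary matrix lies in the ideal
  obtain ⟨i, j, hij, hmem⟩ : ∃ i j, i ≠ j ∧ single i j (1 : k) ∈ I := by
    by_cases hd : ∃ i j, i ≠ j ∧ X j i ≠ 0
    · obtain ⟨i, j, hij, hx⟩ := hd
      refine ⟨i, j, hij, ?_⟩
      have h2 := had _ (tr hij) _ (had _ (tr hij) _ hX)
      -- Applying `ad (single i j 1)` twice isolates the entry `X j i`, because `single i j 1` has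
      -- square zero.
      have : single i j (1 : k) * (single i j 1 * X - X * single i j 1) -
          (single i j 1 * X - X * single i j 1) * single i j 1 = (-2 * X j i) • single i j 1 := by
        have h0 : single i j (1 : k) * single i j 1 = 0 := by simp [hij.symm]
        have h1 : single i j (1 : k) * X * single i j 1 = X j i • single i j 1 := by
          rw [single_mul_mul_single]; simp
        calc _ = (single i j (1 : k) * single i j 1) * X - (single i j 1 * X * single i j 1) -
              (single i j 1 * X * single i j 1) + X * (single i j 1 * single i j 1) := by
              noncomm_ring
          _ = _ := by rw [h0, h1, zero_mul, mul_zero]; module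
      rw [this] at h2
      have hc : (-2 * X j i) ≠ 0 := mul_ne_zero (by norm_num) hx
      exact (I.smul_mem_iff hc).1 h2
    · push Not at hd
      -- Now `X` is diagonal; with equal entries and trace zero it would vanish in characteristic
      -- zero.
      obtain ⟨i, j, hij, hx⟩ : ∃ i j, i ≠ j ∧ X i i ≠ X j j := by
        by_contra! hcon
        apply hX0
        have hX' := hI X hX
        ext a b
        rcases eq_or_ne a b with rfl | hab
        · have : X.trace = Fintype.card ι • X a a := by
            rw [Matrix.trace, ← Finset.card_univ, ← Finset.sum_const]
            refine Finset.sum_congr rfl fun c _ => ?_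
            rcases eq_or_ne c a with rfl | hca
            · rfl
            · exact hcon c a hca
          rw [this] at hX'
          have : Nonempty ι := ⟨a⟩
          simpa using hX'
        · exact hd b a hab.symm
      refine ⟨i, j, hij, ?_⟩
      have h2 := had _ (tr hij) _ hX
      have : single i j (1 : k) * X - X * single i j 1 = (X j j - X i i) • single i j 1 := by
        ext a b
        simp only [Matrix.sub_apply, Matrix.smul_apply, smul_eq_mul]
        rcases eq_or_ne a i with rfl | ha
        · rcases eq_or_ne b j with rfl | hb
          · simp
          · simp [hb, hb.symm, hd _ _ hb]
        · rcases eq_or_ne b j with rfl | hb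
          · simp [ha, ha.symm, hd _ _ ha.symm]
          · simp [ha, ha.symm, hb, hb.symm]
      rw [this] at h2
      have hc : (X j j - X i i) ≠ 0 := sub_ne_zero.2 hx.symm
      exact (I.smul_mem_iff hc).1 h2
  have hrow : ∀ l, l ≠ j → single l j (1 : k) ∈ I := by
    intro l hl
    rcases eq_or_ne l i with rfl | hli
    · exact hmem
    · simpa [hl.symm, hl] using had _ (tr hli) _ hmem
  have hall : ∀ a b, a ≠ b → single a b (1 : k) ∈ I := by
    intro a b hab
    rcases eq_or_ne b j with rfl | hbj
    · exact hrow a hab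
    rcases eq_or_ne a j with rfl | haj
    · have h1 : single a a (1 : k) - single b b 1 ∈ I := by
        simpa using had _ (tr hab) _ (hrow b hab.symm)
      have h2 := had _ (tr hab) _ h1
      have : single a b (1 : k) * (single a a 1 - single b b 1) -
          (single a a 1 - single b b 1) * single a b 1 = (-2 : k) • single a b 1 := by
        simp only [mul_sub, sub_mul, single_mul_single_same, ne_eq, hab.symm,
          not_false_eq_true, single_mul_single_of_ne, mul_one]
        module
      rw [this] at h2
      exact (I.smul_mem_iff (by norm_num)).1 h2
    · have := I.neg_mem (had _ (tr hbj.symm) _ (hrow a haj))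
      simpa [hab.symm] using this
  refine mem_of_trace_eq_zero I hall (fun a b => ?_) hZ
  rcases eq_or_ne a b with rfl | hab
  · simp
  · simpa using had _ (tr hab) _ (hall b a hab.symm)

section Automorphisms

/-- A non-zero nilpotent matrix `X` with `[X, [X, Y]] ∈ k X` for all `Y` has rank one. -/
theorem exists_eq_vecMulVec [CharZero k] {X : Matrix ι ι k} (hX0 : X ≠ 0) (hnil : IsNilpotent X)
    (hX : ∀ Y, ∃ c : k, X * (X * Y - Y * X) - (X * Y - Y * X) * X = c • X) :
    ∃ v φ : ι → k, X = vecMulVec v φ := by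
  obtain ⟨l, hl, hl'⟩ : ∃ l, X ^ (l + 1) ≠ 0 ∧ X ^ (l + 2) = 0 := by
    classical
    have hex : ∃ m, X ^ m = 0 := hnil
    have h0 := Nat.find_spec hex
    have hmin := fun m (h : m < Nat.find hex) => Nat.find_min hex h
    obtain ⟨l, hl⟩ : ∃ l, Nat.find hex = l + 2 := by
      have h1 : Nat.find hex ≠ 0 := by
        intro h; rw [h, pow_zero] at h0
        exact hX0 (by rw [← mul_one X, h0, mul_zero])
      have h2 : Nat.find hex ≠ 1 := by
        intro h; rw [h, pow_one] at h0; exact hX0 h0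
      exact ⟨Nat.find hex - 2, by omega⟩
    refine ⟨l, hmin _ (by omega), ?_⟩
    rw [hl] at h0; exact h0
  set N := X ^ (l + 1) with hN
  obtain ⟨a, b, hab⟩ : ∃ a b, N a b ≠ 0 := by
    by_contra! h; exact hl (by ext; simp [h])
  -- For this `Y` the two outer terms of the double bracket contain `X ^ (l + 2) = 0`. What remains
  -- is `-2 N (single b a 1) N`, of rank one with non-zero entry at `(a, b)`.
  obtain ⟨c, hc⟩ := hX (X ^ l * single b a 1 * X ^ l)
  have h1 : X * (X * (X ^ l * single b a 1 * X ^ l) - (X ^ l * single b a 1 * X ^ l) * X) -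
      (X * (X ^ l * single b a 1 * X ^ l) - (X ^ l * single b a 1 * X ^ l) * X) * X =
      (-2 : k) • (N * single b a 1 * N) := by
    have e1 : X * (X * X ^ l) = 0 := by rw [← pow_succ', ← pow_succ', hl']
    have e2 : X ^ l * X * X = 0 := by rw [← pow_succ, ← pow_succ, hl']
    have e3 : X * X ^ l = N := by rw [← pow_succ']
    have e4 : X ^ l * X = N := by rw [← pow_succ]
    calc _ = (X * (X * X ^ l)) * single b a 1 * X ^ l
          - (X * X ^ l) * single b a 1 * (X ^ l * X) - (X * X ^ l) * single b a 1 * (X ^ l * X)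
          + X ^ l * single b a 1 * (X ^ l * X * X) := by noncomm_ring
      _ = _ := by rw [e1, e2, e3, e4, zero_mul, zero_mul, mul_zero]; module
  have h2 : N * single b a 1 * N = vecMulVec (fun i => N i b) (fun j => N a j) := by
    ext i j
    rw [mul_assoc, mul_apply, vecMulVec_apply, Finset.sum_eq_single b]
    · simp
    · intro x _ hx; simp [hx]
    · simp
  rw [h1, h2] at hc
  have hc0 : c ≠ 0 := by
    rintro rfl
    have := congrFun (congrFun hc a) b
    simp [vecMulVec_apply, hab] at this
  refine ⟨fun i => c⁻¹ * (-2) * N i b, fun j => N a j, ?_⟩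
  rw [← inv_smul_smul₀ hc0 X, ← hc]
  ext i j
  simp [vecMulVec_apply]; ring

/-- Each non-zero `X ^ m` is an eigenvector of `ad D` with eigenvalue `m`; in characteristic zero
these are distinct, and there can be only finitely many. -/
theorem isNilpotent_of_mul_sub_mul_eq_self [CharZero k] {D X : Matrix ι ι k}
    (h : D * X - X * D = X) : IsNilpotent X := by
  by_contra hnil
  have hpow : ∀ m : ℕ, D * X ^ m - X ^ m * D = (m : k) • X ^ m := by
    intro m
    induction m with
    | zero => simp
    | succ m ih =>
      rw [pow_succ]
      calc _ = (D * X ^ m - X ^ m * D) * X + X ^ m * (D * X - X * D) := by noncomm_ring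
        _ = _ := by rw [ih, h]; push_cast; rw [add_smul, one_smul, smul_mul_assoc]
  let ad : Module.End k (Matrix ι ι k) :=
    LinearMap.mulLeft k D - LinearMap.mulRight k D
  have hev : ∀ m : ℕ, ad.HasEigenvalue (m : k) := by
    intro m
    refine Module.End.hasEigenvalue_of_hasEigenvector (x := X ^ m)
      ⟨Module.End.mem_eigenspace_iff.2 (hpow m), fun h0 => hnil ⟨m, h0⟩⟩
  have hfin : {μ | ad.HasEigenvalue μ}.Finite := Module.End.finite_hasEigenvalue ad
  exact Set.infinite_range_of_injective (Nat.cast_injective (R := k))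
    (hfin.subset (by rintro _ ⟨m, rfl⟩; exact hev m))

/-- A subspace of matrices of rank at most one has a common column or a common row. -/
theorem exists_common_vector {κ : Type*} {v φ : κ → ι → k}
    (hv : ∀ j, v j ≠ 0) (hφ : ∀ j, φ j ≠ 0)
    (h : ∀ i j, ∃ w ψ : ι → k, vecMulVec (v i) (φ i) + vecMulVec (v j) (φ j) = vecMulVec w ψ)
    (o : κ) : (∀ j, ∃ c : k, v j = c • v o) ∨ (∀ j, ∃ c : k, φ j = c • φ o) := by
  have key : ∀ i j, (∃ c : k, v j = c • v i) ∨ (∃ c : k, φ j = c • φ i) := by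
    intro i j
    obtain ⟨w, ψ, hw⟩ := h i j
    have hent : ∀ a b, v i a * φ i b + v j a * φ j b = w a * ψ b := fun a b => by
      simpa [vecMulVec_apply] using congrFun (congrFun hw a) b
    -- A 2×2 minor of the sum factors as a minor of the columns times a minor of the rows, and it
    -- vanishes because the sum has rank one.
    have hdet : ∀ a b c d, (v i a * v j b - v i b * v j a) * (φ i c * φ j d - φ i d * φ j c) = 0 := by
      intro a b c d
      calc _ = (v i a * φ i c + v j a * φ j c) * (v i b * φ i d + v j b * φ j d) -
            (v i a * φ i d + v j a * φ j d) * (v i b * φ i c + v j b * φ j c) := by ring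
        _ = 0 := by simp only [hent]; ring
    have hpar : ∀ x y : ι → k, x ≠ 0 → (∀ a b, x a * y b - x b * y a = 0) → ∃ c : k, y = c • x := by
      intro x y hx hxy
      obtain ⟨b, hb⟩ := Function.ne_iff.1 hx
      refine ⟨y b / x b, funext fun a => ?_⟩
      have hb' : x b ≠ 0 := hb
      have := hxy a b
      simp only [Pi.smul_apply, smul_eq_mul]
      field_simp
      linear_combination -this
    by_cases hm : ∃ c d, φ i c * φ j d - φ i d * φ j c ≠ 0
    · obtain ⟨c, d, hcd⟩ := hm
      exact .inl (hpar _ _ (hv i) fun a b => (mul_eq_zero.1 (hdet a b c d)).resolve_right hcd)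
    · push Not at hm
      exact .inr (hpar _ _ (hφ i) hm)
  by_cases hall : ∀ j, ∃ c : k, v j = c • v o
  · exact .inl hall
  push Not at hall
  obtain ⟨j, hj⟩ := hall
  obtain ⟨c, hc⟩ := (key o j).resolve_left (by rintro ⟨c, hc⟩; exact hj c hc)
  refine .inr fun i => ?_
  rcases key o i with ⟨d, hd⟩ | h
  -- Here `v i` is parallel to `v o` and `v j` is not, so `φ i` must be parallel to `φ j`, hence to
  -- `φ o`.
  · have hd0 : d ≠ 0 := by rintro rfl; exact hv i (by rw [hd, zero_smul])
    rcases key i j with ⟨e, he⟩ | ⟨e, he⟩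
    · exact absurd (by rw [he, hd, smul_smul]) (hj (e * d))
    · have he0 : e ≠ 0 := by rintro rfl; exact hφ j (by rw [he, zero_smul])
      exact ⟨e⁻¹ * c, by rw [mul_smul, ← hc, he, inv_smul_smul₀ he0]⟩
  · exact h

/-- A matrix that commutes with all `single o j 1` for `j ≠ o` is the sum of a scalar matrix and a
combination of these matrices. -/
theorem eq_of_commute_single [Nontrivial ι] {o : ι} {Z : Matrix ι ι k}
    (h : ∀ j, j ≠ o → Z * single o j 1 = single o j 1 * Z) :
    Z = Z o o • (1 : Matrix ι ι k) + vecMulVec (Pi.single o 1) (fun j => if j = o then 0 else Z o j) := by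
  obtain ⟨j₀, hj₀⟩ := exists_ne o
  have hcol : ∀ i, i ≠ o → Z i o = 0 := fun i hi => by
    have := congrFun (congrFun (h j₀ hj₀) i) j₀
    simpa [hi, hi.symm] using this
  have hrow : ∀ j l, j ≠ o → Z j l = if j = l then Z o o else 0 := fun j l hj => by
    have := congrFun (congrFun (h j hj) o) l
    rcases eq_or_ne j l with rfl | hl
    · simpa using this.symm
    · simpa [hl, hl.symm] using this.symm
  ext a b
  rcases eq_or_ne a o with rfl | ha
  · rcases eq_or_ne b a with rfl | hb
    · simp [vecMulVec_apply]
    · simp [vecMulVec_apply, hb, hb.symm]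
  · rcases eq_or_ne a b with rfl | hab
    · simp [hrow _ _ ha, vecMulVec_apply, ha]
    · simp [hrow _ _ ha, vecMulVec_apply, ha, hab]

/-- A unital Lie endomorphism of the matrix algebra that preserves the trace and fixes all
`single o j 1` is the identity. -/
theorem apply_eq_self_of_fix [CharZero k] [Nontrivial ι] {o : ι}
    {θ : Matrix ι ι k →ₗ[k] Matrix ι ι k}
    (hθ : ∀ X Y, θ (X * Y - Y * X) = θ X * θ Y - θ Y * θ X) (htr : ∀ X, (θ X).trace = X.trace)
    (hfix : ∀ j, θ (single o j 1) = single o j 1) : θ = LinearMap.id := by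
  -- The defect `Z = θ Y - Y` commutes with the `single o j 1` for `j ≠ o` and has trace zero, so it
  -- lies in the row `o` off the diagonal, where `ad (single o o 1)` acts as 1. It also has the
  -- eigenvalue `c ≠ 1` of `Y`, hence it vanishes. This is applied with `c = 0` to the block away
  -- from `o` and then with `c = -1` to the column `o`.
  have main : ∀ (Y : Matrix ι ι k) (c : k), c ≠ 1 →
      single o o 1 * Y - Y * single o o 1 = c • Y →
      (∀ j, j ≠ o → θ (Y * single o j 1 - single o j 1 * Y) = Y * single o j 1 - single o j 1 * Y) →
      θ Y = Y := by
    intro Y c hc hY hj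
    set Z := θ Y - Y with hZ
    have h1 : ∀ j, j ≠ o → Z * single o j 1 = single o j 1 * Z := by
      intro j hjo
      have h := hj j hjo
      rw [hθ, hfix] at h
      rw [hZ, sub_mul, mul_sub, ← sub_eq_zero]
      calc _ = (θ Y * single o j 1 - single o j 1 * θ Y) - (Y * single o j 1 - single o j 1 * Y) := by
            abel
        _ = 0 := by rw [h, sub_self]
    have h2 := eq_of_commute_single h1
    have h3 : Z.trace = 0 := by rw [hZ, trace_sub, htr, sub_self]
    have h4 : Z o o = 0 := by
      rw [h2, trace_add, trace_smul, trace_one, trace_vecMulVec] at h3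
      simpa using h3
    rw [h4, zero_smul, zero_add] at h2
    have h5 : single o o 1 * Z - Z * single o o 1 = c • Z := by
      have : θ (single o o 1 * Y - Y * single o o 1) = c • θ Y := by rw [hY, map_smul]
      rw [hθ, hfix] at this
      rw [hZ, mul_sub, sub_mul, smul_sub, ← this, ← hY]; abel
    have h6 : single o o 1 * Z - Z * single o o 1 = Z := by
      rw [h2]
      ext a b
      rcases eq_or_ne a o with rfl | ha
      · rcases eq_or_ne b a with rfl | hb
        · simp [vecMulVec_apply]
        · simp [vecMulVec_apply, hb]
      · rcases eq_or_ne b o with rfl | hb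
        · simp [vecMulVec_apply, ha]
        · simp [vecMulVec_apply, ha, hb]
    rw [h6] at h5
    have h7 : (1 - c) • Z = 0 := by rw [sub_smul, one_smul, ← h5, sub_self]
    have := (smul_eq_zero.1 h7).resolve_left (sub_ne_zero.2 hc.symm)
    exact sub_eq_zero.1 this
  have hmid : ∀ i j, i ≠ o → j ≠ o → θ (single i j 1) = single i j 1 := by
    intro i j hi hj
    refine main _ 0 zero_ne_one (by simp [hi.symm, hj]) fun l hl => ?_
    rcases eq_or_ne l i with rfl | hli
    · simp [hj, hfix]
    · simp [hj, hli]
  have hone : ∀ i j, i ≠ o → θ (single i j 1) = single i j 1 := by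
    intro i j hi
    rcases eq_or_ne j o with rfl | hj
    · refine main _ (-1) (by norm_num) (by simp [hi.symm]) fun l hl => ?_
      rcases eq_or_ne l i with rfl | hli
      · simp [hfix, hmid _ _ hi hl]
      · simp [hli, hmid _ _ hi hl]
    · exact hmid i j hi hj
  refine Matrix.ext_linearMap _ fun i j => ?_
  ext1
  rcases eq_or_ne i o with rfl | hi
  · simp [hfix]
  · simp [hone i j hi]

theorem single_eq_vecMulVec (o j : ι) :
    single o j (1 : k) = vecMulVec (Pi.single o 1) (Pi.single j 1) := by
  ext a c
  by_cases ha : o = a <;> by_cases hc : j = c <;>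
    simp [vecMulVec_apply, ha, hc, eq_comm]

/-- By perfectness traceless matrices go to sums of commutators, and the scalars are fixed. -/
theorem trace_map_of_lie [CharZero k] {θ : Matrix ι ι k →ₗ[k] Matrix ι ι k}
    (hθ : ∀ X Y, θ (X * Y - Y * X) = θ X * θ Y - θ Y * θ X) (h1 : θ 1 = 1) (X : Matrix ι ι k) :
    (θ X).trace = X.trace := by
  rcases isEmpty_or_nonempty ι with hι | hι
  · simp [Matrix.trace]
  have h0 : ∀ Z : Matrix ι ι k, Z.trace = 0 → (θ Z).trace = 0 := by
    intro Z hZ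
    have hs := exists_mul_sub_mul_span hZ
    clear hZ
    induction hs using Submodule.span_induction with
    | mem x hx =>
      obtain ⟨A, B, -, -, rfl⟩ := hx
      rw [hθ, trace_sub, trace_mul_comm, sub_self]
    | zero => simp
    | add x y _ _ hx hy => rw [map_add, trace_add, hx, hy, add_zero]
    | smul c x _ hx => rw [map_smul, trace_smul, hx, smul_zero]
  have hc : (Fintype.card ι : k) ≠ 0 := by simp
  have := h0 (X - (X.trace / Fintype.card ι) • (1 : Matrix ι ι k)) (by
    rw [trace_sub, trace_smul, trace_one, smul_eq_mul]; field_simp; simp)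
  rw [map_sub, map_smul, h1, trace_sub, trace_smul, trace_one, smul_eq_mul] at this
  field_simp at this
  linear_combination this

/-- Two conjugations reduce `θ` to the identity: the first makes it fix the row `o` off the
diagonal, the second, by a unipotent matrix, makes it fix `single o o 1` as well. -/
theorem exists_conj_of_common_column [CharZero k] [Nontrivial ι] {o : ι}
    {θ : Matrix ι ι k →ₗ[k] Matrix ι ι k}
    (hθ : ∀ X Y, θ (X * Y - Y * X) = θ X * θ Y - θ Y * θ X) (h1 : θ 1 = 1)
    (hinj : Function.Injective θ) {f : ι → k} {ψ : ι → ι → k}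
    (hf : ∀ j, j ≠ o → θ (single o j 1) = vecMulVec f (ψ j)) :
    ∃ P : GL ι k, ∀ X, θ X = P * X * (P⁻¹ : GL ι k) := by
  have htr := trace_map_of_lie hθ h1
  obtain ⟨j₀, hj₀⟩ := exists_ne o
  have hf0 : f ≠ 0 := by
    rintro rfl
    have := hf j₀ hj₀
    rw [zero_vecMulVec, ← map_zero θ] at this
    have := congrFun (congrFun (hinj this) o) j₀
    simp at this
  obtain ⟨b, hb⟩ := Function.ne_iff.1 hf0
  have hb' : f b ≠ 0 := hb
  have hψf : ∀ j, j ≠ o → ψ j ⬝ᵥ f = 0 := by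
    intro j hj
    have := htr (single o j 1)
    rw [hf j hj, trace_vecMulVec, trace_single_eq_of_ne _ _ _ hj.symm] at this
    rwa [dotProduct_comm]
  -- The rows are the `ψ j`, which kill `f`, and in position `o` a functional with value 1 on `f`.
  -- Conjugation by `Q` therefore carries `vecMulVec f (ψ j)` to `single o j 1`.
  let Q : Matrix ι ι k := Matrix.of fun j => if j = o then Pi.single b (f b)⁻¹ else ψ j
  have hQo : Q o = Pi.single b (f b)⁻¹ := by funext x; simp [Q]
  have hQj : ∀ j, j ≠ o → Q j = ψ j := fun j hj => by funext x; simp [Q, hj]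
  have hQf : Q *ᵥ f = Pi.single o 1 := by
    funext j
    change Q j ⬝ᵥ f = _
    rcases eq_or_ne j o with rfl | hj
    · rw [hQo]; simp [hb']
    · rw [hQj j hj, hψf j hj]; simp [hj]
  have hQ : IsUnit Q := by
    rw [← linearIndependent_rows_iff_isUnit, Fintype.linearIndependent_iff]
    intro c hc
    have hc' : c ᵥ* Q = 0 := by
      rw [vecMul_eq_sum]; exact hc
    have hco : c o = 0 := by
      have : (c ᵥ* Q) ⬝ᵥ f = 0 := by rw [hc', zero_dotProduct]
      rw [← dotProduct_mulVec, hQf] at this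
      simpa using this
    have h0 : θ (∑ j, c j • single o j 1) = 0 := by
      rw [map_sum]
      have : ∀ j, θ (c j • single o j 1) = vecMulVec f (c j • Q j) := by
        intro j
        rcases eq_or_ne j o with rfl | hj
        · simp [hco]
        · rw [map_smul, hf j hj, hQj j hj, vecMulVec_smul]
      simp_rw [this]
      have hs : ∑ j, vecMulVec f (c j • Q j) = vecMulVec f (∑ j, c j • Q j) := by
        ext a b
        simp [Matrix.sum_apply, vecMulVec_apply, Finset.mul_sum, Finset.sum_apply, mul_left_comm]
      have : ∑ j, c j • Q j = 0 := hc
      rw [hs, this, vecMulVec_zero]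
    rw [← map_zero θ] at h0
    intro i
    have := congrFun (congrFun (hinj h0) o) i
    simpa [Matrix.sum_apply, Matrix.single_apply] using this
  obtain ⟨q, hq⟩ := hQ
  have hqq : (q : Matrix ι ι k) * (q⁻¹ : GL ι k) = 1 := Units.mul_inv q
  have hqq' : ((q⁻¹ : GL ι k) : Matrix ι ι k) * q = 1 := Units.inv_mul q
  have conj_lie : ∀ (g : GL ι k) (θ' : Matrix ι ι k →ₗ[k] Matrix ι ι k),
      (∀ X Y, θ' (X * Y - Y * X) = θ' X * θ' Y - θ' Y * θ' X) →
      ∀ X Y, (g : Matrix ι ι k) * θ' (X * Y - Y * X) * (g⁻¹ : GL ι k) =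
        (g * θ' X * (g⁻¹ : GL ι k)) * (g * θ' Y * (g⁻¹ : GL ι k)) -
        (g * θ' Y * (g⁻¹ : GL ι k)) * (g * θ' X * (g⁻¹ : GL ι k)) := by
    intro g θ' h X Y
    have hg : ((g⁻¹ : GL ι k) : Matrix ι ι k) * g = 1 := Units.inv_mul g
    have : ∀ A B : Matrix ι ι k, (g * A * (g⁻¹ : GL ι k)) * (g * B * (g⁻¹ : GL ι k)) =
        g * (A * B) * (g⁻¹ : GL ι k) := by
      intro A B
      calc _ = g * A * ((g⁻¹ : GL ι k) * g) * B * (g⁻¹ : GL ι k) := by noncomm_ring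
        _ = _ := by rw [hg]; noncomm_ring
    rw [this, this, h]; noncomm_ring
  have conj_tr : ∀ (g : GL ι k) (X : Matrix ι ι k), (g * X * (g⁻¹ : GL ι k)).trace = X.trace := by
    intro g X
    have hg : ((g⁻¹ : GL ι k) : Matrix ι ι k) * g = 1 := Units.inv_mul g
    rw [trace_mul_comm, ← mul_assoc, hg, one_mul]
  let cj : GL ι k → Matrix ι ι k →ₗ[k] Matrix ι ι k := fun g =>
    LinearMap.mulRight k ((g⁻¹ : GL ι k) : Matrix ι ι k) ∘ₗ LinearMap.mulLeft k (g : Matrix ι ι k)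
  let θ₁ := cj q ∘ₗ θ
  have hθ₁ : ∀ X, θ₁ X = q * θ X * (q⁻¹ : GL ι k) := fun X => rfl
  have hlie₁ : ∀ X Y, θ₁ (X * Y - Y * X) = θ₁ X * θ₁ Y - θ₁ Y * θ₁ X := conj_lie q θ hθ
  have htr₁ : ∀ X, (θ₁ X).trace = X.trace := fun X => (conj_tr q _).trans (htr X)
  have hfix₁ : ∀ j, j ≠ o → θ₁ (single o j 1) = single o j 1 := by
    intro j hj
    have hψ : ψ j = Pi.single j 1 ᵥ* Q := by rw [single_one_vecMul]; exact (hQj j hj).symm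
    rw [hθ₁, hf j hj, mul_vecMulVec, vecMulVec_mul, hq, hQf, hψ, vecMul_vecMul, ← hq, hqq,
      vecMul_one, single_eq_vecMulVec]
  -- The remaining defect `u` is traceless and commutes with the fixed part of the row `o`, so it
  -- lies in that row and has square zero. Conjugation by `1 + u` removes it.
  set u := θ₁ (single o o 1) - single o o 1 with hu
  have hcomm : ∀ j, j ≠ o → u * single o j 1 = single o j 1 * u := by
    intro j hj
    have h := hlie₁ (single o o 1) (single o j 1)
    have h' : single o o (1 : k) * single o j 1 - single o j 1 * single o o 1 = single o j 1 := by
      simp [hj]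
    rw [h', hfix₁ j hj] at h
    rw [hu, sub_mul, mul_sub, ← sub_eq_zero]
    calc _ = (θ₁ (single o o 1) * single o j 1 - single o j 1 * θ₁ (single o o 1)) -
          (single o o 1 * single o j 1 - single o j 1 * single o o 1) := by abel
      _ = 0 := by rw [← h, h', sub_self]
  have hu2 := eq_of_commute_single hcomm
  have huo : u o o = 0 := by
    have h3 : u.trace = 0 := by rw [hu, trace_sub, htr₁, sub_self]
    rw [hu2, trace_add, trace_smul, trace_one, trace_vecMulVec] at h3
    simpa using h3
  rw [huo, zero_smul, zero_add] at hu2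
  set φ : ι → k := fun j => if j = o then 0 else u o j with hφ
  have hφo : φ o = 0 := by simp [hφ]
  have e1 : single o o 1 * u = u := by
    rw [hu2, mul_vecMulVec]
    congr 1
    ext a; simp [Pi.single_apply, mulVec, dotProduct, Matrix.single_apply, ite_and, eq_comm]
  have e2 : ∀ j, u * single o j 1 = 0 := by
    intro j
    rw [hu2, vecMulVec_mul]
    have : φ ᵥ* single o j (1 : k) = 0 := by
      ext a; simp [vecMul, dotProduct, Matrix.single_apply, ite_and, hφo]
    rw [this, vecMulVec_zero]
  have e3 : ∀ j, j ≠ o → single o j 1 * u = 0 := fun j hj => by rw [← hcomm j hj, e2]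
  have e4 : u * u = 0 := by
    rw [hu2, vecMulVec_mul_vecMulVec]
    simp [hφo]
  let t : GL ι k := ⟨1 + u, 1 - u,
    by rw [show (1 + u) * (1 - u) = 1 - u * u by noncomm_ring, e4, sub_zero],
    by rw [show (1 - u) * (1 + u) = 1 - u * u by noncomm_ring, e4, sub_zero]⟩
  have ht : (t : Matrix ι ι k) = 1 + u := rfl
  have ht' : ((t⁻¹ : GL ι k) : Matrix ι ι k) = 1 - u := rfl
  let θ₂ := cj t ∘ₗ θ₁
  have hθ₂ : ∀ X, θ₂ X = t * θ₁ X * (t⁻¹ : GL ι k) := fun X => rfl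
  have hid : θ₂ = LinearMap.id := by
    refine apply_eq_self_of_fix (o := o) (conj_lie t θ₁ hlie₁)
      (fun X => (conj_tr t _).trans (htr₁ X)) fun j => ?_
    rw [hθ₂, ht, ht']
    rcases eq_or_ne j o with rfl | hj
    · have : θ₁ (single j j 1) = single j j 1 + u := by rw [hu]; abel
      rw [this]
      calc _ = single j j 1 + u - single j j 1 * u - u * u + u * single j j 1 + u * u
            - (u * single j j 1) * u - u * u * u := by noncomm_ring
        _ = _ := by rw [e1, e2, e4]; simp
    · rw [hfix₁ j hj]
      calc _ = single o j 1 - single o j 1 * u + u * single o j 1 - (u * single o j 1) * u := by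
            noncomm_ring
        _ = _ := by rw [e2, e3 j hj]; simp
  refine ⟨(t * q)⁻¹, fun X => ?_⟩
  have h : (t : Matrix ι ι k) * (q * θ X * (q⁻¹ : GL ι k)) * (t⁻¹ : GL ι k) = X :=
    LinearMap.congr_fun hid X
  have h' : ((t * q : GL ι k) : Matrix ι ι k) * θ X * ((t * q)⁻¹ : GL ι k) = X := by
    rw [_root_.mul_inv_rev, Units.val_mul, Units.val_mul]
    refine Eq.trans ?_ h
    noncomm_ring
  rw [inv_inv]
  conv_rhs => rw [← h']
  have hg : (((t * q)⁻¹ : GL ι k) : Matrix ι ι k) * (t * q : GL ι k) = 1 := Units.inv_mul _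
  calc _ = 1 * θ X * 1 := by simp
    _ = _ := by rw [← hg]; noncomm_ring

/-- Every Lie automorphism of the matrices of trace zero is, up to the extension to all matrices,
a conjugation or the negative of a conjugated transpose. -/
theorem exists_conj_or_transpose [CharZero k] [Nontrivial ι]
    {θ : Matrix ι ι k →ₗ[k] Matrix ι ι k}
    (hθ : ∀ X Y, θ (X * Y - Y * X) = θ X * θ Y - θ Y * θ X) (h1 : θ 1 = 1)
    (hinj : Function.Injective θ) :
    ∃ P : GL ι k, (∀ X, θ X = P * X * (P⁻¹ : GL ι k)) ∨
      ∀ X, X.trace = 0 → θ X = -(P * Xᵀ * (P⁻¹ : GL ι k)) := by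
  obtain ⟨o, j₀, hoj⟩ := exists_pair_ne ι
  have htr := trace_map_of_lie hθ h1
  have hsurj : Function.Surjective θ := LinearMap.surjective_of_injective hinj
  -- the images of the elements of the first row have rank one
  have hrank : ∀ φ : ι → k, φ o = 0 → φ ≠ 0 →
      ∃ v ψ : ι → k, θ (vecMulVec (Pi.single o 1) φ) = vecMulVec v ψ := by
    intro φ hφo hφ
    set X := vecMulVec (Pi.single o (1 : k)) φ with hX
    have hX0 : X ≠ 0 := by
      intro h0
      apply hφ
      ext j
      have := congrFun (congrFun h0 o) j
      simpa [hX, vecMulVec_apply] using this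
    have hXX : X * X = 0 := by
      rw [hX, vecMulVec_mul_vecMulVec]; simp [hφo]
    have hXYX : ∀ Y : Matrix ι ι k, X * Y * X = (φ ⬝ᵥ (Y *ᵥ Pi.single o 1)) • X := by
      intro Y
      rw [hX, vecMulVec_mul, vecMulVec_mul_vecMulVec, ← dotProduct_mulVec, vecMulVec_smul]
    refine exists_eq_vecMulVec ?_ ?_ ?_
    · intro h0; exact hX0 (hinj (by rw [h0, map_zero]))
    -- The relation `[single o o 1, X] = X` is transported by `θ`.
    · refine isNilpotent_of_mul_sub_mul_eq_self (D := θ (single o o 1)) ?_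
      rw [← hθ]
      congr 1
      ext a c
      rcases eq_or_ne a o with rfl | ha
      · rcases eq_or_ne c a with rfl | hc
        · simp [hX, vecMulVec_apply, hφo]
        · simp [hX, vecMulVec_apply, hc]
      · rcases eq_or_ne c o with rfl | hc
        · simp [hX, vecMulVec_apply, ha]
        · simp [hX, vecMulVec_apply, ha, hc]
    · intro Y
      obtain ⟨Y, rfl⟩ := hsurj Y
      refine ⟨-2 * (φ ⬝ᵥ (Y *ᵥ Pi.single o 1)), ?_⟩
      rw [← hθ, ← hθ, ← map_smul]
      congr 1
      calc _ = (X * X) * Y - X * Y * X - X * Y * X + Y * (X * X) := by noncomm_ring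
        _ = _ := by rw [hXX, hXYX, zero_mul, mul_zero]; module
  have hsingle := single_eq_vecMulVec (k := k) o
  have hne : ∀ j : {j // j ≠ o}, ∃ v ψ : ι → k, θ (single o j.1 1) = vecMulVec v ψ := by
    intro j
    rw [hsingle]
    exact hrank (Pi.single j.1 1) (by simp [j.2.symm]) (by simp)
  choose v ψ hvψ using hne
  have hs0 : ∀ j : {j // j ≠ o}, vecMulVec (v j) (ψ j) ≠ 0 := by
    intro j h0
    rw [← hvψ, ← map_zero θ] at h0
    have := congrFun (congrFun (hinj h0) o) j.1
    simp at this
  have hv0 : ∀ j, v j ≠ 0 := fun j h0 => hs0 j (by rw [h0, zero_vecMulVec])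
  have hψ0 : ∀ j, ψ j ≠ 0 := fun j h0 => hs0 j (by rw [h0, vecMulVec_zero])
  have hsum : ∀ i j : {j // j ≠ o}, ∃ w η : ι → k,
      vecMulVec (v i) (ψ i) + vecMulVec (v j) (ψ j) = vecMulVec w η := by
    intro i j
    rw [← hvψ, ← hvψ, ← map_add, hsingle, hsingle, ← vecMulVec_add]
    refine hrank _ (by simp [i.2.symm, j.2.symm]) fun h0 => ?_
    have := congrFun h0 i.1
    rcases eq_or_ne i j with rfl | hij
    · simp at this
    · simp [Subtype.coe_injective.ne hij] at this
  rcases exists_common_vector hv0 hψ0 hsum ⟨j₀, hoj.symm⟩ with h | h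
  · choose c hc using h
    obtain ⟨P, hP⟩ := exists_conj_of_common_column (o := o) hθ h1 hinj
      (f := v ⟨j₀, hoj.symm⟩) (ψ := fun j => if hj : j ≠ o then c ⟨j, hj⟩ • ψ ⟨j, hj⟩ else 0)
      fun j hj => by
        rw [dif_pos hj, hvψ ⟨j, hj⟩, hc ⟨j, hj⟩, vecMulVec_smul, smul_vecMulVec]
    exact ⟨P, .inl hP⟩
  · choose c hc using h
    let tr : Matrix ι ι k →ₗ[k] k := traceLinearMap ι k k
    -- The negative transpose exchanges common rows and common columns. It sends 1 to -1, and the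
    -- trace term, equal to 2 at the identity, restores `θ' 1 = 1` without affecting brackets.
    let θ' : Matrix ι ι k →ₗ[k] Matrix ι ι k :=
      -((transposeLinearEquiv ι ι k k).toLinearMap ∘ₗ θ) +
        (2 / Fintype.card ι : k) • (tr.smulRight (1 : Matrix ι ι k))
    have hθ' : ∀ X, θ' X = -(θ X)ᵀ + (2 / Fintype.card ι * X.trace : k) • (1 : Matrix ι ι k) := by
      intro X; simp [θ', tr, smul_smul]
    have hcard : (Fintype.card ι : k) ≠ 0 := by simp
    have h1' : θ' 1 = 1 := by
      rw [hθ', h1, trace_one, div_mul_cancel₀ _ hcard, transpose_one]; module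
    have hlie' : ∀ X Y, θ' (X * Y - Y * X) = θ' X * θ' Y - θ' Y * θ' X := by
      intro X Y
      rw [hθ', hθ', hθ', hθ, trace_sub, trace_mul_comm, sub_self, mul_zero, zero_smul, add_zero,
        transpose_sub, transpose_mul, transpose_mul]
      generalize (2 / Fintype.card ι * X.trace : k) = a
      generalize (2 / Fintype.card ι * Y.trace : k) = b
      simp only [add_mul, mul_add, smul_mul_assoc, mul_smul_comm, one_mul, mul_one, neg_mul,
        mul_neg]
      module
    have hinj' : Function.Injective θ' := by
      rw [← LinearMap.ker_eq_bot, LinearMap.ker_eq_bot']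
      intro X hX
      have htrX := trace_map_of_lie hlie' h1' X
      rw [hX, trace_zero] at htrX
      rw [hθ', ← htrX, mul_zero, zero_smul, add_zero, neg_eq_zero, transpose_eq_zero] at hX
      exact hinj (by rw [hX, map_zero])
    obtain ⟨P, hP⟩ := exists_conj_of_common_column (o := o) hlie' h1' hinj'
      (f := ψ ⟨j₀, hoj.symm⟩) (ψ := fun j => if hj : j ≠ o then -(c ⟨j, hj⟩) • v ⟨j, hj⟩ else 0)
      fun j hj => by
        rw [dif_pos hj, hθ', trace_single_eq_of_ne _ _ _ hj.symm, mul_zero, zero_smul, add_zero,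
          hvψ ⟨j, hj⟩, hc ⟨j, hj⟩, vecMulVec_smul, vecMulVec_smul, transpose_smul,
          transpose_vecMulVec, neg_smul]
    refine ⟨⟨((P⁻¹ : GL ι k) : Matrix ι ι k)ᵀ, (P : Matrix ι ι k)ᵀ, ?_, ?_⟩, .inr fun X hX => ?_⟩
    · rw [← transpose_mul, Units.mul_inv, transpose_one]
    · rw [← transpose_mul, Units.inv_mul, transpose_one]
    · have := hP X
      rw [hθ', hX, mul_zero, zero_smul, add_zero] at this
      have h2 : θ X = -(P * X * (P⁻¹ : GL ι k) : Matrix ι ι k)ᵀ := by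
        rw [← this, transpose_neg, transpose_transpose, neg_neg]
      rw [h2, transpose_mul, transpose_mul, ← mul_assoc]
      rfl

end Automorphisms

end SpecialLinear

end

/-! ### Goursat's lemma for products of `sl_n` -/

section

section Goursat

variable {k ι Λ : Type*} [Field k] [CharZero k] [Fintype ι] [DecidableEq ι]

/-- The components `λ` and `μ` of the elements of `g` are related by a conjugation, or by a
conjugation and the negative of the transpose. -/
def ConjRelated (g : Submodule k (Λ → Matrix ι ι k)) (l m : Λ) : Prop :=
  ∃ P : GL ι k, (∀ w ∈ g, w l = P * w m * (P⁻¹ : GL ι k)) ∨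
    ∀ w ∈ g, w l = -(P * (w m)ᵀ * (P⁻¹ : GL ι k))

variable {g : Submodule k (Λ → Matrix ι ι k)}

/-- The elements of `g` vanishing at `m` project to an ideal of `sl_n` at `l`, which is zero or
everything. If it is zero, the component at `l` is a function of the component at `m`, and this
function is an automorphism of `sl_n`. -/
theorem exists_or_conjRelated
    (hlie : ∀ a ∈ g, ∀ b ∈ g, a * b - b * a ∈ g) (htr : ∀ w ∈ g, ∀ l, (w l).trace = 0)
    (hsurj : ∀ l, ∀ Z : Matrix ι ι k, Z.trace = 0 → ∃ w ∈ g, w l = Z) (l m : Λ) :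
    (∀ Z : Matrix ι ι k, Z.trace = 0 → ∃ w ∈ g, w l = Z ∧ w m = 0) ∨ ConjRelated g l m := by
  by_cases hne : ∃ w ∈ g, w m = 0 ∧ w l ≠ 0
  · refine .inl fun Z hZ => ?_
    obtain ⟨w₀, hw₀, hm₀, hl₀⟩ := hne
    let I : Submodule k (Matrix ι ι k) :=
      (g ⊓ LinearMap.ker (LinearMap.proj (R := k) (φ := fun _ : Λ => Matrix ι ι k) m)).map
        (LinearMap.proj l)
    have hI : ∀ X, X ∈ I ↔ ∃ w ∈ g, w m = 0 ∧ w l = X := by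
      intro X; simp [I, Submodule.mem_map, and_assoc]
    have := mem_ideal_of_trace_eq_zero I (by
        intro X hX
        obtain ⟨w, hw, -, rfl⟩ := (hI X).1 hX
        exact htr w hw l) (by
        intro A hA X hX
        obtain ⟨w, hw, hwm, rfl⟩ := (hI X).1 hX
        obtain ⟨a, ha, rfl⟩ := hsurj l A hA
        exact (hI _).2 ⟨a * w - w * a, hlie a ha w hw, by simp [hwm], by simp⟩)
      ⟨w₀ l, (hI _).2 ⟨w₀, hw₀, hm₀, rfl⟩, hl₀⟩ hZ
    obtain ⟨w, hw, h1, h2⟩ := (hI Z).1 this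
    exact ⟨w, hw, h2, h1⟩
  push Not at hne
  rcases subsingleton_or_nontrivial ι with hι | hι
  · refine .inl fun Z hZ => ⟨0, g.zero_mem, ?_, rfl⟩
    ext a b
    rw [Subsingleton.elim b a]
    have : ∑ i, Z i i = 0 := hZ
    rw [Fintype.sum_subsingleton _ a] at this
    simp [this]
  right
  have hcard : (Fintype.card ι : k) ≠ 0 := by simp
  let q : g →ₗ[k] Matrix ι ι k := LinearMap.proj m ∘ₗ g.subtype
  let r : g →ₗ[k] Matrix ι ι k := LinearMap.proj l ∘ₗ g.subtype
  have hq : ∀ w : g, q w = w.1 m := fun _ => rfl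
  have hr : ∀ w : g, r w = w.1 l := fun _ => rfl
  -- A linear section of the projection to `m`; the component at `l` of a lift does not depend on
  -- the choice.
  obtain ⟨s, hs⟩ := q.rangeRestrict.exists_rightInverse_of_surjective q.range_rangeRestrict
  have hs' : ∀ X : q.range, (s X).1 m = X.1 := fun X =>
    congrArg Subtype.val (LinearMap.congr_fun hs X)
  have hunique : ∀ (w : g) (X : q.range), w.1 m = X.1 → (s X).1 l = w.1 l := by
    intro w X h
    have := hne (s X - w : g).1 (s X - w).2 (by simp [hs', h])
    simpa [sub_eq_zero] using this
  let tl : Matrix ι ι k →ₗ[k] Matrix ι ι k :=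
    LinearMap.id - (Fintype.card ι : k)⁻¹ • (traceLinearMap ι k k).smulRight 1
  have htl : ∀ X, tl X = X - ((Fintype.card ι : k)⁻¹ * X.trace) • 1 := by
    intro X; simp [tl, smul_smul]
  have htl0 : ∀ X, (tl X).trace = 0 := by
    intro X; rw [htl, trace_sub, trace_smul, trace_one, smul_eq_mul]; field_simp; simp
  have hmem : ∀ X, tl X ∈ q.range := by
    intro X
    obtain ⟨w, hw, h⟩ := hsurj m _ (htl0 X)
    exact ⟨⟨w, hw⟩, h⟩
  let tl' : Matrix ι ι k →ₗ[k] q.range := tl.codRestrict _ hmem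
  -- The Lie map on traceless matrices is extended to all matrices by the identity on scalars, the
  -- form in which automorphisms were classified.
  let θ : Matrix ι ι k →ₗ[k] Matrix ι ι k :=
    r ∘ₗ s ∘ₗ tl' + (Fintype.card ι : k)⁻¹ • (traceLinearMap ι k k).smulRight 1
  have hθ : ∀ X, θ X = (s (tl' X)).1 l + ((Fintype.card ι : k)⁻¹ * X.trace) • 1 := by
    intro X; simp [θ, hr, smul_smul]
  have hθm : ∀ w ∈ g, θ (w m) = w l := by
    intro w hw
    rw [hθ, htr w hw m, mul_zero, zero_smul, add_zero]
    refine hunique ⟨w, hw⟩ _ ?_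
    change w m = tl (w m)
    rw [htl, htr w hw m, mul_zero, zero_smul, sub_zero]
  have hone : θ 1 = 1 := by
    have h0 : tl' 1 = 0 := by
      apply Subtype.ext
      change tl 1 = 0
      rw [htl, trace_one, inv_mul_cancel₀ hcard, one_smul, sub_self]
    rw [hθ, h0, trace_one, inv_mul_cancel₀ hcard, map_zero]
    simp
  have hlie' : ∀ X Y, θ (X * Y - Y * X) = θ X * θ Y - θ Y * θ X := by
    intro X Y
    set a := s (tl' X) with ha
    set b := s (tl' Y) with hb
    have ham : a.1 m = X - ((Fintype.card ι : k)⁻¹ * X.trace) • 1 := (hs' _).trans (htl X)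
    have hbm : b.1 m = Y - ((Fintype.card ι : k)⁻¹ * Y.trace) • 1 := (hs' _).trans (htl Y)
    have h1 : X * Y - Y * X = (a.1 * b.1 - b.1 * a.1) m := by
      simp only [Pi.sub_apply, Pi.mul_apply, ham, hbm, sub_mul, mul_sub, smul_mul_assoc,
        mul_smul_comm, one_mul, mul_one]
      module
    rw [h1, hθm _ (hlie _ a.2 _ b.2), hθ X, hθ Y, ← ha, ← hb]
    simp only [Pi.sub_apply, Pi.mul_apply, add_mul, mul_add, smul_mul_assoc,
        mul_smul_comm, one_mul, mul_one]
    module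
  have hθs : Function.Surjective θ := by
    intro Y
    obtain ⟨w, hw, h⟩ := hsurj l _ (htl0 Y)
    refine ⟨w m + ((Fintype.card ι : k)⁻¹ * Y.trace) • 1, ?_⟩
    rw [map_add, map_smul, hone, hθm w hw, h, htl, sub_add_cancel]
  obtain ⟨P, hP | hP⟩ := exists_conj_or_transpose hlie' hone
    (LinearMap.injective_iff_surjective.2 hθs)
  · exact ⟨P, .inl fun w hw => by rw [← hθm w hw, hP]⟩
  · exact ⟨P, .inr fun w hw => by rw [← hθm w hw, hP _ (htr w hw m)]⟩

/-- A Lie algebra that surjects onto all pairs of factors surjects onto the product. -/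
theorem exists_eq_and_eq_zero
    (hlie : ∀ a ∈ g, ∀ b ∈ g, a * b - b * a ∈ g)
    (hsurj : ∀ l, ∀ Z : Matrix ι ι k, Z.trace = 0 → ∃ w ∈ g, w l = Z) (r : Λ) (T : Finset Λ)
    (hT : ∀ t ∈ T, ∀ Z : Matrix ι ι k, Z.trace = 0 → ∃ w ∈ g, w r = Z ∧ w t = 0)
    {Z : Matrix ι ι k} (hZ : Z.trace = 0) : ∃ w ∈ g, w r = Z ∧ ∀ t ∈ T, w t = 0 := by
  classical
  induction T using Finset.induction_on generalizing Z with
  | empty =>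
    obtain ⟨w, hw, h⟩ := hsurj r Z hZ
    exact ⟨w, hw, h, by simp⟩
  | insert t T _ ih =>
    have ih' := fun Z hZ => ih (fun t ht => hT t (Finset.mem_insert_of_mem ht)) (Z := Z) hZ
    have hs := exists_mul_sub_mul_span hZ
    clear hZ
    induction hs using Submodule.span_induction with
    | zero => exact ⟨0, g.zero_mem, rfl, fun _ _ => rfl⟩
    | add x y _ _ hx hy =>
      obtain ⟨a, ha, ha1, ha2⟩ := hx
      obtain ⟨b, hb, hb1, hb2⟩ := hy
      exact ⟨a + b, g.add_mem ha hb, by simp [ha1, hb1], fun t ht => by simp [ha2 t ht, hb2 t ht]⟩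
    | smul c x _ hx =>
      obtain ⟨a, ha, ha1, ha2⟩ := hx
      exact ⟨c • a, g.smul_mem c ha, by simp [ha1], fun t ht => by simp [ha2 t ht]⟩
    | mem x hx =>
      obtain ⟨A, B, hA, hB, rfl⟩ := hx
      obtain ⟨a, ha, ha1, ha2⟩ := ih' A hA
      obtain ⟨b, hb, hb1, hb2⟩ := hT t (Finset.mem_insert_self _ _) B hB
      -- A bracket vanishes wherever one of its entries does, so `a` takes care of `T` and `b` of
      -- the new index.
      refine ⟨a * b - b * a, hlie a ha b hb, by simp [ha1, hb1], fun u hu => ?_⟩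
      rcases Finset.mem_insert.1 hu with rfl | hu
      · simp [hb2]
      · simp [ha2 u hu]

/-- A Lie subalgebra `g` of a product of copies of `sl_n` that surjects onto each factor: there is a
set `R` of indices such that the commutators of `g` span a space that surjects onto the product over
`R`, and every other component is related to one in `R`. -/
theorem exists_finset_conjRelated [Fintype Λ]
    (hlie : ∀ a ∈ g, ∀ b ∈ g, a * b - b * a ∈ g) (htr : ∀ w ∈ g, ∀ l, (w l).trace = 0)
    (hsurj : ∀ l, ∀ Z : Matrix ι ι k, Z.trace = 0 → ∃ w ∈ g, w l = Z) :
    ∃ R : Finset Λ, (∀ l, l ∈ R ∨ ∃ r ∈ R, ConjRelated g l r ∨ ConjRelated g r l) ∧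
      ∀ Z : Λ → Matrix ι ι k, (∀ l, (Z l).trace = 0) →
        ∃ w ∈ Submodule.span k {c | ∃ a ∈ g, ∃ b ∈ g, c = a * b - b * a}, ∀ r ∈ R, w r = Z r := by
  classical
  let Good : Λ → Λ → Prop := fun l m =>
    ∀ Z : Matrix ι ι k, Z.trace = 0 → ∃ w ∈ g, w l = Z ∧ w m = 0
  -- A maximal set of pairwise independent indices: by maximality any other index is dependent on a
  -- member of `R`.
  obtain ⟨R, hR⟩ : ∃ R : Finset Λ, Maximal (fun R : Finset Λ => ∀ l ∈ R, ∀ m ∈ R, l ≠ m → Good l m) R :=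
    Set.Finite.exists_maximal (Set.toFinite {R : Finset Λ | _}) ⟨∅, fun l hl => absurd hl (Finset.notMem_empty l)⟩
  refine ⟨R, fun l => ?_, ?_⟩
  · by_contra! hcon
    obtain ⟨hl, hrel⟩ := hcon
    have hgood : ∀ r ∈ R, Good l r ∧ Good r l := fun r hr =>
      ⟨(exists_or_conjRelated hlie htr hsurj l r).resolve_right (hrel r hr).1,
        (exists_or_conjRelated hlie htr hsurj r l).resolve_right (hrel r hr).2⟩
    refine hl (hR.le_of_ge (y := insert l R) ?_ (Finset.subset_insert _ _)
      (Finset.mem_insert_self _ _))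
    intro a ha b hb hab
    rcases Finset.mem_insert.1 ha with ha' | ha' <;> rcases Finset.mem_insert.1 hb with hb' | hb'
    · exact absurd (ha'.trans hb'.symm) hab
    · rw [ha']; exact (hgood b hb').1
    · rw [hb']; exact (hgood a ha').2
    · exact hR.prop a ha' b hb' hab
  · intro Z hZ
    set D := Submodule.span k {c | ∃ a ∈ g, ∃ b ∈ g, c = a * b - b * a}
    have hsingle : ∀ r ∈ R, ∃ w ∈ D, w r = Z r ∧ ∀ t ∈ R.erase r, w t = 0 := by
      intro r hr
      have hlift := fun (A : Matrix ι ι k) (hA : A.trace = 0) =>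
        exists_eq_and_eq_zero hlie hsurj r (R.erase r)
          (fun t ht => hR.prop r hr t (Finset.mem_of_mem_erase ht) (Finset.ne_of_mem_erase ht).symm)
          hA
      have hs := exists_mul_sub_mul_span (hZ r)
      generalize Z r = X at hs
      induction hs using Submodule.span_induction with
      | zero => exact ⟨0, D.zero_mem, rfl, fun _ _ => rfl⟩
      | add x y _ _ hx hy =>
        obtain ⟨a, ha, ha1, ha2⟩ := hx
        obtain ⟨b, hb, hb1, hb2⟩ := hy
        exact ⟨a + b, D.add_mem ha hb, by simp [ha1, hb1], fun t ht => by simp [ha2 t ht, hb2 t ht]⟩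
      | smul c x _ hx =>
        obtain ⟨a, ha, ha1, ha2⟩ := hx
        exact ⟨c • a, D.smul_mem c ha, by simp [ha1], fun t ht => by simp [ha2 t ht]⟩
      | mem x hx =>
        obtain ⟨A, B, hA, hB, rfl⟩ := hx
        obtain ⟨a, ha, ha1, ha2⟩ := hlift A hA
        obtain ⟨b, hb, hb1, hb2⟩ := hlift B hB
        exact ⟨a * b - b * a, Submodule.subset_span ⟨a, ha, b, hb, rfl⟩, by simp [ha1, hb1],
          fun t ht => by simp [ha2 t ht]⟩
    choose! w hw1 hw2 hw3 using hsingle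
    refine ⟨∑ r ∈ R, w r, D.sum_mem hw1, fun r hr => ?_⟩
    rw [Finset.sum_apply, Finset.sum_eq_single r]
    · exact hw2 r hr
    · intro t ht htr'
      exact hw3 t ht r (Finset.mem_erase.2 ⟨htr'.symm, hr⟩)
    · exact fun h => absurd hr h

end Goursat

end

/-! ### Euler products and the pole of the Dedekind zeta function -/

section

open Filter Topology

section EulerSum

open scoped ENNReal

/-- The sum over all `f : ι →₀ ℕ` of `∏ a i ^ f i`. -/
def eulerSum {ι : Type*} (a : ι → ℝ≥0∞) : ℝ≥0∞ := ∑' f : ι →₀ ℕ, f.prod fun i m => a i ^ m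

variable {ι κ : Type*}

/-- An exponent vector on a disjoint union is a pair of exponent vectors. With values in `ℝ≥0∞` no
convergence question arises. -/
theorem eulerSum_sumElim (a : ι → ℝ≥0∞) (b : κ → ℝ≥0∞) :
    eulerSum (Sum.elim a b) = eulerSum a * eulerSum b := by
  rw [eulerSum, eulerSum, eulerSum, ← ENNReal.tsum_mul_right]
  simp_rw [← ENNReal.tsum_mul_left]
  rw [← ENNReal.tsum_prod, ← Finsupp.sumFinsuppEquivProdFinsupp.symm.tsum_eq]
  refine tsum_congr fun ⟨f, g⟩ => ?_
  change (f.sumElim g).prod _ = _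
  rw [Finsupp.prod_sumElim]
  rfl

theorem eulerSum_comp_le (e : ι ↪ κ) (b : κ → ℝ≥0∞) : eulerSum (b ∘ e) ≤ eulerSum b := by
  have := ENNReal.tsum_comp_le_tsum_of_injective (Finsupp.embDomain_injective (M := ℕ) e)
    fun f : κ →₀ ℕ => f.prod fun i m => b i ^ m
  simpa [eulerSum, Finsupp.prod_embDomain] using this

theorem eulerSum_comp_equiv (e : ι ≃ κ) (b : κ → ℝ≥0∞) : eulerSum (b ∘ e) = eulerSum b := by
  refine le_antisymm (eulerSum_comp_le e.toEmbedding b) ?_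
  have := eulerSum_comp_le e.symm.toEmbedding (b ∘ e)
  simpa [Function.comp_assoc] using this

theorem eulerSum_unique_le {a : PUnit.{1} → ℝ≥0∞} (ha : a PUnit.unit ≤ 2⁻¹) : eulerSum a ≤ 2 := by
  let e : (PUnit.{1} →₀ ℕ) ≃ ℕ := Finsupp.equivFunOnFinite.trans (Equiv.funUnique PUnit ℕ)
  rw [eulerSum, ← e.symm.tsum_eq]
  have : ∀ m : ℕ, (e.symm m).prod (fun i m => a i ^ m) = a PUnit.unit ^ m := by
    intro m
    rw [Finsupp.prod_fintype _ _ (by simp)]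
    simp [e]
  simp_rw [this]
  rw [ENNReal.tsum_geometric]
  calc (1 - a PUnit.unit)⁻¹ ≤ (1 - 2⁻¹)⁻¹ := by gcongr
    _ = 2 := by rw [ENNReal.one_sub_inv_two, inv_inv]

/-- Each of the finitely many factors is a geometric series with sum `(1 - a i)⁻¹ ≤ 2`. -/
theorem eulerSum_lt_top [Finite ι] (a : ι → ℝ≥0∞) (ha : ∀ i, a i ≤ 2⁻¹) :
    eulerSum a ≤ 2 ^ Nat.card ι := by
  induction ι using Finite.induction_empty_option with
  | of_equiv e ih =>
    rw [← eulerSum_comp_equiv e, ← Nat.card_congr e]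
    exact ih _ fun i => ha _
  | h_empty =>
    rw [eulerSum, tsum_eq_single 0 (by intro f hf; exact absurd (Subsingleton.elim f 0) hf)]
    simp
  | h_option ih =>
    rename_i α _
    rw [← eulerSum_comp_equiv (Equiv.optionEquivSumPUnit α).symm,
      Nat.card_congr (Equiv.optionEquivSumPUnit α), Nat.card_sum,
      show Nat.card PUnit.{1} = 1 from Nat.card_unique]
    have : a ∘ (Equiv.optionEquivSumPUnit α).symm =
        Sum.elim (a ∘ some) (fun _ : PUnit.{1} => a none) := by
      funext x; rcases x with x | x <;> rfl
    rw [this, eulerSum_sumElim, pow_add, pow_one]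
    exact mul_le_mul' (ih _ fun i => ha _) (eulerSum_unique_le (ha none))

end EulerSum

section Zeta

open scoped ENNReal
open IsDedekindDomain UniqueFactorizationMonoid

/-- The function `n ↦ n ^ (-s)` as a multiplicative map to the extended non-negative reals. -/
def negPow (s : ℝ) : ℕ →* ℝ≥0∞ where
  toFun n := ENNReal.ofReal ((n : ℝ) ^ (-s))
  map_one' := by simp
  map_mul' a b := by
    rw [Nat.cast_mul, Real.mul_rpow (Nat.cast_nonneg _) (Nat.cast_nonneg _),
      ENNReal.ofReal_mul (by positivity)]

variable (K : Type*) [Field K] [NumberField K]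

/-- The term of the Euler product of the Dedekind zeta function at `v`. -/
def normTerm (s : ℝ) (v : HeightOneSpectrum (𝓞 K)) : ℝ≥0∞ := negPow s (Ideal.absNorm v.asIdeal)

/-- Unique factorization of ideals. The zero ideal is not a product of primes, but it contributes `0
^ (-s) = 0`. -/
theorem eulerSum_normTerm {s : ℝ} (hs : s ≠ 0) :
    eulerSum (normTerm K s) = ∑' I : Ideal (𝓞 K), negPow s (Ideal.absNorm I) := by
  classical
  let Φ : (HeightOneSpectrum (𝓞 K) →₀ ℕ) → Ideal (𝓞 K) := fun f =>
    ((Finsupp.toMultiset f).map HeightOneSpectrum.asIdeal).prod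
  have hΦ : ∀ f, f.prod (fun i m => normTerm K s i ^ m) = negPow s (Ideal.absNorm (Φ f)) := by
    intro f
    change _ = negPow s (Ideal.absNorm (((Finsupp.toMultiset f).map HeightOneSpectrum.asIdeal).prod))
    rw [Finsupp.toMultiset_map, Finsupp.prod_toMultiset, map_finsuppProd, map_finsuppProd,
      Finsupp.prod_mapDomain_index (by simp) (by simp [pow_add])]
    simp [normTerm]
  have hnf : ∀ f, normalizedFactors (Φ f) = (Finsupp.toMultiset f).map HeightOneSpectrum.asIdeal := by
    intro f
    refine normalizedFactors_prod_of_prime fun P hP => ?_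
    obtain ⟨v, -, rfl⟩ := Multiset.mem_map.1 hP
    exact v.prime
  have hinj : Function.Injective Φ := by
    intro f g h
    have h1 := (hnf f).symm.trans ((congrArg normalizedFactors h).trans (hnf g))
    have h2 := Multiset.map_injective (fun v w h => HeightOneSpectrum.ext h) h1
    exact Multiset.toFinsupp.symm.injective h2
  have hrange : ∀ I : Ideal (𝓞 K), I ∉ Set.range Φ → negPow s (Ideal.absNorm I) = 0 := by
    intro I hI
    have : I = ⊥ := by
      by_contra hI0
      apply hI
      have hp : ∀ P ∈ normalizedFactors I, Prime P := fun P hP => prime_of_normalized_factor P hP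
      let m : Multiset (HeightOneSpectrum (𝓞 K)) :=
        (normalizedFactors I).pmap (fun P hP => ⟨P, Ideal.isPrime_of_prime hP, hP.ne_zero⟩) hp
      refine ⟨Multiset.toFinsupp m, ?_⟩
      simp only [Φ, Multiset.toFinsupp_toMultiset, m, Multiset.map_pmap]
      rw [Multiset.pmap_eq_map, Multiset.map_id']
      exact associated_iff_eq.1 (prod_normalizedFactors hI0)
    rw [this, Ideal.absNorm_bot]
    simp [negPow, hs]
  rw [eulerSum]
  simp_rw [hΦ]
  rw [← tsum_range (fun I : Ideal (𝓞 K) => negPow s (Ideal.absNorm I)) hinj]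
  refine tsum_subtype_eq_of_support_subset
    (f := fun I : Ideal (𝓞 K) => negPow s (Ideal.absNorm I)) fun I hI => Classical.byContradiction fun h => ?_
  exact hI (hrange I h)

/-- The hypothesis `h0` supplies convergence, since a divergent series has the default value 0. -/
theorem tsum_negPow_eq {s : ℝ} (hs : 1 < s) (h0 : dedekindZeta K s ≠ 0) :
    ∑' I : Ideal (𝓞 K), negPow s (Ideal.absNorm I) = ENNReal.ofReal (dedekindZeta K s).re := by
  let c : ℕ → ℕ := fun m => Nat.card {I : Ideal (𝓞 K) // Ideal.absNorm I = m}
  have hs0 : s ≠ 0 := by linarith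
  have hterm : ∀ m, LSeries.term (fun m => (c m : ℂ)) s m = ((c m * (m : ℝ) ^ (-s) : ℝ) : ℂ) := by
    intro m
    rcases eq_or_ne m 0 with rfl | hm
    · simp [hs0]
    · rw [LSeries.term_of_ne_zero hm, Real.rpow_neg (Nat.cast_nonneg _)]
      push_cast
      rw [Complex.ofReal_cpow (Nat.cast_nonneg _)]
      simp [div_eq_mul_inv]
  have hz : dedekindZeta K s = ∑' m, ((c m * (m : ℝ) ^ (-s) : ℝ) : ℂ) := by
    rw [dedekindZeta, LSeries]
    exact tsum_congr hterm
  have hsum : Summable fun m => (c m * (m : ℝ) ^ (-s) : ℝ) := by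
    by_contra hcon
    rw [← Complex.summable_ofReal] at hcon
    exact h0 (hz.trans (tsum_eq_zero_of_not_summable hcon))
  rw [hz, ← Complex.ofReal_tsum, Complex.ofReal_re, ENNReal.ofReal_tsum_of_nonneg
    (fun m => by positivity) hsum, ← (Equiv.sigmaFiberEquiv (Ideal.absNorm (S := 𝓞 K))).tsum_eq,
    ENNReal.tsum_sigma']
  refine tsum_congr fun m => ?_
  have : ∀ I : {I : Ideal (𝓞 K) // Ideal.absNorm I = m},
      negPow s (Ideal.absNorm (Equiv.sigmaFiberEquiv (Ideal.absNorm (S := 𝓞 K)) ⟨m, I⟩)) =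
        ENNReal.ofReal ((m : ℝ) ^ (-s)) := by
    rintro ⟨I, rfl⟩; rfl
  rw [tsum_congr this]
  rcases eq_or_ne m 0 with rfl | hm
  · simp [hs0]
  · have hfin : Finite {I : Ideal (𝓞 K) // Ideal.absNorm I = m} :=
      Ideal.finite_setOfPred_absNorm_eq m
    have := Fintype.ofFinite {I : Ideal (𝓞 K) // Ideal.absNorm I = m}
    rw [tsum_fintype, Finset.sum_const, Finset.card_univ, ENNReal.ofReal_mul (by positivity),
      ENNReal.ofReal_natCast, nsmul_eq_mul, ← Nat.card_eq_fintype_card]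

/-- With `κ` half the residue, the bounds are half and twice the asymptotic value given by the
simple pole. -/
theorem exists_eulerSum_bounds : ∃ κ > 0, ∀ᶠ s in 𝓝[>] (1 : ℝ),
    ENNReal.ofReal (κ / (s - 1)) ≤ eulerSum (normTerm K s) ∧
      eulerSum (normTerm K s) ≤ ENNReal.ofReal (4 * κ / (s - 1)) := by
  have hpos := dedekindZeta_residue_pos K
  set κ := dedekindZeta_residue K
  have ht := (Complex.continuous_re.tendsto _).comp (tendsto_sub_one_mul_dedekindZeta_nhdsGT K)
  refine ⟨κ / 2, by positivity, ?_⟩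
  have hmem : Set.Ioo (κ / 2) (2 * κ) ∈ 𝓝 ((κ : ℂ).re) := by
    rw [Complex.ofReal_re]; exact Ioo_mem_nhds (by linarith) (by linarith)
  filter_upwards [ht.eventually hmem, self_mem_nhdsWithin] with s hs hs1
  have hs1' : (1 : ℝ) < s := hs1
  have hre : ((s - 1 : ℂ) * dedekindZeta K s).re = (s - 1) * (dedekindZeta K s).re := by
    rw [show (s - 1 : ℂ) = ((s - 1 : ℝ) : ℂ) by push_cast; ring, Complex.re_ofReal_mul]
  simp only [Function.comp_apply, hre] at hs
  have h0 : dedekindZeta K s ≠ 0 := by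
    intro h
    rw [h] at hs
    have := hs.1
    simp at this; linarith
  have hd : 0 < s - 1 := by linarith
  rw [eulerSum_normTerm K (by linarith), tsum_negPow_eq K hs1' h0]
  constructor
  · refine ENNReal.ofReal_le_ofReal ?_
    rw [div_le_iff₀ hd]; linarith [hs.1]
  · refine ENNReal.ofReal_le_ofReal ?_
    rw [le_div_iff₀ hd]; linarith [hs.2]

/-- It is impossible that almost all primes of `K` have two distinct primes of `L` of the same norm
attached to them, injectively. -/
theorem not_exists_two_primes (L : Type*) [Field L] [NumberField L]
    (S : Set (HeightOneSpectrum (𝓞 K))) (hS : S.Finite)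
    (q : (↥Sᶜ ⊕ ↥Sᶜ) ↪ HeightOneSpectrum (𝓞 L))
    (hq : ∀ v : ↥Sᶜ, Ideal.absNorm (q (.inl v)).asIdeal = Ideal.absNorm v.1.asIdeal ∧
      Ideal.absNorm (q (.inr v)).asIdeal = Ideal.absNorm v.1.asIdeal) : False := by
  classical
  have : Finite S := hS
  obtain ⟨a, ha, hKa⟩ := exists_eulerSum_bounds K
  obtain ⟨b, hb, hLb⟩ := exists_eulerSum_bounds L
  have hsmall : ∀ s : ℝ, 1 < s → ∀ v, normTerm K s v ≤ 2⁻¹ := by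
    intro s hs v
    have h2 : 2 ≤ Ideal.absNorm v.asIdeal := by
      have h1 : Ideal.absNorm v.asIdeal ≠ 1 := fun h => v.isPrime.ne_top (Ideal.absNorm_eq_one_iff.1 h)
      have h0 : Ideal.absNorm v.asIdeal ≠ 0 := fun h => v.ne_bot (Ideal.absNorm_eq_zero_iff.1 h)
      omega
    have h2' : (2 : ℝ) ≤ Ideal.absNorm v.asIdeal := by exact_mod_cast h2
    have : ((Ideal.absNorm v.asIdeal : ℝ)) ^ (-s) ≤ 2⁻¹ := by
      rw [Real.rpow_neg (by positivity)]
      refine inv_anti₀ (by norm_num) (h2'.trans ?_)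
      exact Real.self_le_rpow_of_one_le (by linarith) hs.le
    calc normTerm K s v ≤ ENNReal.ofReal 2⁻¹ := ENNReal.ofReal_le_ofReal this
      _ = 2⁻¹ := by rw [ENNReal.ofReal_inv_of_pos (by norm_num)]; simp
  -- Two disjoint copies of almost all primes of `K` inside those of `L` bound the square of one
  -- zeta function by a constant times the other: a double pole against a simple one as `s → 1`.
  have key : ∀ s : ℝ, 1 < s →
      eulerSum (normTerm K s) ^ 2 ≤ (2 ^ Nat.card S) ^ 2 * eulerSum (normTerm L s) := by
    intro s hs
    have h1 : eulerSum (normTerm K s) =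
        eulerSum (fun v : S => normTerm K s v) * eulerSum (fun v : ↥Sᶜ => normTerm K s v) := by
      rw [← eulerSum_sumElim, ← eulerSum_comp_equiv (Equiv.Set.sumCompl S)]
      congr 1
      funext x; rcases x with x | x <;> simp
    have h2 : eulerSum (fun v : ↥Sᶜ => normTerm K s v) ^ 2 ≤ eulerSum (normTerm L s) := by
      rw [sq, ← eulerSum_sumElim]
      refine le_trans (le_of_eq ?_) (eulerSum_comp_le q _)
      congr 1
      funext x; rcases x with x | x
      · simp [normTerm, (hq x).1]
      · simp [normTerm, (hq x).2]
    rw [h1, mul_pow]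
    gcongr
    exact eulerSum_lt_top _ fun v => hsmall s hs v
  have hev : ∀ᶠ s in 𝓝[>] (1 : ℝ), a ^ 2 ≤ (2 ^ Nat.card S) ^ 2 * (4 * b) * (s - 1) := by
    filter_upwards [hKa, hLb, self_mem_nhdsWithin] with s h1 h2 hs
    have hs' : 0 < s - 1 := sub_pos.2 hs
    have h3 : ENNReal.ofReal ((a / (s - 1)) ^ 2) ≤
        ENNReal.ofReal ((2 ^ Nat.card S) ^ 2 * (4 * b / (s - 1))) := by
      rw [ENNReal.ofReal_pow (by positivity), ENNReal.ofReal_mul (by positivity),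
        ENNReal.ofReal_pow (by positivity), ENNReal.ofReal_pow (by positivity)]
      calc _ ≤ eulerSum (normTerm K s) ^ 2 := by gcongr; exact h1.1
        _ ≤ _ := key s hs
        _ ≤ _ := by
          gcongr
          · simp
          · exact h2.2
    rw [ENNReal.ofReal_le_ofReal_iff (by positivity), div_pow, div_le_iff₀ (by positivity)] at h3
    calc a ^ 2 ≤ _ := h3
      _ = _ := by field_simp
  have hlim : Tendsto (fun s : ℝ => (2 ^ Nat.card S) ^ 2 * (4 * b) * (s - 1)) (𝓝[>] 1) (𝓝 0) := by
    refine (Continuous.tendsto' (by fun_prop) _ _ (by simp)).mono_left nhdsWithin_le_nhds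
  have := ge_of_tendsto hlim hev
  have : 0 < a ^ 2 := by positivity
  linarith

end Zeta

end

/-! ### Primes fixed by an element of `p`-power order -/

section

open Filter Topology

section FrobeniusDensity

open IsDedekindDomain

/-- In a cyclic `p`-group every proper subgroup lies in the subgroup of `p`-th powers. -/
theorem mem_zpowers_pow_of_not_mem {G : Type*} [Group G] {g : G} {p a : ℕ} (hp : p.Prime)
    (hg : orderOf g = p ^ (a + 1)) {H : Subgroup G} (hgH : g ∉ H) {h : G}
    (hh : h ∈ Subgroup.zpowers g) (hhH : h ∈ H) : h ∈ Subgroup.zpowers (g ^ p) := by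
  obtain ⟨i, rfl⟩ := Subgroup.mem_zpowers_iff.1 hh
  by_cases hi : (p : ℤ) ∣ i
  · obtain ⟨j, rfl⟩ := hi
    exact Subgroup.mem_zpowers_iff.2 ⟨j, by rw [_root_.zpow_mul, zpow_natCast]⟩
  · have hcop : IsCoprime (i : ℤ) ((p : ℤ) ^ (a + 1)) :=
      (((Nat.prime_iff_prime_int.1 hp).coprime_iff_not_dvd.2 hi).symm).pow_right
    obtain ⟨u, v, huv⟩ := hcop
    refine absurd ?_ hgH
    have h1 : g ^ ((p : ℤ) ^ (a + 1)) = 1 := by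
      rw [← Nat.cast_pow, zpow_natCast, ← hg, pow_orderOf_eq_one]
    have : g = (g ^ i) ^ u := by
      rw [← _root_.zpow_mul, ← mul_one (g ^ (i * u)), ← _root_.one_zpow v, ← h1, ← _root_.zpow_mul,
        ← _root_.zpow_add, mul_comm i, mul_comm _ v, huv, _root_.zpow_one]
    rw [this]
    exact H.zpow_mem hhH u

/-- If there were finitely many primes, all of them could be put into the exceptional set and the
hypotheses of the zeta argument would hold vacuously. -/
theorem infinite_heightOneSpectrum (k : Type*) [Field k] [NumberField k] :
    Infinite (HeightOneSpectrum (𝓞 k)) := by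
  by_contra h
  rw [not_infinite_iff_finite] at h
  have he : IsEmpty ↥(Set.univ : Set (HeightOneSpectrum (𝓞 k)))ᶜ := ⟨fun x => x.2 trivial⟩
  exact not_exists_two_primes k k Set.univ Set.finite_univ
    ⟨fun x => isEmptyElim x, fun x => isEmptyElim x⟩ fun v => isEmptyElim v

theorem card_le_of_forall_pow_eq {F : Type*} [Field F] [Finite F] {m : ℕ}
    (hm : 1 < m) (h : ∀ x : F, x ^ m = x) : Nat.card F ≤ m := by
  classical
  have := Fintype.ofFinite F
  have hne : (Polynomial.X ^ m - Polynomial.X : Polynomial F) ≠ 0 :=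
    FiniteField.X_pow_card_sub_X_ne_zero _ hm
  have hcard := Polynomial.card_le_degree_of_subset_roots
    (p := (Polynomial.X ^ m - Polynomial.X : Polynomial F)) (Z := Finset.univ) (by
      intro x _
      rw [Polynomial.mem_roots hne]
      simp [h])
  rw [FiniteField.X_pow_card_sub_X_natDegree_eq _ hm] at hcard
  rw [Nat.card_eq_fintype_card]
  exact hcard

theorem one_lt_absNorm {k : Type*} [Field k] [NumberField k] (v : HeightOneSpectrum (𝓞 k)) :
    1 < Ideal.absNorm v.asIdeal := by
  have h1 : Ideal.absNorm v.asIdeal ≠ 1 := fun h => v.isPrime.ne_top (Ideal.absNorm_eq_one_iff.1 h)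
  have h0 : Ideal.absNorm v.asIdeal ≠ 0 := fun h => v.ne_bot (Ideal.absNorm_eq_zero_iff.1 h)
  omega

theorem absNorm_eq_card {k : Type*} [Field k] [NumberField k] (I : Ideal (𝓞 k)) :
    Ideal.absNorm I = Nat.card (𝓞 k ⧸ I) := by
  rw [Ideal.absNorm_apply, Submodule.cardQuot_apply]

/-- Every element of the residue field of `q` is a root of `X ^ Nv - X`, so this field is no larger
than that of `v`. -/
theorem absNorm_under_eq {k k₁ : Type*} [Field k] [NumberField k] [Field k₁] [NumberField k₁]
    [Algebra k k₁] (v : HeightOneSpectrum (𝓞 k)) (q : HeightOneSpectrum (𝓞 k₁))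
    (hq : q.asIdeal.under (𝓞 k) = v.asIdeal)
    (h : ∀ x : 𝓞 k₁, x - x ^ Ideal.absNorm v.asIdeal ∈ q.asIdeal) :
    Ideal.absNorm q.asIdeal = Ideal.absNorm v.asIdeal := by
  have hfin : Finite (𝓞 k₁ ⧸ q.asIdeal) := inferInstance
  apply le_antisymm
  · rw [absNorm_eq_card q.asIdeal]
    have := q.isMaximal
    let := Ideal.Quotient.field q.asIdeal
    refine card_le_of_forall_pow_eq (one_lt_absNorm v) fun x => ?_
    obtain ⟨x, rfl⟩ := Ideal.Quotient.mk_surjective x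
    rw [← map_pow, eq_comm, Ideal.Quotient.eq]
    exact h x
  · rw [absNorm_eq_card, absNorm_eq_card, ← hq]
    exact Nat.card_le_card_of_injective _
      (Ideal.algebraMap_quotient_injective (R := 𝓞 k) (I := q.asIdeal))

/-- If the set were finite, then for almost all `v` the decomposition groups above `v` would not
contain `g`, hence would lie in `⟨g ^ p⟩`. Such a `v` has two primes of its own norm in the fixed
field of `g ^ p`, which the poles of the zeta functions forbid. -/
theorem infinite_fixed_of_generator {k N : Type*} [Field k] [NumberField k] [Field N]
    [NumberField N] [Algebra k N] [IsGalois k N] {p a : ℕ} (hp : p.Prime) (g : Gal(N/k))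
    (hgen : ∀ h : Gal(N/k), h ∈ Subgroup.zpowers g) (hg : orderOf g = p ^ (a + 1)) :
    {Q : HeightOneSpectrum (𝓞 N) | g • Q.asIdeal = Q.asIdeal}.Infinite := by
  intro hfin
  set T := {Q : HeightOneSpectrum (𝓞 N) | g • Q.asIdeal = Q.asIdeal} with hT
  let S : Set (HeightOneSpectrum (𝓞 k)) := HeightOneSpectrum.under (𝓞 k) '' T
  have hS : S.Finite := hfin.image _
  have hstab : ∀ Q : HeightOneSpectrum (𝓞 N), Q.under (𝓞 k) ∉ S → ∀ h : Gal(N/k),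
      h • Q.asIdeal = Q.asIdeal → h ∈ Subgroup.zpowers (g ^ p) := by
    intro Q hQ h hh
    exact mem_zpowers_pow_of_not_mem hp hg (H := MulAction.stabilizer Gal(N/k) Q.asIdeal)
      (fun hcon => hQ ⟨Q, hcon, rfl⟩) (hgen h) hh
  have hgp : g ∉ Subgroup.zpowers (g ^ p) := by
    intro h
    have h1 : Subgroup.zpowers (g ^ p) = Subgroup.zpowers g :=
      le_antisymm (by simp) (by simpa using h)
    have h2 : orderOf (g ^ p) = orderOf g := by
      rw [← Nat.card_zpowers, ← Nat.card_zpowers, h1]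
    rw [orderOf_pow_of_dvd hp.ne_zero (by rw [hg]; exact dvd_pow_self _ (by omega)), hg, pow_succ,
      Nat.mul_div_cancel _ hp.pos] at h2
    have := hp.one_lt
    have h3 : 0 < p ^ a := pow_pos hp.pos a
    nlinarith
  -- Outside `S` the decomposition groups act trivially on this field. In particular Frobenius
  -- elements do, so the residue fields do not grow from `k` to `k₁`.
  let k₁ : IntermediateField k N := IntermediateField.fixedField (Subgroup.zpowers (g ^ p))
  have hk₁ : k₁.fixingSubgroup = Subgroup.zpowers (g ^ p) :=
    IntermediateField.fixingSubgroup_fixedField _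
  have hnorm : ∀ Q : HeightOneSpectrum (𝓞 N), Q.under (𝓞 k) ∉ S →
      Ideal.absNorm (Q.under (𝓞 k₁)).asIdeal = Ideal.absNorm (Q.under (𝓞 k)).asIdeal := by
    intro Q hQ
    refine absNorm_under_eq (Q.under (𝓞 k)) (Q.under (𝓞 k₁)) ?_ fun x => ?_
    · exact Ideal.under_under _
    · obtain ⟨φ, hφ⟩ := IsArithFrobAt.exists_of_isInvariant (𝓞 k) Gal(N/k) Q.asIdeal
      have h1 : φ⁻¹ • Q.asIdeal = Q.asIdeal := by
        ext y
        rw [Ideal.mem_pointwise_smul_iff_inv_smul_mem, inv_inv]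
        exact Ideal.ext_iff.1 hφ.comap_eq y
      have h2 : φ ∈ k₁.fixingSubgroup := by
        rw [hk₁, ← inv_mem_iff]
        exact hstab Q hQ _ h1
      have h3 := hφ (algebraMap (𝓞 k₁) (𝓞 N) x)
      have h4 : φ • algebraMap (𝓞 k₁) (𝓞 N) x = algebraMap (𝓞 k₁) (𝓞 N) x := by
        ext
        exact (IntermediateField.mem_fixingSubgroup_iff _ _).1 h2 _ (x : k₁).2
      change φ • algebraMap (𝓞 k₁) (𝓞 N) x - _ ∈ _ at h3
      rw [h4, ← map_pow, ← map_sub, ← absNorm_eq_card] at h3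
      exact h3
  have hex : ∀ v : HeightOneSpectrum (𝓞 k), ∃ Q : HeightOneSpectrum (𝓞 N), Q.under (𝓞 k) = v := by
    intro v
    obtain ⟨Q, -, hQ, hQv⟩ := Ideal.exists_ideal_over_prime_of_isIntegral v.asIdeal
      (⊥ : Ideal (𝓞 N)) (by
        rw [← RingHom.ker_eq_comap_bot, (RingHom.injective_iff_ker_eq_bot _).1
          (FaithfulSMul.algebraMap_injective (𝓞 k) (𝓞 N))]
        exact bot_le)
    refine ⟨⟨Q, hQ, ?_⟩, HeightOneSpectrum.ext hQv⟩
    rintro rfl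
    refine v.ne_bot ?_
    rw [← hQv, ← RingHom.ker_eq_comap_bot, (RingHom.injective_iff_ker_eq_bot _).1
          (FaithfulSMul.algebraMap_injective (𝓞 k) (𝓞 N))]
  choose Q hQ using hex
  have hsm : ∀ R : HeightOneSpectrum (𝓞 N), ∃ R' : HeightOneSpectrum (𝓞 N),
      R'.asIdeal = g • R.asIdeal := by
    intro R
    have := R.isPrime
    refine ⟨⟨g • R.asIdeal, inferInstance, fun h => R.ne_bot ?_⟩, rfl⟩
    rw [smul_eq_iff_eq_inv_smul] at h
    rw [h, Ideal.smul_bot]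
  choose gs hgs using hsm
  have hgsu : ∀ R, (gs R).under (𝓞 k) = R.under (𝓞 k) := fun R => HeightOneSpectrum.ext (by
    change (gs R).asIdeal.under _ = R.asIdeal.under _
    rw [hgs, Ideal.under_smul])
  -- The two primes are those below `Q v` and `g • Q v`. If they agreed in `k₁`, then `g` would lie
  -- in `⟨g ^ p⟩` times a decomposition group, which is again `⟨g ^ p⟩`.
  let R : ↥Sᶜ ⊕ ↥Sᶜ → HeightOneSpectrum (𝓞 N) := Sum.elim (fun v => Q v) fun v => gs (Q v)
  have hR : ∀ x, (R x).under (𝓞 k) = (Sum.elim id id x : ↥Sᶜ) := by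
    rintro (x | x)
    · exact hQ _
    · exact (hgsu _).trans (hQ _)
  have hRk : ∀ x, ((R x).under (𝓞 k₁)).asIdeal.under (𝓞 k) = ((Sum.elim id id x : ↥Sᶜ) : HeightOneSpectrum (𝓞 k)).asIdeal := by
    intro x
    rw [← hR x]
    exact Ideal.under_under _
  have hne : ∀ v : ↥Sᶜ, (R (.inl v)).under (𝓞 k₁) ≠ (R (.inr v)).under (𝓞 k₁) := by
    intro v h
    have h1 : (Q v).asIdeal.under (𝓞 k₁) = (gs (Q v)).asIdeal.under (𝓞 k₁) :=
      congrArg HeightOneSpectrum.asIdeal h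
    have := (Q v).isPrime
    have := (gs (Q v)).isPrime
    obtain ⟨b, hb⟩ := Algebra.IsInvariant.exists_smul_of_under_eq (𝓞 k₁) (𝓞 N) Gal(N/k₁) _ _ h1
    let b' : Gal(N/k) := b.restrictScalars k
    have hb' : b' ∈ Subgroup.zpowers (g ^ p) := by
      rw [← hk₁, IntermediateField.mem_fixingSubgroup_iff]
      intro x hx
      exact b.commutes ⟨x, hx⟩
    have hb2 : g • (Q v).asIdeal = b' • (Q v).asIdeal := by
      rw [← hgs, hb]
      rfl
    have hb3 : (b'⁻¹ * g) • (Q v).asIdeal = (Q v).asIdeal := by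
      rw [mul_smul, hb2, inv_smul_smul]
    have hb4 := hstab (Q v) (by rw [hQ]; exact v.2) _ hb3
    exact hgp (by simpa using mul_mem hb' hb4)
  refine not_exists_two_primes k k₁ S hS ⟨fun x => (R x).under (𝓞 k₁), ?_⟩ ?_
  · intro x y hxy
    have h1 : (Sum.elim id id x : ↥Sᶜ) = Sum.elim id id y := by
      refine Subtype.ext (HeightOneSpectrum.ext ?_)
      rw [← hRk, ← hRk]
      exact congrArg (fun q : HeightOneSpectrum (𝓞 k₁) => q.asIdeal.under (𝓞 k)) hxy
    rcases x with x | x <;> rcases y with y | y <;> simp only [Sum.elim_inl, Sum.elim_inr, id] at h1 <;>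
      subst h1
    · rfl
    · exact absurd hxy (hne _)
    · exact absurd hxy.symm (hne _)
    · rfl
  · intro v
    constructor
    · exact (hnorm _ (by rw [hR]; exact v.2)).trans (by rw [hR]; rfl)
    · exact (hnorm _ (by rw [hR]; exact v.2)).trans (by rw [hR]; rfl)

end FrobeniusDensity

end

/-! ### Existence of Frobenius elements -/

section

open Filter Topology

section FrobeniusExistence

open IsDedekindDomain

/-- Replacing the base by the fixed field of `⟨g⟩` makes `g` a generator. -/
theorem infinite_fixed_of_pow_eq_one {k N : Type*} [Field k] [NumberField k] [Field N]
    [NumberField N] [Algebra k N] [IsGalois k N] {p a : ℕ} (hp : p.Prime) (g : Gal(N/k))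
    (hg : g ^ p ^ a = 1) :
    {Q : HeightOneSpectrum (𝓞 N) | g • Q.asIdeal = Q.asIdeal}.Infinite := by
  obtain ⟨b, -, hb⟩ := (Nat.dvd_prime_pow hp).1 (orderOf_dvd_of_pow_eq_one hg)
  rcases b with _ | b
  · rw [pow_zero, orderOf_eq_one_iff] at hb
    subst hb
    simp only [one_smul]
    have := infinite_heightOneSpectrum N
    exact Set.infinite_univ
  · let k₀ : IntermediateField k N := IntermediateField.fixedField (Subgroup.zpowers g)
    have hk₀ : k₀.fixingSubgroup = Subgroup.zpowers g :=
      IntermediateField.fixingSubgroup_fixedField _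
    have hmem : g ∈ k₀.fixingSubgroup := hk₀ ▸ Subgroup.mem_zpowers g
    let g₀ : Gal(N/k₀) := k₀.fixingSubgroupEquiv ⟨g, hmem⟩
    refine infinite_fixed_of_generator (k := k₀) (a := b) hp g₀ (fun h => ?_) ?_
    · obtain ⟨⟨x, hx⟩, rfl⟩ := k₀.fixingSubgroupEquiv.surjective h
      have hx' := hx
      rw [hk₀] at hx'
      obtain ⟨i, rfl⟩ := Subgroup.mem_zpowers_iff.1 hx'
      refine Subgroup.mem_zpowers_iff.2 ⟨i, ?_⟩
      rw [← map_zpow]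
      rfl
    · rw [← hb]
      exact (MulEquiv.orderOf_eq _ _).trans (Subgroup.orderOf_mk _ _)

/-- With trivial inertia the decomposition group embeds into the Galois group of the residue fields,
which is generated by Frobenius. -/
theorem eq_pow_of_smul_eq {k N : Type*} [Field k] [NumberField k] [Field N]
    [NumberField N] [Algebra k N] [IsGalois k N] (Q : HeightOneSpectrum (𝓞 N))
    (hQ : ∀ τ : Gal(N/k), (∀ x : 𝓞 N, τ • x - x ∈ Q.asIdeal) → τ = 1) (φ g : Gal(N/k))
    (hφ : IsArithFrobAt (𝓞 k) φ Q.asIdeal) (hg : g • Q.asIdeal = Q.asIdeal) :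
    ∃ j : ℕ, g = φ ^ j := by
  let P := (Q.under (𝓞 k))
  have : Q.asIdeal.LiesOver P.asIdeal := ⟨rfl⟩
  have := Q.isMaximal
  have := P.isMaximal
  let := Ideal.Quotient.field Q.asIdeal
  let := Ideal.Quotient.field P.asIdeal
  have := Fintype.ofFinite (𝓞 k ⧸ P.asIdeal)
  let gs := Ideal.Quotient.stabilizerHom Q.asIdeal P.asIdeal Gal(N/k) ⟨g, hg⟩
  obtain ⟨j, hj⟩ := (FiniteField.bijective_frobeniusAlgEquivOfAlgebraic_pow
    (𝓞 k ⧸ P.asIdeal) (𝓞 N ⧸ Q.asIdeal)).2 gs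
  have hpow : ∀ (i : ℕ) (x : 𝓞 N), Ideal.Quotient.mk Q.asIdeal ((φ ^ i) • x) =
      Ideal.Quotient.mk Q.asIdeal x ^ (Nat.card (𝓞 k ⧸ P.asIdeal)) ^ i := by
    intro i
    induction i with
    | zero => intro x; simp
    | succ i ih =>
      intro x
      rw [pow_succ, mul_smul, ih, pow_succ', pow_mul]
      congr 1
      exact hφ.mk_apply x
  have hgx : ∀ x : 𝓞 N, Ideal.Quotient.mk Q.asIdeal (g • x) =
      Ideal.Quotient.mk Q.asIdeal x ^ (Nat.card (𝓞 k ⧸ P.asIdeal)) ^ (j : ℕ) := by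
    intro x
    have h1 : gs (Ideal.Quotient.mk Q.asIdeal x) = Ideal.Quotient.mk Q.asIdeal (g • x) := rfl
    rw [← h1, ← hj]
    have h2 := congrFun (FiniteField.coe_frobeniusAlgEquivOfAlgebraic_iterate
      (𝓞 k ⧸ P.asIdeal) (𝓞 N ⧸ Q.asIdeal) j) (Ideal.Quotient.mk Q.asIdeal x)
    rw [Nat.card_eq_fintype_card]
    exact (congrFun (AlgEquiv.coe_pow _ _) _).trans h2
  refine ⟨j, ?_⟩
  rw [← mul_inv_eq_one]
  refine hQ _ fun x => ?_
  rw [← Ideal.Quotient.eq, mul_smul, hgx, ← hpow, smul_inv_smul]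

variable {k Ω : Type*} [Field k] [NumberField k] [Field Ω] [Algebra k Ω] [IsAlgClosure k Ω]

theorem isGalois_of_isAlgClosure (k Ω : Type*) [Field k] [NumberField k] [Field Ω] [Algebra k Ω]
    [IsAlgClosure k Ω] : IsGalois k Ω := by
  have := IsAlgClosure.isAlgClosed (R := k) (K := Ω)
  have := IsAlgClosure.isAlgebraic (R := k) (K := Ω)
  have : Normal k Ω := IsAlgClosure.normal k Ω
  exact ⟨⟩

/-- The decomposition group of a profinite Galois group surjects onto the automorphisms of the
residue extension, so the residual Frobenius lifts. -/
theorem exists_isFrobeniusAt (v : HeightOneSpectrum (𝓞 k)) (w : Ideal (𝓞 Ω))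
    (hw : IsPrimeAbove v w) : ∃ φ : Gal(Ω/k), IsFrobeniusAt φ w := by
  have hgal := isGalois_of_isAlgClosure k Ω
  -- With the discrete topology, continuity of the action says that every algebraic integer has an
  -- open stabilizer.
  let : TopologicalSpace (𝓞 Ω) := ⊥
  have : DiscreteTopology (𝓞 Ω) := ⟨rfl⟩
  have hcomm : SMulCommClass Gal(Ω/k) (𝓞 k) (𝓞 Ω) := ⟨fun σ a x => by
    ext
    change σ ((algebraMap (𝓞 k) (𝓞 Ω) a * x : 𝓞 Ω) : Ω) = ((algebraMap (𝓞 k) (𝓞 Ω) a : 𝓞 Ω) : Ω) * σ x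
    refine (map_mul σ ((algebraMap (𝓞 k) (𝓞 Ω) a : 𝓞 Ω) : Ω) (x : Ω)).trans ?_
    congr 1
    exact σ.commutes a⟩
  have : ContinuousSMul Gal(Ω/k) (𝓞 Ω) := by
    rw [continuousSMul_iff_stabilizer_isOpen]
    intro x
    convert stabilizer_isOpen_of_isIntegral (K := k) (L := Ω) (x : Ω) using 1
    ext σ
    exact RingOfIntegers.ext_iff
  have : Algebra.IsInvariant (𝓞 k) (𝓞 Ω) Gal(Ω/k) := ⟨fun x hx => by
    obtain ⟨y, hy⟩ := (InfiniteGalois.mem_range_algebraMap_iff_fixed (k := k) (x : Ω)).2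
      fun σ => RingOfIntegers.ext_iff.1 (hx σ)
    have hyi : IsIntegral ℤ y := by
      rw [← isIntegral_algebraMap_iff (algebraMap k Ω).injective, hy]
      exact x.2
    exact ⟨⟨y, hyi⟩, RingOfIntegers.ext hy⟩⟩
  have hwp := hw.1
  have : w.LiesOver v.asIdeal := ⟨hw.2.symm⟩
  have := v.isMaximal
  let := Ideal.Quotient.field v.asIdeal
  have := Fintype.ofFinite (𝓞 k ⧸ v.asIdeal)
  have : w.IsMaximal := Ideal.isMaximal_of_isIntegral_of_isMaximal_comap (R := 𝓞 k) w
    (by rw [← Ideal.under_def, hw.2]; exact v.isMaximal)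
  let := Ideal.Quotient.field w
  have : Algebra.IsAlgebraic (𝓞 k ⧸ v.asIdeal) (𝓞 Ω ⧸ w) := inferInstance
  obtain ⟨φ, hφ⟩ := Ideal.Quotient.stabilizerHom_surjective_of_profinite (G := Gal(Ω/k)) v.asIdeal w
    (FiniteField.frobeniusAlgEquivOfAlgebraic (𝓞 k ⧸ v.asIdeal) (𝓞 Ω ⧸ w))
  refine ⟨φ, fun x => ?_⟩
  rw [hw.2, Nat.card_eq_fintype_card, ← Ideal.Quotient.eq, map_pow]
  have := congrArg (fun e => e (Ideal.Quotient.mk w x)) hφ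
  exact this

/-- A weak form of Frobenius density: an element of `p`-power order modulo an open subgroup is
congruent to a power of a Frobenius element. -/
theorem exists_isFrobeniusAt_pow {p : ℕ} (hp : p.Prime) {S : Set (HeightOneSpectrum (𝓞 k))}
    (hS : S.Finite) (V : Set Gal(Ω/k)) (hV : V ∈ 𝓝 1) :
    ∃ N : IntermediateField k Ω, (N.fixingSubgroup : Set Gal(Ω/k)) ⊆ V ∧ FiniteDimensional k N ∧
      Normal k N ∧
    ∀ (a : ℕ) (g : Gal(Ω/k)), g ^ p ^ a ∈ N.fixingSubgroup →
    ∃ v ∉ S, ∃ w : Ideal (𝓞 Ω), IsPrimeAbove v w ∧ ∃ φ : Gal(Ω/k), IsFrobeniusAt φ w ∧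
      ∃ j : ℕ, g⁻¹ * φ ^ j ∈ V := by
  classical
  have hgal := isGalois_of_isAlgClosure k Ω
  obtain ⟨N, hfd, hnorm, hNV⟩ := (krullTopology_mem_nhds_one_iff_of_normal k Ω V).1 hV
  refine ⟨N, hNV, hfd, hnorm, fun a g hg => ?_⟩
  have : Algebra.IsSeparable k N := inferInstance
  have : IsGalois k N := ⟨⟩
  have : NumberField N := NumberField.of_module_finite k N
  let r : Gal(Ω/k) →* Gal(N/k) := AlgEquiv.restrictNormalHom N
  have hker : ∀ x, r x = 1 → x ∈ V := fun x hx => hNV (by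
    rw [SetLike.mem_coe, ← IntermediateField.restrictNormalHom_ker]; exact hx)
  have hr : r g ^ p ^ a = 1 := by
    rw [← map_pow]
    rw [← IntermediateField.restrictNormalHom_ker] at hg
    exact hg
  have hinf := infinite_fixed_of_pow_eq_one hp (r g) hr
  -- One integer moved by each `τ ≠ 1` suffices to exclude ramification: if `τ` is inertial at `Q`,
  -- then `Q` divides the non-zero element `τ • x τ - x τ`.
  have hτ : ∀ τ : Gal(N/k), τ ≠ 1 → ∃ x : 𝓞 N, τ • x - x ≠ 0 := by
    intro τ hτ
    by_contra! hcon
    refine hτ (AlgEquiv.ext fun y => ?_)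
    obtain ⟨a, b, hb, rfl⟩ := IsFractionRing.div_surjective (A := 𝓞 N) y
    have h1 : ∀ x : 𝓞 N, τ (algebraMap (𝓞 N) N x) = algebraMap (𝓞 N) N x := fun x =>
      RingOfIntegers.ext_iff.1 (sub_eq_zero.1 (hcon x))
    rw [map_div₀, h1, h1]
    rfl
  choose! x hx using hτ
  have hbad1 : {Q : HeightOneSpectrum (𝓞 N) | ∃ τ : Gal(N/k), τ ≠ 1 ∧
      τ • x τ - x τ ∈ Q.asIdeal}.Finite := by
    have : {Q : HeightOneSpectrum (𝓞 N) | ∃ τ : Gal(N/k), τ ≠ 1 ∧ τ • x τ - x τ ∈ Q.asIdeal} =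
        ⋃ τ ∈ {τ : Gal(N/k) | τ ≠ 1}, {Q | τ • x τ - x τ ∈ Q.asIdeal} := by
      ext Q; simp
    rw [this]
    refine (Set.toFinite _).biUnion fun τ hτ => ?_
    have := Ideal.finite_factors (R := 𝓞 N) (I := Ideal.span {τ • x τ - x τ})
      (by simpa [Ideal.zero_eq_bot] using hx τ hτ)
    refine this.subset fun Q hQ => ?_
    simpa [Ideal.dvd_span_singleton] using hQ
  have hbad2 : {Q : HeightOneSpectrum (𝓞 N) | Q.under (𝓞 k) ∈ S}.Finite := by
    have : {Q : HeightOneSpectrum (𝓞 N) | Q.under (𝓞 k) ∈ S} =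
        ⋃ v ∈ S, {Q | Q.under (𝓞 k) = v} := by
      ext Q; simp
    rw [this]
    refine hS.biUnion fun v hv => ?_
    have hne : v.asIdeal.map (algebraMap (𝓞 k) (𝓞 N)) ≠ ⊥ :=
      Ideal.map_ne_bot_of_ne_bot v.ne_bot
    refine (Ideal.finite_factors hne).subset fun Q hQ => ?_
    rw [Set.mem_ofPred_eq, Ideal.dvd_iff_le, Ideal.map_le_iff_le_comap, ← hQ.out]
    exact le_rfl
  -- A prime stabilized by the image of `g`, with trivial inertia and not above `S`.
  obtain ⟨Q, hQ, hQb⟩ := (hinf.sdiff (hbad1.union hbad2)).nonempty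
  rw [Set.mem_union, not_or] at hQb
  obtain ⟨w, -, hwp, hwQ⟩ := Ideal.exists_ideal_over_prime_of_isIntegral Q.asIdeal
    (⊥ : Ideal (𝓞 Ω)) (by
      rw [← RingHom.ker_eq_comap_bot, (RingHom.injective_iff_ker_eq_bot _).1
        (RingOfIntegers.algebraMap.injective N Ω)]
      exact bot_le)
  have hwv : IsPrimeAbove (Q.under (𝓞 k)) w := by
    refine ⟨hwp, ?_⟩
    change _ = Q.asIdeal.under (𝓞 k)
    rw [← hwQ, ← Ideal.under_def, Ideal.under_under]
  obtain ⟨φ, hφ⟩ := exists_isFrobeniusAt _ w hwv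
  refine ⟨Q.under (𝓞 k), hQb.2, w, hwv, φ, hφ, ?_⟩
  obtain ⟨j, hj⟩ := eq_pow_of_smul_eq (k := k) Q (fun τ h => by
    by_contra hτ1; exact hQb.1 ⟨τ, hτ1, h _⟩) (r φ) (r g) (fun y => by
      have h1 := hφ (algebraMap (𝓞 N) (𝓞 Ω) y)
      rw [hwv.2] at h1
      refine (Ideal.ext_iff.1 hwQ _).1 ?_
      rw [Ideal.mem_comap, map_sub, map_pow]
      have h2 : algebraMap (𝓞 N) (𝓞 Ω) ((MulSemiringAction.toAlgHom (𝓞 k) (𝓞 N) (r φ)) y) =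
          RingOfIntegers.mapAlgHom (k := k) φ (algebraMap (𝓞 N) (𝓞 Ω) y) := by
        ext
        exact AlgEquiv.restrictNormal_commutes φ N _
      rw [h2]
      exact h1) hQ
  refine ⟨j, hker _ ?_⟩
  rw [map_mul, map_inv, map_pow, ← hj, inv_mul_cancel]

end FrobeniusExistence

end

/-! ### Embeddings of `E_p` and descent from `ℚ̄_p` -/

section

open Filter Topology

section LocEmb

variable {p : ℕ} [Fact p.Prime] {E : Type*} [Field E] [NumberField E]

theorem locEmb_tmul (ν : E →ₐ[ℚ] PadicAlgCl p) (a : ℚ_[p]) (x : E) :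
    locEmb p ν (a ⊗ₜ x) = algebraMap ℚ_[p] (PadicAlgCl p) a * ν x := by
  simp [locEmb, Algebra.ofId_apply]

theorem locEmb_includeRight (ν : E →ₐ[ℚ] PadicAlgCl p) (x : E) :
    locEmb p ν (Algebra.TensorProduct.includeRight x) = ν x := by
  simp [locEmb_tmul]

theorem locEmb_locAut (ν : E →ₐ[ℚ] PadicAlgCl p) (σ : E ≃ₐ[ℚ] E) (r : Loc p E) :
    locEmb p ν (locAut p σ r) = locEmb p (ν.comp σ.toAlgHom) r := by
  induction r using TensorProduct.induction_on with
  | zero => simp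
  | tmul a b => simp [locAut, locEmb_tmul]
  | add a b ha hb => rw [map_add, map_add, map_add, ha, hb]

/-- The matrix of all embeddings with respect to a basis is invertible. -/
theorem exists_equiv_det_ne_zero : ∃ e : Fin (Module.finrank ℚ E) ≃ (E →ₐ[ℚ] PadicAlgCl p),
    (Matrix.of fun i j => e j (Module.finBasis ℚ E i)).det ≠ 0 := by
  have hcard : Fintype.card (Fin (Module.finrank ℚ E)) = Fintype.card (E →ₐ[ℚ] PadicAlgCl p) := by
    rw [Fintype.card_fin, AlgHom.card]
  let e := Fintype.equivOfCardEq hcard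
  refine ⟨e, fun h => ?_⟩
  have h1 := Algebra.discr_eq_det_embeddingsMatrixReindex_pow_two ℚ (PadicAlgCl p)
    (Module.finBasis ℚ E) e
  have h2 : Algebra.embeddingsMatrixReindex ℚ (PadicAlgCl p) (Module.finBasis ℚ E) e =
      Matrix.of fun i j => e j (Module.finBasis ℚ E i) := rfl
  rw [h2, h, zero_pow two_ne_zero, map_eq_zero] at h1
  exact Algebra.discr_not_zero_of_basis ℚ (Module.finBasis ℚ E) h1

theorem eq_zero_of_sum_mul_emb (d : (E →ₐ[ℚ] PadicAlgCl p) → PadicAlgCl p)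
    (h : ∀ x : E, ∑ ν, d ν * ν x = 0) (ν : E →ₐ[ℚ] PadicAlgCl p) : d ν = 0 := by
  obtain ⟨e, he⟩ := exists_equiv_det_ne_zero (p := p) (E := E)
  have h1 := Matrix.eq_zero_of_mulVec_eq_zero he (v := d ∘ e) (by
    funext i
    rw [Matrix.mulVec, dotProduct, Pi.zero_apply, ← h (Module.finBasis ℚ E i), ← e.sum_comp]
    exact Finset.sum_congr rfl fun j _ => mul_comm _ _)
  simpa using congrFun h1 (e.symm ν)

/-- The discriminant of `E` does not vanish, so the embeddings form a basis of the `ℚ̄_p`-valued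
linear functionals on `E_p`. -/
theorem exists_functional_eq_sum (φ : Loc p E →ₗ[ℚ_[p]] ℚ_[p]) :
    ∃ c : (E →ₐ[ℚ] PadicAlgCl p) → PadicAlgCl p, ∀ r,
      algebraMap ℚ_[p] (PadicAlgCl p) (φ r) = ∑ ν, c ν * locEmb p ν r := by
  obtain ⟨e, he⟩ := exists_equiv_det_ne_zero (p := p) (E := E)
  set M := Matrix.of fun i j => e j (Module.finBasis ℚ E i) with hM
  let b := Algebra.TensorProduct.basis ℚ_[p] (Module.finBasis ℚ E)
  let t : Fin (Module.finrank ℚ E) → PadicAlgCl p := fun i => algebraMap ℚ_[p] _ (φ (b i))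
  have hc : M *ᵥ (M⁻¹ *ᵥ t) = t := by
    rw [Matrix.mulVec_mulVec, Matrix.mul_nonsing_inv _ (isUnit_iff_ne_zero.2 he), Matrix.one_mulVec]
  let c : (E →ₐ[ℚ] PadicAlgCl p) → PadicAlgCl p := fun ν => (M⁻¹ *ᵥ t) (e.symm ν)
  refine ⟨c, ?_⟩
  have : (Algebra.linearMap ℚ_[p] (PadicAlgCl p)).comp φ =
      ∑ ν, c ν • (locEmb p ν).toLinearMap := by
    refine b.ext fun i => ?_
    have hi := congrFun hc i
    rw [LinearMap.comp_apply, LinearMap.sum_apply, ← e.sum_comp]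
    refine hi.symm.trans ?_
    rw [Matrix.mulVec, dotProduct]
    refine Finset.sum_congr rfl fun j _ => ?_
    have : locEmb p (e j) (b i) = M i j := by
      simp [b, hM, locEmb_tmul]
    change _ = c (e j) * locEmb p (e j) (b i)
    rw [this, mul_comm]
    simp [c]
  intro r
  have := LinearMap.congr_fun this r
  simpa using this

theorem locEmb_ext {r s : Loc p E} (h : ∀ ν : E →ₐ[ℚ] PadicAlgCl p, locEmb p ν r = locEmb p ν s) :
    r = s := by
  rw [← sub_eq_zero, ← Module.forall_dual_apply_eq_zero_iff ℚ_[p]]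
  intro φ
  obtain ⟨c, hc⟩ := exists_functional_eq_sum φ
  have := hc (r - s)
  simp only [map_sub, h, sub_self, mul_zero, Finset.sum_const_zero] at this
  rw [← map_sub, map_eq_zero] at this
  simpa using this

/-- Such an element is not a zero divisor, and in an Artinian ring non-zero-divisors are units. -/
theorem isUnit_of_locEmb_ne_zero {r : Loc p E}
    (h : ∀ ν : E →ₐ[ℚ] PadicAlgCl p, locEmb p ν r ≠ 0) : IsUnit r := by
  have : IsArtinianRing (Loc p E) := IsArtinianRing.of_finite ℚ_[p] (Loc p E)
  refine IsArtinianRing.isUnit_of_mem_nonZeroDivisors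
    (mem_nonZeroDivisors_iff_left.2 fun s hs => locEmb_ext fun ν => ?_)
  have := congrArg (locEmb p ν) hs
  rw [map_mul, map_zero, mul_eq_zero] at this
  rw [map_zero]
  exact this.resolve_left (h ν)

end LocEmb

section MatrixEmb

variable {p : ℕ} [Fact p.Prime] {E : Type*} [Field E] [NumberField E] {n : ℕ}

variable (p E n) in
/-- The coefficient ring of the representations. -/
abbrev LocMat : Type _ := Matrix (Fin n) (Fin n) (Loc p E)

/-- Base change of a matrix over `E_p` along an embedding. -/
def matEmb (ν : E →ₐ[ℚ] PadicAlgCl p) :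
    LocMat p E n →ₐ[ℚ_[p]] Matrix (Fin n) (Fin n) (PadicAlgCl p) := (locEmb p ν).mapMatrix

/-- All base changes of a matrix over `E_p`. -/
def matEmbAll : LocMat p E n →ₗ[ℚ_[p]]
    ((E →ₐ[ℚ] PadicAlgCl p) → Matrix (Fin n) (Fin n) (PadicAlgCl p)) :=
  LinearMap.pi fun ν => (matEmb ν).toLinearMap

theorem matEmb_apply (ν : E →ₐ[ℚ] PadicAlgCl p) (x : LocMat p E n) (i j : Fin n) :
    matEmb ν x i j = locEmb p ν (x i j) := rfl

theorem matEmbAll_apply (ν : E →ₐ[ℚ] PadicAlgCl p) (x : LocMat p E n) :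
    matEmbAll x ν = matEmb ν x := rfl

theorem matEmb_smul (ν : E →ₐ[ℚ] PadicAlgCl p) (r : Loc p E) (x : LocMat p E n) :
    matEmb ν (r • x) = locEmb p ν r • matEmb ν x := by
  ext i j
  simp [matEmb_apply]

theorem trace_matEmb (ν : E →ₐ[ℚ] PadicAlgCl p) (x : LocMat p E n) :
    (matEmb ν x).trace = locEmb p ν x.trace := by
  simp [Matrix.trace, matEmb_apply]

theorem exists_matFunctional_eq_sum (φ : LocMat p E n →ₗ[ℚ_[p]] ℚ_[p]) :
    ∃ Z : (E →ₐ[ℚ] PadicAlgCl p) → Matrix (Fin n) (Fin n) (PadicAlgCl p), ∀ x,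
      algebraMap ℚ_[p] (PadicAlgCl p) (φ x) = ∑ ν, (Z ν * matEmb ν x).trace := by
  have h : ∀ i j : Fin n, ∃ c : (E →ₐ[ℚ] PadicAlgCl p) → PadicAlgCl p, ∀ r,
      algebraMap ℚ_[p] (PadicAlgCl p) (φ (Matrix.single i j r)) = ∑ ν, c ν * locEmb p ν r :=
    fun i j => exists_functional_eq_sum (φ.comp (Matrix.singleLinearMap ℚ_[p] i j))
  choose c hc using h
  refine ⟨fun ν => Matrix.of fun j i => c i j ν, fun x => ?_⟩
  conv_lhs => rw [Matrix.matrix_eq_sum_single x]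
  simp only [map_sum, hc]
  simp only [Matrix.trace, Matrix.diag, Matrix.mul_apply, Matrix.of_apply, matEmb_apply]
  rw [Finset.sum_comm, Finset.sum_comm (s := Finset.univ (α := E →ₐ[ℚ] PadicAlgCl p))]
  refine Finset.sum_congr rfl fun j _ => ?_
  rw [Finset.sum_comm]

/-- Descent of a linear subspace from the algebraic closure. -/
theorem mem_of_matEmbAll_mem_span {W : Submodule ℚ_[p] (LocMat p E n)} {x : LocMat p E n}
    (hx : matEmbAll x ∈ Submodule.span (PadicAlgCl p) (matEmbAll '' (W : Set (LocMat p E n)))) :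
    x ∈ W := by
  by_contra hxW
  -- A `ℚ_p`-functional that kills `W` but not `x` is a `ℚ̄_p`-linear form in the base changes, so
  -- it also kills the span over `ℚ̄_p`.
  obtain ⟨φ, hφx, hφW⟩ := Submodule.exists_le_ker_of_notMem hxW
  obtain ⟨Z, hZ⟩ := exists_matFunctional_eq_sum φ
  have key : ∀ T ∈ Submodule.span (PadicAlgCl p) (matEmbAll '' (W : Set (LocMat p E n))),
      ∑ ν, (Z ν * T ν).trace = 0 := by
    intro T hT
    induction hT using Submodule.span_induction with
    | mem T hT =>
      obtain ⟨y, hy, rfl⟩ := hT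
      have := hZ y
      rw [hφW hy, map_zero] at this
      exact this.symm
    | zero => simp
    | add a b _ _ ha hb => simp [mul_add, Finset.sum_add_distrib, ha, hb]
    | smul c a _ ha => simp [← Finset.mul_sum, ha]
  have := hZ x
  rw [show ∑ ν, (Z ν * matEmb ν x).trace = 0 from key _ hx, map_eq_zero] at this
  exact hφx this

/-- A family of matrices over `E_p` that is non-degenerate for the trace form under every embedding
spans the whole matrix ring. -/
theorem span_eq_top_of_nondegenerate {s : Set (LocMat p E n)}
    (hs : ∀ (ν : E →ₐ[ℚ] PadicAlgCl p) (Z : Matrix (Fin n) (Fin n) (PadicAlgCl p)),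
      (∀ x ∈ s, (Z * matEmb ν x).trace = 0) → Z = 0) :
    Submodule.span (Loc p E) s = ⊤ := by
  rw [eq_top_iff]
  intro x _
  by_contra hx
  have hx' : x ∉ (Submodule.span (Loc p E) s).restrictScalars ℚ_[p] := hx
  obtain ⟨φ, hφx, hφW⟩ := Submodule.exists_le_ker_of_notMem hx'
  obtain ⟨Z, hZ⟩ := exists_matFunctional_eq_sum φ
  have h0 : ∀ ν, Z ν = 0 := by
    intro ν
    refine hs ν _ fun y hy => ?_
    -- Multiplying `y` by elements of `E` separates the embeddings.
    refine eq_zero_of_sum_mul_emb (fun ν => (Z ν * matEmb ν y).trace) (fun e => ?_) ν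
    have h1 : (Algebra.TensorProduct.includeRight e : Loc p E) • y ∈
        (Submodule.span (Loc p E) s).restrictScalars ℚ_[p] :=
      (Submodule.span (Loc p E) s).smul_mem _ (Submodule.subset_span hy)
    have h2 := hZ ((Algebra.TensorProduct.includeRight e : Loc p E) • y)
    rw [show φ _ = 0 from hφW h1, map_zero] at h2
    rw [h2]
    refine Finset.sum_congr rfl fun ν _ => ?_
    rw [matEmb_smul, locEmb_includeRight, Matrix.mul_smul, Matrix.trace_smul, smul_eq_mul, mul_comm]
  have := hZ x
  simp only [h0, Matrix.zero_mul, Matrix.trace_zero, Finset.sum_const_zero, map_eq_zero] at this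
  exact hφx this

end MatrixEmb

end

/-! ### Rationality of traces of powers -/

section

open Filter Topology

section CharpolyPow

variable {F ι : Type*} [Field F] [IsAlgClosed F] [Fintype ι] [DecidableEq ι]

/-- The determinant of a polynomial in a matrix depends only on its characteristic polynomial. -/
theorem det_aeval_eq_of_charpoly_eq {A C : Matrix ι ι F} (h : A.charpoly = C.charpoly)
    (q : Polynomial F) : (Polynomial.aeval A q).det = (Polynomial.aeval C q).det := by
  -- Both sides are multiplicative in `q`, which reduces the claim to constants and linear
  -- polynomials.
  let ψ : Matrix ι ι F → Polynomial F →* F := fun A =>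
    Matrix.detMonoidHom.comp (Polynomial.aeval A : Polynomial F →ₐ[F] _).toMonoidHom
  change ψ A q = ψ C q
  have h1 : ∀ a : F, ψ A (Polynomial.C a) = ψ C (Polynomial.C a) := by
    intro a
    simp [ψ]
  have h2 : ∀ a : F, ψ A (Polynomial.X - Polynomial.C a) = ψ C (Polynomial.X - Polynomial.C a) := by
    intro a
    have h3 : ∀ B : Matrix ι ι F, ψ B (Polynomial.X - Polynomial.C a) =
        (-1) ^ Fintype.card ι * B.charpoly.eval a := by
      intro B
      rw [Matrix.eval_charpoly, ← Matrix.det_neg, neg_sub]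
      simp [ψ, Matrix.algebraMap_eq_diagonal, Matrix.scalar]
    rw [h3, h3, h]
  rw [(IsAlgClosed.splits q).eq_prod_roots, map_mul, map_mul, h1, map_multiset_prod,
    map_multiset_prod, Multiset.map_map, Multiset.map_map]
  congr 2
  exact Multiset.map_congr rfl fun a _ => h2 a

theorem charpoly_pow_eq_of_charpoly_eq {A C : Matrix ι ι F} (h : A.charpoly = C.charpoly) (j : ℕ) :
    (A ^ j).charpoly = (C ^ j).charpoly := by
  refine Polynomial.funext fun t => ?_
  rw [Matrix.eval_charpoly, Matrix.eval_charpoly]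
  have := det_aeval_eq_of_charpoly_eq h (Polynomial.C t - Polynomial.X ^ j)
  simpa [Matrix.algebraMap_eq_diagonal, Matrix.scalar] using this

theorem trace_pow_eq_of_charpoly_eq {A C : Matrix ι ι F} (h : A.charpoly = C.charpoly) (j : ℕ) :
    (A ^ j).trace = (C ^ j).trace := by
  cases isEmpty_or_nonempty ι
  · simp [Matrix.trace]
  · rw [Matrix.trace_eq_neg_charpoly_coeff, Matrix.trace_eq_neg_charpoly_coeff,
      charpoly_pow_eq_of_charpoly_eq h]

end CharpolyPow

/-- The matrix of multiplication by the root in `k[X]/(f)`. -/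
theorem exists_matrix_charpoly_eq {k : Type*} [Field k] {f : Polynomial k} (hf : f.Monic) {n : ℕ}
    (hn : f.natDegree = n) : ∃ C : Matrix (Fin n) (Fin n) k, C.charpoly = f := by
  subst hn
  let pb := AdjoinRoot.powerBasis hf.ne_zero
  have hd : pb.dim = f.natDegree := AdjoinRoot.powerBasis_dim hf.ne_zero
  refine ⟨Matrix.reindex (finCongr hd) (finCongr hd) (Algebra.leftMulMatrix pb.basis pb.gen), ?_⟩
  rw [Matrix.charpoly_reindex, charpoly_leftMulMatrix]
  rw [AdjoinRoot.powerBasis_gen, AdjoinRoot.minpoly_root hf.ne_zero, hf.leadingCoeff]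
  simp

section RationalTrace

variable {p : ℕ} [Fact p.Prime] {E : Type*} [Field E] [NumberField E] {n : ℕ}

/-- Under every embedding `A` has the same characteristic polynomial as a matrix `C` over `E`. The
traces of powers depend only on that polynomial, so those of `C` and `C⁻¹` serve as the required
elements of `E`. -/
theorem trace_pow_rational {A : GL (Fin n) (Loc p E)} {f : Polynomial E}
    (hf : A.val.charpoly = f.map (Algebra.TensorProduct.includeRight : E →ₐ[ℚ] Loc p E).toRingHom)
    (j : ℕ) :
    (∃ e : E, (A ^ j).val.trace = Algebra.TensorProduct.includeRight e) ∧
    ∃ e : E, (A ^ j)⁻¹.val.trace = Algebra.TensorProduct.includeRight e := by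
  set ι : E →+* Loc p E := (Algebra.TensorProduct.includeRight : E →ₐ[ℚ] Loc p E).toRingHom with hι
  have hinj : Function.Injective ι := ι.injective
  have hmon : f.Monic := by
    refine Polynomial.monic_of_injective hinj ?_
    rw [← hf]
    exact Matrix.charpoly_monic _
  have hdeg : f.natDegree = n := by
    rw [← Polynomial.natDegree_map_eq_of_injective hinj, ← hf, Matrix.charpoly_natDegree_eq_dim,
      Fintype.card_fin]
  obtain ⟨C, hC⟩ := exists_matrix_charpoly_eq hmon hdeg
  have hν : ∀ ν : E →ₐ[ℚ] PadicAlgCl p, ((locEmb p ν : Loc p E →+* PadicAlgCl p).comp ι) =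
      (ν : E →+* PadicAlgCl p) := by
    intro ν
    ext x
    exact locEmb_includeRight ν x
  have hch : ∀ ν : E →ₐ[ℚ] PadicAlgCl p, (matEmb ν A.val).charpoly = (C.map ν).charpoly := by
    intro ν
    have h1 := Matrix.charpoly_map A.val (locEmb p ν : Loc p E →+* PadicAlgCl p)
    rw [hf, Polynomial.map_map, hν, ← hC, ← Matrix.charpoly_map] at h1
    exact h1
  have hdet : ∀ ν : E →ₐ[ℚ] PadicAlgCl p, IsUnit (matEmb ν A.val) := fun ν =>
    A.isUnit.map (matEmb ν)
  have hdetC : IsUnit C := by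
    obtain ⟨ν⟩ : Nonempty (E →ₐ[ℚ] PadicAlgCl p) := ⟨IsAlgClosed.lift⟩
    rw [Matrix.isUnit_iff_isUnit_det, isUnit_iff_ne_zero]
    intro h0
    have h1 := (Matrix.isUnit_iff_isUnit_det _).1 (hdet ν)
    rw [Matrix.det_eq_sign_charpoly_coeff, hch, ← Matrix.det_eq_sign_charpoly_coeff] at h1
    have h2 : (C.map ν).det = ν C.det := (RingHom.map_det (ν : E →+* PadicAlgCl p) C).symm
    rw [h2, h0, map_zero] at h1
    exact not_isUnit_zero h1
  have hpow : ∀ (ν : E →ₐ[ℚ] PadicAlgCl p) (D : Matrix (Fin n) (Fin n) E) (i : ℕ),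
      (D.map ν) ^ i = (D ^ i).map ν := fun ν D i => (map_pow (ν.mapMatrix) D i).symm
  have htr : ∀ (ν : E →ₐ[ℚ] PadicAlgCl p) (D : Matrix (Fin n) (Fin n) E),
      (D.map ν).trace = ν D.trace := fun ν D => by simp [Matrix.trace]
  refine ⟨⟨(C ^ j).trace, locEmb_ext fun ν => ?_⟩, ⟨(C⁻¹ ^ j).trace, locEmb_ext fun ν => ?_⟩⟩
  · rw [locEmb_includeRight, ← trace_matEmb, Units.val_pow_eq_pow_val, map_pow,
      trace_pow_eq_of_charpoly_eq (hch ν), hpow, htr]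
  · have hAinv : matEmb ν (A⁻¹).val = (matEmb ν A.val)⁻¹ := by
      symm
      apply Matrix.inv_eq_right_inv
      rw [← map_mul, ← Units.val_mul, mul_inv_cancel, Units.val_one, map_one]
    have hCinv : (C⁻¹).map ν = (C.map ν)⁻¹ := by
      symm
      apply Matrix.inv_eq_right_inv
      have h1 := map_mul (ν.mapMatrix) C C⁻¹
      rw [Matrix.mul_nonsing_inv _ ((Matrix.isUnit_iff_isUnit_det _).1 hdetC), map_one] at h1
      exact h1.symm
    have hch' : (matEmb ν (A⁻¹).val).charpoly = ((C⁻¹).map ν).charpoly := by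
      have hu : IsUnit (C.map ν) := hdetC.map ν.mapMatrix
      rw [hAinv, hCinv, Matrix.charpoly_inv _ (hdet ν), Matrix.charpoly_inv _ hu]
      rw [← Matrix.reverse_charpoly, ← Matrix.reverse_charpoly, hch, Matrix.det_eq_sign_charpoly_coeff,
        hch, ← Matrix.det_eq_sign_charpoly_coeff]
    rw [locEmb_includeRight, ← trace_matEmb, ← inv_pow, Units.val_pow_eq_pow_val, map_pow,
      trace_pow_eq_of_charpoly_eq hch', hpow, htr]

end RationalTrace

end

/-! ### Representations over `E_p` with equal traces -/

section

open Filter Topology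

section SkolemNoether

variable {p : ℕ} [Fact p.Prime] {E : Type*} [Field E] [NumberField E] {n : ℕ}

theorem eq_zero_of_forall_trace_mul {A : Type*} [CommRing A] {Z : Matrix (Fin n) (Fin n) A}
    (h : ∀ Y, (Z * Y).trace = 0) : Z = 0 := by
  ext i j
  simpa [Matrix.trace_mul_single] using h (Matrix.single j i 1)

theorem exists_nat_forall_eval_ne_zero {Λ : Type*} [Fintype Λ] {k : Type*} [Field k] [CharZero k]
    (q : Λ → Polynomial k) (hq : ∀ l, q l ≠ 0) : ∃ t : ℕ, ∀ l, (q l).eval (t : k) ≠ 0 := by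
  by_contra! h
  have hprod : ∏ l, q l ≠ 0 := Finset.prod_ne_zero_iff.2 fun l _ => hq l
  refine hprod (Polynomial.eq_zero_of_infinite_isRoot _ ?_)
  refine (Set.infinite_range_of_injective (Nat.cast_injective (R := k))).mono ?_
  rintro _ ⟨t, rfl⟩
  obtain ⟨l, hl⟩ := h t
  change Polynomial.IsRoot _ _
  rw [Polynomial.IsRoot.def, Polynomial.eval_prod]
  exact Finset.prod_eq_zero (Finset.mem_univ l) hl

/-- Two families of matrix units in the matrix ring over `E_p` are conjugate. -/
theorem exists_conj_of_matrix_units (hn : 0 < n) (Y : Fin n → Fin n → LocMat p E n)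
    (hmul : ∀ a b c d, Y a b * Y c d = if b = c then Y a d else 0) (hone : ∑ a, Y a a = 1) :
    ∃ P : GL (Fin n) (Loc p E), ∀ a b, Y a b * P.val = P.val * Matrix.single a b 1 := by
  let o : Fin n := ⟨0, hn⟩
  have hne : ∀ ν : E →ₐ[ℚ] PadicAlgCl p, ∃ k j, locEmb p ν (Y o o k j) ≠ 0 := by
    intro ν
    by_contra! hcon
    have h0 : matEmb ν (Y o o) = 0 := by
      ext k j
      exact hcon k j
    have h1 : ∀ a, matEmb ν (Y a a) = 0 := by
      intro a
      have : Y a a = Y a o * Y o o * Y o a := by simp [hmul]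
      rw [this, map_mul, map_mul, h0]
      simp
    have h2 := congrArg (matEmb ν) hone
    rw [map_sum, map_one, Finset.sum_eq_zero fun a _ => h1 a] at h2
    have := congrFun (congrFun h2 o) o
    simp at this
  choose k j hkj using hne
  -- `E_p` is a product of fields, so a vector is needed that `Y o o` does not kill under any
  -- embedding. Among the vectors `(1, t, t², …)` the bad `t` are roots of finitely many non-zero
  -- polynomials.
  let q : (E →ₐ[ℚ] PadicAlgCl p) → Polynomial (PadicAlgCl p) := fun ν =>
    ∑ i : Fin n, Polynomial.C (locEmb p ν (Y o o (k ν) i)) * Polynomial.X ^ (i : ℕ)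
  have hq : ∀ ν, q ν ≠ 0 := by
    intro ν h
    have := congrArg (fun f => f.coeff (j ν : ℕ)) h
    simp only [q, Polynomial.finsetSum_coeff, Polynomial.coeff_C_mul_X_pow, Polynomial.coeff_zero]
      at this
    rw [Finset.sum_eq_single (j ν) (fun b _ hb => if_neg fun h => hb (Fin.ext h.symm)) (by simp),
      if_pos rfl] at this
    exact hkj ν this
  obtain ⟨t, ht⟩ := exists_nat_forall_eval_ne_zero q hq
  let c : Fin n → Loc p E := fun i => (t : Loc p E) ^ (i : ℕ)
  -- The columns `Y a o *ᵥ c` are permuted by the matrix units `Y a b` as standard basis vectors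
  -- would be.
  let P : LocMat p E n := Matrix.of fun i a => (Y a o *ᵥ c) i
  have hP : ∀ a b, Y a b * P = P * Matrix.single a b 1 := by
    intro a b
    ext i d
    have h1 : (Y a b * P) i d = (Y a b *ᵥ (Y d o *ᵥ c)) i := rfl
    rw [h1, Matrix.mulVec_mulVec, hmul]
    by_cases hbd : b = d
    · subst hbd
      simp [P]
    · rw [if_neg hbd, Matrix.zero_mulVec, Matrix.mul_single_apply_of_ne _ _ _ _ _ (Ne.symm hbd)]
      rfl
  have hdet : ∀ ν : E →ₐ[ℚ] PadicAlgCl p, locEmb p ν P.det ≠ 0 := by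
    intro ν h
    have hd : (matEmb ν P).det = 0 := by
      rw [← h]
      exact (AlgHom.map_det (locEmb p ν) P).symm
    obtain ⟨v, hv, hPv⟩ := Matrix.exists_mulVec_eq_zero_iff.2 hd
    obtain ⟨b, hb⟩ := Function.ne_iff.1 hv
    -- The kernel of `P` is stable under matrix units. A kernel vector with `v b ≠ 0` therefore puts
    -- a multiple of the `o`-th basis vector into the kernel, against the choice of `t`.
    have h1 : matEmb ν P *ᵥ (matEmb ν (Matrix.single o b 1) *ᵥ v) = 0 := by
      rw [Matrix.mulVec_mulVec, ← map_mul, ← hP, map_mul, ← Matrix.mulVec_mulVec, hPv,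
        Matrix.mulVec_zero]
    have h2 : matEmb ν (Matrix.single o b 1) *ᵥ v = Pi.single o (v b) := by
      have : matEmb ν (Matrix.single o b (1 : Loc p E)) = Matrix.single o b 1 := by
        change (Matrix.single o b (1 : Loc p E)).map (locEmb p ν) = _
        simp [Matrix.map_single]
      rw [this, Matrix.single_mulVec]
      simp [Pi.single]
    rw [h2] at h1
    have h3 := congrFun h1 (k ν)
    rw [Matrix.mulVec_single] at h3
    have h4 : matEmb ν P (k ν) o = (q ν).eval (t : PadicAlgCl p) := by
      rw [matEmb_apply]
      simp only [P, Matrix.of_apply, Matrix.mulVec, dotProduct, map_sum, map_mul, c, map_pow,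
        map_natCast, q, Polynomial.eval_finsetSum, Polynomial.eval_mul, Polynomial.eval_C,
        Polynomial.eval_pow, Polynomial.eval_X]
    have h5 : matEmb ν P (k ν) o * v b = 0 := by
      simpa [Matrix.col] using h3
    rw [h4] at h5
    exact (mul_ne_zero (ht ν) hb) h5
  have hunit : IsUnit P.det := isUnit_of_locEmb_ne_zero hdet
  refine ⟨Matrix.nonsingInvUnit P hunit, hP⟩

/-- Two representations over `E_p` with the same trace whose images span the matrix ring are
isomorphic. -/
theorem iso_of_trace_eq (hn : 0 < n) {G : Type*} [Group G] (ρ₁ ρ₂ : G →* GL (Fin n) (Loc p E))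
    (h₁ : Submodule.span (Loc p E) (Set.range fun g => (ρ₁ g).val) = ⊤)
    (h₂ : Submodule.span (Loc p E) (Set.range fun g => (ρ₂ g).val) = ⊤)
    (htr : ∀ g, (ρ₁ g).val.trace = (ρ₂ g).val.trace) : Iso ρ₁ ρ₂ := by
  let s : Set (LocMat p E n × LocMat p E n) := Set.range fun g => ((ρ₁ g).val, (ρ₂ g).val)
  -- The span of the pairs `(ρ₁ g, ρ₂ g)`. It turns out to be the graph of an algebra homomorphism
  -- between matrix rings, and the images of the matrix units then provide the conjugating matrix.
  let Γ : Submodule (Loc p E) (LocMat p E n × LocMat p E n) := Submodule.span (Loc p E) s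
  have hmul : ∀ z ∈ Γ, ∀ w ∈ Γ, z * w ∈ Γ := by
    intro z hz w hw
    have h1 := Submodule.mul_mem_mul hz hw
    rw [Submodule.span_mul_span] at h1
    refine Submodule.span_mono ?_ h1
    rintro _ ⟨_, ⟨g, rfl⟩, _, ⟨h, rfl⟩, rfl⟩
    exact ⟨g * h, by simp⟩
  have htrΓ : ∀ z ∈ Γ, z.1.trace = z.2.trace := by
    intro z hz
    induction hz using Submodule.span_induction with
    | mem z hz => obtain ⟨g, rfl⟩ := hz; exact htr g
    | zero => simp
    | add a b _ _ ha hb => simp [Matrix.trace_add, ha, hb]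
    | smul c a _ ha => simp [Matrix.trace_smul, ha]
  have hfst : ∀ x, ∃ y, (x, y) ∈ Γ := by
    intro x
    have h3 : x ∈ Γ.map (LinearMap.fst _ _ _) := by
      rw [Submodule.map_span, ← Set.range_comp]
      change x ∈ Submodule.span _ (Set.range fun g => (ρ₁ g).val)
      rw [h₁]; trivial
    obtain ⟨z, hz, rfl⟩ := h3
    exact ⟨z.2, hz⟩
  have hsnd : ∀ y, ∃ x, (x, y) ∈ Γ := by
    intro x
    have h3 : x ∈ Γ.map (LinearMap.snd _ _ _) := by
      rw [Submodule.map_span, ← Set.range_comp]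
      change x ∈ Submodule.span _ (Set.range fun g => (ρ₂ g).val)
      rw [h₂]; trivial
    obtain ⟨z, hz, rfl⟩ := h3
    exact ⟨z.1, hz⟩
  -- Traces agree on `Γ` and the trace form is non-degenerate, so a pair with first entry zero is
  -- zero.
  have hzero : ∀ y, ((0 : LocMat p E n), y) ∈ Γ → y = 0 := by
    intro y hy
    refine eq_zero_of_forall_trace_mul fun y' => ?_
    obtain ⟨x', hx'⟩ := hsnd y'
    have := htrΓ _ (hmul _ hy _ hx')
    simpa using this.symm
  have huniq : ∀ x y y', (x, y) ∈ Γ → (x, y') ∈ Γ → y = y' := by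
    intro x y y' hy hy'
    have := Γ.sub_mem hy hy'
    rw [Prod.mk_sub_mk, sub_self] at this
    exact sub_eq_zero.1 (hzero _ this)
  have hYex : ∀ a b : Fin n, ∃ y, ((Matrix.single a b 1 : LocMat p E n), y) ∈ Γ := fun a b => hfst _
  choose Y hY using hYex
  have hYmul : ∀ a b c d, Y a b * Y c d = if b = c then Y a d else 0 := by
    intro a b c d
    have h3 := hmul _ (hY a b) _ (hY c d)
    rw [Prod.mk_mul_mk] at h3
    by_cases hbc : b = c
    · subst hbc
      rw [Matrix.single_mul_single_same, one_mul] at h3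
      rw [if_pos rfl]
      exact huniq _ _ _ h3 (hY a d)
    · rw [Matrix.single_mul_single_of_ne _ _ _ _ hbc] at h3
      rw [if_neg hbc]
      exact hzero _ h3
  have hsum : ∀ x : LocMat p E n, (x, ∑ a, ∑ b, x a b • Y a b) ∈ Γ := by
    intro x
    have h3 : (∑ a, ∑ b, x a b • ((Matrix.single a b 1 : LocMat p E n), Y a b)) ∈ Γ :=
      Γ.sum_mem fun a _ => Γ.sum_mem fun b _ => Γ.smul_mem _ (hY a b)
    have h4 : (∑ a, ∑ b, x a b • ((Matrix.single a b 1 : LocMat p E n), Y a b)) =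
        (x, ∑ a, ∑ b, x a b • Y a b) := by
      ext1
      · simp only [Prod.fst_sum, Prod.smul_fst]
        conv_rhs => rw [Matrix.matrix_eq_sum_single x]
        simp [Matrix.smul_single]
      · simp [Prod.snd_sum]
    rwa [h4] at h3
  have hone : ∑ a, Y a a = 1 := by
    have h3 : ((1 : LocMat p E n), (1 : LocMat p E n)) ∈ Γ := Submodule.subset_span ⟨1, by simp⟩
    have h4 := hsum 1
    have h5 : ∑ a, ∑ b, (1 : LocMat p E n) a b • Y a b = ∑ a, Y a a := by
      simp [Matrix.one_apply]
    rw [h5] at h4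
    exact huniq _ _ _ h4 h3
  obtain ⟨P, hP⟩ := exists_conj_of_matrix_units hn Y hYmul hone
  refine ⟨P, fun g => ?_⟩
  rw [eq_mul_inv_iff_mul_eq]
  ext1
  have h6 : (ρ₂ g).val = ∑ a, ∑ b, (ρ₁ g).val a b • Y a b :=
    huniq _ _ _ (Submodule.subset_span ⟨g, rfl⟩) (hsum _)
  rw [Units.val_mul, Units.val_mul, h6, Finset.sum_mul]
  conv_rhs => rw [Matrix.matrix_eq_sum_single (ρ₁ g).val, Matrix.mul_sum]
  refine Finset.sum_congr rfl fun a _ => ?_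
  rw [Finset.sum_mul, Matrix.mul_sum]
  refine Finset.sum_congr rfl fun b _ => ?_
  rw [Matrix.smul_mul, hP, ← Matrix.mul_smul, Matrix.smul_single, smul_eq_mul, mul_one]

end SkolemNoether

end

/-! ### The Lie algebra of the image -/

section

open Filter Topology NormedSpace

section LocTopology

variable {p : ℕ} [Fact p.Prime] {E : Type*} [Field E] [NumberField E] {n : ℕ}

instance : IsTopologicalRing (Loc p E) := IsModuleTopology.isTopologicalRing ℚ_[p] (Loc p E)

theorem continuous_locEmb (ν : E →ₐ[ℚ] PadicAlgCl p) : Continuous (locEmb p ν) :=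
  IsModuleTopology.continuous_of_linearMap (R := ℚ_[p]) (locEmb p ν).toLinearMap

theorem continuous_locAut (σ : E ≃ₐ[ℚ] E) : Continuous (locAut p σ) :=
  IsModuleTopology.continuous_of_linearMap (R := ℚ_[p]) (locAut p σ).toLinearMap

instance : T2Space (Loc p E) :=
  T2Space.of_injective_continuous (f := fun r (ν : E →ₐ[ℚ] PadicAlgCl p) => locEmb p ν r)
    (fun _ _ h => locEmb_ext fun ν => congrFun h ν) (continuous_pi fun ν => continuous_locEmb ν)

instance : IsModuleTopology ℚ_[p] (LocMat p E n) :=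
  inferInstanceAs (IsModuleTopology ℚ_[p] (Fin n → Fin n → Loc p E))

theorem continuous_matEmb (ν : E →ₐ[ℚ] PadicAlgCl p) : Continuous (matEmb (n := n) ν) :=
  continuous_id.matrix_map (continuous_locEmb ν)

variable (p E n) in
theorem hasPadicExp_locMat : HasPadicExp p (LocMat p E n) := hasPadicExp _

theorem tendsto_exp_locMat : Tendsto (exp : LocMat p E n → LocMat p E n) (𝓝 0) (𝓝 1) :=
  (hasPadicExp_locMat p E n).map_exp_nhds_zero.le

theorem eventually_smul_mem {B : Type*} [AddCommGroup B] [Module ℚ_[p] B] [TopologicalSpace B]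
    [ContinuousSMul ℚ_[p] B] {S : Set B} (hS : S ∈ 𝓝 0) (x : B) :
    ∀ᶠ t : ℚ_[p] in 𝓝 0, t • x ∈ S := by
  have : Tendsto (fun t : ℚ_[p] => t • x) (𝓝 0) (𝓝 0) :=
    Continuous.tendsto' (by fun_prop) _ _ (by simp)
  exact this hS

end LocTopology

section LieOf

variable {p : ℕ} [Fact p.Prime] {E : Type*} [Field E] [NumberField E] {n : ℕ}
  {G : Type*} [Group G] [TopologicalSpace G]

/-- `W` is the Lie algebra of the image of `ρ`. -/
structure IsLieOf (ρ : G →* GL (Fin n) (Loc p E)) (W : Submodule ℚ_[p] (LocMat p E n)) : Prop where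
  eventually_iff : ∀ᶠ x in 𝓝 (0 : LocMat p E n), (∃ g, (ρ g).val = exp x) ↔ x ∈ W
  lie_mem : ∀ x ∈ W, ∀ y ∈ W, x * y - y * x ∈ W

theorem exists_isLieOf [CompactSpace G] {ρ : G →* GL (Fin n) (Loc p E)} (hρ : Continuous ρ) :
    ∃ W, IsLieOf ρ W := by
  have hc : IsClosed (Units.val '' (ρ.range : Set (GL (Fin n) (Loc p E)))) := by
    rw [MonoidHom.coe_range, ← Set.range_comp]
    exact (isCompact_range (Units.continuous_val.comp hρ)).isClosed
  obtain ⟨W, h1, h2⟩ := (hasPadicExp_locMat p E n).exists_lie_submodule ρ.range hc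
  refine ⟨W, ?_, h2⟩
  filter_upwards [h1] with x hx
  rw [← hx]
  simp

variable [IsTopologicalGroup G] [CompactSpace G]

/-- The complement of `O * ker ρ`, for an open `O ⊆ V` around 1, is compact, so its image is closed,
and it misses 1. -/
theorem exists_nhds_one_forall {ρ : G →* GL (Fin n) (Loc p E)} (hρ : Continuous ρ) {V : Set G}
    (hV : V ∈ 𝓝 1) : ∃ N ∈ 𝓝 (1 : LocMat p E n), ∀ g, (ρ g).val ∈ N → ∃ v ∈ V, ρ v = ρ g := by
  obtain ⟨O, hOV, hO, h1⟩ := mem_nhds_iff.1 hV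
  let C : Set G := (O * (ρ.ker : Set G))ᶜ
  have hC : IsClosed C := (hO.mul_right).isClosed_compl
  have hCc : IsClosed ((fun g => (ρ g).val) '' C) :=
    (hC.isCompact.image (Units.continuous_val.comp hρ)).isClosed
  refine ⟨((fun g => (ρ g).val) '' C)ᶜ, hCc.isOpen_compl.mem_nhds ?_, fun g hg => ?_⟩
  · rintro ⟨c, hc, hc1⟩
    refine hc ⟨1, h1, c, ?_, one_mul c⟩
    exact Units.ext hc1
  · have : g ∈ O * (ρ.ker : Set G) := by
      by_contra hcon
      exact hg ⟨g, hcon, rfl⟩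
    obtain ⟨o, ho, k, hk, rfl⟩ := this
    refine ⟨o, hOV ho, ?_⟩
    rw [map_mul, show ρ k = 1 from hk, mul_one]

namespace IsLieOf

variable {ρ : G →* GL (Fin n) (Loc p E)} {W : Submodule ℚ_[p] (LocMat p E n)}

theorem eventually_exists (h : IsLieOf ρ W) (hρ : Continuous ρ) {V : Set G} (hV : V ∈ 𝓝 1) :
    ∀ᶠ x in 𝓝 (0 : LocMat p E n), x ∈ W → ∃ g ∈ V, (ρ g).val = exp x := by
  obtain ⟨N, hN, hNV⟩ := exists_nhds_one_forall hρ hV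
  filter_upwards [h.eventually_iff, tendsto_exp_locMat hN] with x hx hxN hxW
  obtain ⟨g, hg⟩ := hx.2 hxW
  obtain ⟨v, hv, hvg⟩ := hNV g (by rw [hg]; exact hxN)
  exact ⟨v, hv, by rw [hvg, hg]⟩

theorem matEmb_mem_lieAlg (h : IsLieOf ρ W) (ν : E →ₐ[ℚ] PadicAlgCl p)
    {x : LocMat p E n} (hx : x ∈ W) : matEmb ν x ∈ lieAlg (repAt ρ ν).range := by
  obtain ⟨U, -, hU⟩ := (hasPadicExp_locMat p E n).exists_isExpNhd _ univ_mem
  have h1 := eventually_smul_mem (p := p) (inter_mem hU.mem_nhds h.eventually_iff) x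
  obtain ⟨r, hr, hball⟩ := Metric.eventually_nhds_iff.1 h1
  refine ⟨r, hr, fun t ht => ?_⟩
  obtain ⟨h2, h3⟩ := hball (y := t) (by simpa using ht)
  obtain ⟨g, hg⟩ := h3.2 (W.smul_mem t hx)
  refine ⟨repAt ρ ν g, ⟨g, rfl⟩, ?_⟩
  have h4 := hU.map_exp (matEmb (n := n) ν).toRingHom (continuous_matEmb ν) h2
  have h5 : (matEmb ν).toRingHom (t • x) = t • matEmb ν x := map_smul (matEmb ν) t x
  rw [h5] at h4
  rw [← h4, ← hg]
  rfl

/-- An element of the image at `ν` equal to `exp(tX)` need not come from a `g` close to 1. A power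
of `g` does lie close to 1, hence has a logarithm in `W`, and derivatives identify the latter with a
multiple of `X`. -/
theorem lieAlg_subset [TotallyDisconnectedSpace G] (h : IsLieOf ρ W) (hρ : Continuous ρ)
    (ν : E →ₐ[ℚ] PadicAlgCl p) : lieAlg (repAt ρ ν).range ⊆ matEmb ν '' (W : Set (LocMat p E n)) := by
  rintro X ⟨r, hr, hX⟩
  -- The exponential was studied on finite-dimensional algebras only; the entries of `X` generate a
  -- finite extension.
  let F : IntermediateField ℚ_[p] (PadicAlgCl p) :=
    IntermediateField.adjoin ℚ_[p] (Set.range fun ij : Fin n × Fin n => X ij.1 ij.2)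
  have : FiniteDimensional ℚ_[p] F := by
    refine IntermediateField.finiteDimensional_adjoin fun x _ => ?_
    exact Algebra.IsIntegral.isIntegral x
  let Y : Matrix (Fin n) (Fin n) F := Matrix.of fun i j =>
    ⟨X i j, IntermediateField.subset_adjoin _ _ ⟨(i, j), rfl⟩⟩
  let ι : Matrix (Fin n) (Fin n) F →+* Matrix (Fin n) (Fin n) (PadicAlgCl p) :=
    (F.val : F →+* PadicAlgCl p).mapMatrix
  have hιY : ι Y = X := by ext i j; rfl
  have hιs : ∀ (t : ℚ_[p]) (Z : Matrix (Fin n) (Fin n) F), ι (t • Z) = t • ι Z := by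
    intro t Z; ext i j; rfl
  have hι : Continuous ι := continuous_id.matrix_map continuous_subtype_val
  have hmt : IsModuleTopology ℚ_[p] (Matrix (Fin n) (Fin n) F) := by
    have : IsModuleTopology ℚ_[p] F := isModuleTopologyOfFiniteDimensional
    exact inferInstanceAs (IsModuleTopology ℚ_[p] (Fin n → Fin n → F))
  have hF : HasPadicExp p (Matrix (Fin n) (Fin n) F) := hasPadicExp _
  obtain ⟨U, -, hU⟩ := (hasPadicExp_locMat p E n).exists_isExpNhd _ univ_mem
  obtain ⟨U', -, hU'⟩ := hF.exists_isExpNhd _ univ_mem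
  have himg : exp '' (U ∩ {x | (∃ g, (ρ g).val = exp x) ↔ x ∈ W}) ∈ 𝓝 (1 : LocMat p E n) := by
    rw [← (hasPadicExp_locMat p E n).map_exp_nhds_zero]
    exact image_mem_map (inter_mem hU.mem_nhds h.eventually_iff)
  have hpre : (fun g => (ρ g).val) ⁻¹' (exp '' (U ∩ {x | (∃ g, (ρ g).val = exp x) ↔ x ∈ W})) ∈
      𝓝 (1 : G) := by
    refine (Units.continuous_val.comp hρ).continuousAt.preimage_mem_nhds ?_
    simpa using himg
  obtain ⟨O, hOsub, hO, hO1⟩ := mem_nhds_iff.1 hpre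
  -- The index of a small open normal subgroup is the exponent that brings `g` close to 1.
  obtain ⟨N, hN⟩ := ProfiniteGrp.exist_openNormalSubgroup_sub_open_nhds_of_one hO hO1
  have hfin : (N : Subgroup G).FiniteIndex := by
    have := (N : Subgroup G).quotient_finite_of_isOpen N.isOpen'
    exact Subgroup.finiteIndex_of_finite_quotient
  set J := (N : Subgroup G).index with hJ
  have hJ0 : J ≠ 0 := hfin.index_ne_zero
  have hevt := (eventually_smul_mem hU'.mem_nhds Y).and (Metric.ball_mem_nhds (0 : ℚ_[p]) hr)
  obtain ⟨t, ⟨htU, htr⟩, ht0⟩ := ((hevt.filter_mono nhdsWithin_le_nhds).and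
    (self_mem_nhdsWithin (s := {(0 : ℚ_[p])}ᶜ))).exists
  obtain ⟨_, ⟨g, rfl⟩, hg⟩ := hX t (by simpa using htr)
  obtain ⟨x, ⟨hxU, hxW⟩, hxg⟩ := hOsub (hN ((N : Subgroup G).pow_index_mem g))
  have hxW' : x ∈ W := hxW.1 ⟨_, hxg.symm⟩
  let y : Matrix (Fin n) (Fin n) F := (J : ℚ_[p]) • t • Y
  have hyU : y ∈ U' := hU'.smul_mem _ (by exact_mod_cast (PadicInt.norm_le_one (J : ℤ_[p]))) _ htU
  have hexp : matEmb ν (exp x) = ι (exp y) := by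
    have h1 : matEmb ν ((ρ (g ^ J)).val) = (matEmb ν (ρ g).val) ^ J := by
      rw [map_pow, Units.val_pow_eq_pow_val, map_pow]
    have h2 : matEmb ν (ρ g).val = ι (exp (t • Y)) := by
      rw [hU'.map_exp ι hι htU, hιs, hιY, ← hg]
      rfl
    rw [hxg]
    refine h1.trans ?_
    rw [h2, ← map_pow, ← hU'.exp_natCast_smul htU]
  have hpow : ∀ a : ℕ, matEmb ν (exp (((p ^ a : ℕ) : ℚ_[p]) • x)) =
      ι (exp (((p ^ a : ℕ) : ℚ_[p]) • y)) := by
    intro a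
    rw [hU.exp_natCast_smul hxU, hU'.exp_natCast_smul hyU, map_pow, map_pow, hexp]
  -- Equality of exponentials passes to `p ^ a`-th powers, and letting `a` grow extracts the
  -- derivatives at 0.
  have hpa : Tendsto (fun a : ℕ => ((p ^ a : ℕ) : ℚ_[p])) atTop (𝓝[≠] 0) := by
    rw [tendsto_nhdsWithin_iff]
    constructor
    · have : ‖(p : ℚ_[p])‖ < 1 := Padic.norm_p_lt_one
      simpa using tendsto_pow_atTop_nhds_zero_of_norm_lt_one this
    · refine Eventually.of_forall fun a => ?_
      have : (p ^ a : ℕ) ≠ 0 := pow_ne_zero _ (Fact.out : p.Prime).ne_zero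
      simpa using this
  have hlim1 := ((continuous_matEmb ν).tendsto x).comp
    (((hasPadicExp_locMat p E n).tendsto_slope x).comp hpa)
  have hlim2 := (hι.tendsto y).comp ((hF.tendsto_slope y).comp hpa)
  have heq : matEmb ν x = ι y := by
    refine tendsto_nhds_unique hlim1 (hlim2.congr fun a => ?_)
    simp only [Function.comp_apply]
    rw [hιs, map_sub, map_one, map_smul (matEmb ν), map_sub, map_one, hpow a]
  have hJt : (J : ℚ_[p]) * t ≠ 0 := mul_ne_zero (Nat.cast_ne_zero.2 hJ0) ht0
  refine ⟨((J : ℚ_[p]) * t)⁻¹ • x, W.smul_mem _ hxW', ?_⟩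
  rw [map_smul, heq]
  simp only [y]
  rw [smul_smul, hιs, hιY, smul_smul, inv_mul_cancel₀ hJt, one_smul]

theorem span_matEmb_eq [TotallyDisconnectedSpace G] (h : IsLieOf ρ W) (hρ : Continuous ρ)
    {ν : E →ₐ[ℚ] PadicAlgCl p}
    (hsl : Submodule.span (PadicAlgCl p) (lieAlg (repAt ρ ν).range) =
      LinearMap.ker (traceLinearMap (Fin n) (PadicAlgCl p) (PadicAlgCl p))) :
    Submodule.span (PadicAlgCl p) (matEmb ν '' (W : Set (LocMat p E n))) =
      LinearMap.ker (traceLinearMap (Fin n) (PadicAlgCl p) (PadicAlgCl p)) := by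
  rw [← hsl]
  refine le_antisymm (Submodule.span_mono ?_) (Submodule.span_mono (h.lieAlg_subset hρ ν))
  rintro _ ⟨x, hx, rfl⟩
  exact h.matEmb_mem_lieAlg ν hx

/-- Near the identity, the image of `ρ` is non-degenerate for the trace form. -/
theorem eq_zero_of_trace_mul_eq_zero (hn : 0 < n) (h : IsLieOf ρ W) (hρ : Continuous ρ)
    {ν : E →ₐ[ℚ] PadicAlgCl p}
    (hsl : Submodule.span (PadicAlgCl p) (matEmb ν '' (W : Set (LocMat p E n))) =
      LinearMap.ker (traceLinearMap (Fin n) (PadicAlgCl p) (PadicAlgCl p)))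
    {V : Set G} (hV : V ∈ 𝓝 1) {Z : Matrix (Fin n) (Fin n) (PadicAlgCl p)}
    (hZ : ∀ g ∈ V, (Z * matEmb ν (ρ g).val).trace = 0) : Z = 0 := by
  have hZ1 : Z.trace = 0 := by
    have := hZ 1 (mem_of_mem_nhds hV)
    simpa using this
  -- `Z` is orthogonal to 1 and to the image near 1, hence to difference quotients and to their
  -- limits.
  have hZW : ∀ x ∈ W, (Z * matEmb ν x).trace = 0 := by
    intro x hx
    have hlim : Tendsto (fun t : ℚ_[p] => (Z * matEmb ν (t⁻¹ • (exp (t • x) - 1))).trace) (𝓝[≠] 0)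
        (𝓝 (Z * matEmb ν x).trace) := by
      have hc : Continuous fun y : LocMat p E n => (Z * matEmb ν y).trace :=
        (continuous_const.mul (continuous_matEmb ν)).matrix_trace
      exact (hc.tendsto x).comp ((hasPadicExp_locMat p E n).tendsto_slope x)
    have hev : ∀ᶠ t : ℚ_[p] in 𝓝[≠] 0, (Z * matEmb ν (t⁻¹ • (exp (t • x) - 1))).trace = 0 := by
      have := eventually_smul_mem (p := p) (h.eventually_exists hρ hV) x
      filter_upwards [this.filter_mono nhdsWithin_le_nhds] with t ht
      obtain ⟨g, hg, hgt⟩ := ht (W.smul_mem t hx)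
      rw [map_smul, ← hgt, map_sub, map_one, Matrix.mul_smul, Matrix.trace_smul, mul_sub, mul_one,
        Matrix.trace_sub, hZ g hg, hZ1, sub_zero, smul_zero]
    exact tendsto_nhds_unique hlim (tendsto_const_nhds.congr' (hev.mono fun t ht => ht.symm))
  have hZsl : ∀ Y : Matrix (Fin n) (Fin n) (PadicAlgCl p), Y.trace = 0 → (Z * Y).trace = 0 := by
    intro Y hY
    have hY' : Y ∈ Submodule.span (PadicAlgCl p) (matEmb ν '' (W : Set (LocMat p E n))) := by
      rw [hsl]; exact hY
    induction hY' using Submodule.span_induction with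
    | mem y hy => obtain ⟨x, hx, rfl⟩ := hy; exact hZW x hx
    | zero => simp
    | add a b ha' hb' ha hb =>
      have key : ∀ a ∈ Submodule.span (PadicAlgCl p) (matEmb ν '' (W : Set (LocMat p E n))),
          a.trace = 0 := fun a ha => by rw [hsl] at ha; exact ha
      rw [mul_add, Matrix.trace_add, ha (key a ha'), hb (key b hb'), add_zero]
    | smul c a ha' ha =>
      have : a.trace = 0 := by rw [hsl] at ha'; exact ha'
      rw [Matrix.mul_smul, Matrix.trace_smul, ha this, smul_zero]
  refine eq_zero_of_forall_trace_mul fun Y => ?_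
  have hn' : (n : PadicAlgCl p) ≠ 0 := Nat.cast_ne_zero.2 hn.ne'
  have hdec : Y = (Y - (Y.trace / n) • (1 : Matrix (Fin n) (Fin n) (PadicAlgCl p))) +
      (Y.trace / n) • (1 : Matrix (Fin n) (Fin n) (PadicAlgCl p)) := by abel
  rw [hdec, mul_add, Matrix.trace_add, hZsl, Matrix.mul_smul, Matrix.trace_smul, mul_one, hZ1,
    smul_zero, add_zero]
  rw [Matrix.trace_sub, Matrix.trace_smul, Matrix.trace_one, Fintype.card_fin, smul_eq_mul,
    div_mul_cancel₀ _ hn', sub_self]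

end IsLieOf

end LieOf

end

/-! ### Approximation by rational traces, and Schur's lemma -/

section

open Filter Topology NormedSpace

section RationalTraces

variable {p : ℕ} [Fact p.Prime] {E : Type*} [Field E] [NumberField E] {n : ℕ}

/-- Near the identity, the image of `ρ` is approximated by elements whose trace and inverse trace
lie in `E`. -/
def HasRationalTraces {G : Type*} [Group G] (ρ : G →* GL (Fin n) (Loc p E)) : Prop :=
  ∃ O ∈ 𝓝 (1 : LocMat p E n), ∀ u, (ρ u).val ∈ O → ∀ V ∈ 𝓝 (ρ u), ∃ h, ρ h ∈ V ∧
    (∃ e : E, (ρ h).val.trace = Algebra.TensorProduct.includeRight e) ∧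
    ∃ e : E, (ρ h)⁻¹.val.trace = Algebra.TensorProduct.includeRight e

theorem exists_coprime_multiple {p r : ℕ} (hp : p.Prime) (hr : ¬ p ∣ r) (B : ℕ) :
    ∃ c : ℕ, r ∣ c ∧ ((p ^ B : ℕ) : ℤ) ∣ (c : ℤ) - 1 := by
  have hcop : Nat.Coprime (p ^ B) r := ((Nat.Prime.coprime_iff_not_dvd hp).2 hr).pow_left B
  obtain ⟨c, hc1, hc2⟩ := Nat.chineseRemainder hcop 1 0
  refine ⟨c, (Nat.modEq_zero_iff_dvd).1 hc2, ?_⟩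
  have := (Nat.modEq_iff_dvd).1 hc1.symm
  simpa using this

/-- An element with small logarithm lies on a `ℤ_p`-parameter subgroup. Hence it can be replaced by
a nearby power of `p`-power order modulo an open subgroup, and then by a power of a Frobenius
element. -/
theorem hasRationalTraces {k Ω : Type*} [Field k] [NumberField k] [Field Ω] [Algebra k Ω]
    [IsAlgClosure k Ω] {ρ : Gal(Ω/k) →* GL (Fin n) (Loc p E)} (hρ : Continuous ρ)
    (hv : IsValid ρ) : HasRationalTraces ρ := by
  have hp : p.Prime := Fact.out
  have hgal := isGalois_of_isAlgClosure k Ω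
  obtain ⟨S, hS, -, -, hrat⟩ := hv.unramified_rational
  obtain ⟨U, -, hU⟩ := (hasPadicExp_locMat p E n).exists_isExpNhd _ univ_mem
  refine ⟨exp '' U, ?_, ?_⟩
  · rw [← (hasPadicExp_locMat p E n).map_exp_nhds_zero]
    exact image_mem_map hU.mem_nhds
  rintro u ⟨x, hx, hxu⟩ V hV
  have hmul : Tendsto (fun y : GL (Fin n) (Loc p E) × GL (Fin n) (Loc p E) => y.1 * y.2)
      (𝓝 (ρ u) ×ˢ 𝓝 1) (𝓝 (ρ u)) := by
    rw [← nhds_prod_eq]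
    exact Continuous.tendsto' continuous_mul _ _ (by simp)
  obtain ⟨V', hV', O, hO, hVO⟩ := mem_prod_iff.1 (hmul hV)
  -- The powers of `ρ u` interpolated to `p`-adic exponents.
  let e : ℤ_[p] → GL (Fin n) (Loc p E) := fun t =>
    ⟨exp ((t : ℚ_[p]) • x), exp (-((t : ℚ_[p]) • x)),
      hU.exp_mul_exp_neg (hU.smul_mem _ (PadicInt.norm_le_one t) x hx),
      hU.exp_neg_mul_exp (hU.smul_mem _ (PadicInt.norm_le_one t) x hx)⟩
  have he : Continuous e := by
    rw [Units.continuous_iff]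
    refine ⟨hU.continuous_exp_smul hx, ?_⟩
    have := hU.continuous_exp_smul (hU.neg_mem hx)
    simp only [smul_neg] at this
    exact this
  have he1 : e 1 = ρ u := by
    ext1
    rw [← hxu]
    simp [e]
  have hec : ∀ c : ℕ, e c = ρ (u ^ c) := by
    intro c
    ext1
    rw [map_pow, Units.val_pow_eq_pow_val, ← hxu, ← hU.exp_natCast_smul hx]
    simp [e]
  have hpre : e ⁻¹' V' ∈ 𝓝 (1 : ℤ_[p]) := he.continuousAt.preimage_mem_nhds (by rwa [he1])
  obtain ⟨ε, hε, hball⟩ := Metric.mem_nhds_iff.1 hpre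
  obtain ⟨B, hB⟩ := PadicInt.exists_pow_neg_lt p hε
  obtain ⟨N, -, hfd, hnorm, hN⟩ := exists_isFrobeniusAt_pow (k := k) (Ω := Ω) hp hS
    (ρ ⁻¹' O) (hρ.continuousAt.preimage_mem_nhds (by rwa [map_one]))
  have hNn : N.fixingSubgroup.Normal := by
    rw [← IntermediateField.restrictNormalHom_ker]; infer_instance
  have hfin : N.fixingSubgroup.FiniteIndex := by
    have := N.fixingSubgroup.quotient_finite_of_isOpen N.fixingSubgroup_isOpen
    exact Subgroup.finiteIndex_of_finite_quotient
  -- The index is `p ^ b * r` with `r` prime to `p`. An exponent `c` divisible by `r` removes the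
  -- prime-to-`p` part, while `c ≡ 1` modulo `p ^ B` keeps `ρ (u ^ c)` near `ρ u`.
  obtain ⟨b, r, hr, hd⟩ := Nat.exists_eq_pow_mul_and_not_dvd hfin.index_ne_zero p hp.ne_one
  obtain ⟨c, hrc, hcB⟩ := exists_coprime_multiple hp hr B
  have hcV : ρ (u ^ c) ∈ V' := by
    rw [← hec]
    refine hball ?_
    rw [mem_ball_iff_norm]
    refine lt_of_le_of_lt ?_ hB
    have h1 := (PadicInt.norm_int_le_pow_iff_dvd (p := p) (k := (c : ℤ) - 1) (n := B)).2
      (by exact_mod_cast hcB)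
    simpa using h1
  obtain ⟨v, hvS, w, hw, φ, hφ, j, hj⟩ := hN b (u ^ c) (by
    obtain ⟨s, rfl⟩ := hrc
    rw [← pow_mul, show r * s * p ^ b = (p ^ b * r) * s by ring, ← hd, pow_mul]
    exact pow_mem (N.fixingSubgroup.pow_index_mem u) s)
  obtain ⟨f, hf⟩ := hrat v hvS w hw φ hφ
  have htr := trace_pow_rational hf j
  refine ⟨φ ^ j, ?_, by simpa only [map_pow] using htr.1, by simpa only [map_pow] using htr.2⟩
  have h2 : (ρ (u ^ c), ρ ((u ^ c)⁻¹ * φ ^ j)) ∈ V' ×ˢ O := ⟨hcV, hj⟩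
  have h3 := hVO h2
  simpa using h3

end RationalTraces

section Schur

variable {p : ℕ} [Fact p.Prime] {E : Type*} [Field E] [NumberField E] {n : ℕ}
  {G : Type*} [Group G] [TopologicalSpace G] [IsTopologicalGroup G]

theorem exists_scalar_of_commute {A : Type*} [CommRing A] {s : Set (Matrix (Fin n) (Fin n) A)}
    (hs : Submodule.span A s = ⊤) {c : Matrix (Fin n) (Fin n) A} (hc : ∀ x ∈ s, Commute c x) :
    ∃ a : A, c = Matrix.scalar (Fin n) a := by
  have hall : ∀ x, Commute c x := by
    intro x
    have hx : x ∈ Submodule.span A s := hs ▸ trivial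
    induction hx using Submodule.span_induction with
    | mem x hx => exact hc x hx
    | zero => exact Commute.zero_right c
    | add a b _ _ ha hb => exact ha.add_right hb
    | smul r a _ ha => exact ha.smul_right r
  obtain ⟨a, ha⟩ := Matrix.mem_range_scalar_of_commute_single (M := c) fun i j _ => (hall _).symm
  exact ⟨a, ha.symm⟩

/-- Two representations that are conjugate on an open normal subgroup, on which they are
absolutely irreducible, are twists of each other. -/
theorem exists_iso_twist (hn : 0 < n) {ρ₁ ρ₂ : G →* GL (Fin n) (Loc p E)} (N : Subgroup G)
    [hN : N.Normal] (hNo : IsOpen (N : Set G))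
    (hspan : Submodule.span (Loc p E) (Set.range fun u : N => (ρ₁ u).val) = ⊤)
    (hiso : Iso (ρ₁.comp N.subtype) (ρ₂.comp N.subtype)) :
    ∃ χ : G →* (Loc p E)ˣ, Continuous χ ∧ Iso (twist ρ₁ χ) ρ₂ := by
  obtain ⟨P, hP⟩ := hiso
  let A : G →* GL (Fin n) (Loc p E) := (MulAut.conj P⁻¹).toMonoidHom.comp ρ₂
  have hA : ∀ g, A g = P⁻¹ * ρ₂ g * P := fun g => by simp [A]
  have hAu : ∀ u ∈ N, A u = ρ₁ u := by
    intro u hu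
    rw [hA, show ρ₂ u = P * ρ₁ u * P⁻¹ from hP ⟨u, hu⟩]
    group
  have hex : ∀ g, ∃ a : (Loc p E)ˣ, A g = GeneralLinearGroup.scalar (Fin n) a * ρ₁ g := by
    intro g
    -- As `N` is normal and both representations agree on it, this quotient commutes with the image
    -- of `N`, which spans the matrix ring.
    let c : GL (Fin n) (Loc p E) := A g * (ρ₁ g)⁻¹
    have hcomm : ∀ u ∈ N, c * ρ₁ u = ρ₁ u * c := by
      intro u hu
      have h1 : g⁻¹ * u * g ∈ N := by simpa using hN.conj_mem u hu g⁻¹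
      have h2 := hAu _ h1
      have h3 := hAu _ hu
      simp only [map_mul, map_inv] at h2
      simp only [c]
      calc A g * (ρ₁ g)⁻¹ * ρ₁ u = A g * ((ρ₁ g)⁻¹ * ρ₁ u * ρ₁ g) * (ρ₁ g)⁻¹ := by group
        _ = ρ₁ u * (A g * (ρ₁ g)⁻¹) := by rw [← h2, ← h3]; group
    have hs : ∀ d : GL (Fin n) (Loc p E), (∀ u ∈ N, d * ρ₁ u = ρ₁ u * d) →
        ∃ a, d.val = Matrix.scalar (Fin n) a := by
      intro d hd
      refine exists_scalar_of_commute hspan ?_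
      rintro _ ⟨u, rfl⟩
      exact congrArg Units.val (hd u u.2)
    obtain ⟨a, ha⟩ := hs c hcomm
    -- `E_p` is not a field in general; the inverse scalar is obtained from `c⁻¹`.
    obtain ⟨b, hb⟩ := hs c⁻¹ fun u hu => by
      rw [inv_mul_eq_iff_eq_mul, ← mul_assoc, hcomm u hu, mul_inv_cancel_right]
    have hab : a * b = 1 := by
      have h4 := congrArg Units.val (mul_inv_cancel c)
      rw [Units.val_mul, ha, hb, ← map_mul, Units.val_one, ← map_one (Matrix.scalar (Fin n))] at h4
      have : Nonempty (Fin n) := ⟨⟨0, hn⟩⟩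
      exact Matrix.scalar_inj.1 h4
    refine ⟨⟨a, b, hab, by rw [mul_comm, hab]⟩, ?_⟩
    rw [← mul_inv_eq_iff_eq_mul]
    exact Units.ext ha
  choose χ hχ using hex
  have hinj : ∀ (a b : (Loc p E)ˣ) (y : GL (Fin n) (Loc p E)),
      GeneralLinearGroup.scalar (Fin n) a * y = GeneralLinearGroup.scalar (Fin n) b * y → a = b := by
    intro a b y h
    have h1 := congrArg Units.val (mul_right_cancel h)
    have : Nonempty (Fin n) := ⟨⟨0, hn⟩⟩
    exact Units.ext (Matrix.scalar_inj.1 h1)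
  let χ' : G →* (Loc p E)ˣ :=
    { toFun := χ
      map_one' := hinj _ _ (ρ₁ 1) (by rw [← hχ]; simp)
      map_mul' := fun g h => hinj _ _ (ρ₁ (g * h)) (by
        rw [← hχ, map_mul, hχ, hχ, map_mul, map_mul, mul_assoc, ← mul_assoc (ρ₁ g),
          ← GeneralLinearGroup.scalar_commute (χ h) (ρ₁ g)]
        group) }
  refine ⟨χ', ?_, P, fun g => ?_⟩
  -- The character is trivial on the open subgroup `N`.
  · refine continuous_of_continuousAt_one χ' ?_
    refine (continuousAt_const (y := (1 : (Loc p E)ˣ))).congr ?_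
    filter_upwards [hNo.mem_nhds N.one_mem] with u hu
    refine hinj _ _ (ρ₁ u) ?_
    change _ = GeneralLinearGroup.scalar (Fin n) (χ u) * ρ₁ u
    rw [← hχ, hAu u hu]
    simp
  · change ρ₂ g = P * (GeneralLinearGroup.scalar (Fin n) (χ g) * ρ₁ g) * P⁻¹
    rw [← hχ, hA]
    group

end Schur

end

/-! ### Linked components come from extra-twists -/

section

open Filter Topology NormedSpace

/-- Conjugation by an invertible matrix, as a ring homomorphism. -/
def conjRingHom {A : Type*} [CommRing A] {n : ℕ} (P : GL (Fin n) A) :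
    Matrix (Fin n) (Fin n) A →+* Matrix (Fin n) (Fin n) A where
  toFun X := P.val * X * (P⁻¹).val
  map_one' := by simp
  map_mul' X Y := by
    rw [show P.val * (X * Y) * (P⁻¹).val = P.val * X * (1 : Matrix (Fin n) (Fin n) A) * Y * (P⁻¹).val
      by simp [mul_assoc], ← Units.val_one, ← inv_mul_cancel P, Units.val_mul]
    simp only [mul_assoc]
  map_zero' := by simp
  map_add' X Y := by simp [mul_add, add_mul]

section ConjRelated

variable {p : ℕ} [Fact p.Prime] {E : Type*} [Field E] [NumberField E] {n : ℕ}

theorem exists_eq_comp [IsGalois ℚ E] (l m : E →ₐ[ℚ] PadicAlgCl p) :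
    ∃ σ : E ≃ₐ[ℚ] E, l = m.comp σ.toAlgHom := by
  let : Algebra E (PadicAlgCl p) := m.toRingHom.toAlgebra
  have : IsScalarTower ℚ E (PadicAlgCl p) := IsScalarTower.of_algebraMap_eq fun x => by
    simp
  let τ : E →ₐ[ℚ] E := l.restrictNormal E
  refine ⟨AlgEquiv.ofBijective τ (Algebra.IsAlgebraic.algHom_bijective τ), ?_⟩
  ext x
  exact (l.restrictNormal_commutes E x).symm

variable {G : Type*} [Group G]

/-- Exponentiating the linear relation between two components turns a conjugation into a conjugation
and a negative transpose into an inverse transpose. -/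
theorem IsLieOf.trace_relation [TopologicalSpace G] {ρ : G →* GL (Fin n) (Loc p E)}
    {W : Submodule ℚ_[p] (LocMat p E n)} (h : IsLieOf ρ W) {l m : E →ₐ[ℚ] PadicAlgCl p}
    (hlm : ConjRelated (Submodule.span (PadicAlgCl p) (matEmbAll '' (W : Set (LocMat p E n)))) l m) :
    ∃ O ∈ 𝓝 (1 : LocMat p E n),
      (∀ u, (ρ u).val ∈ O → locEmb p l (ρ u).val.trace = locEmb p m (ρ u).val.trace) ∨
      ∀ u, (ρ u).val ∈ O → locEmb p l (ρ u).val.trace = locEmb p m (ρ u)⁻¹.val.trace := by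
  obtain ⟨U, -, hU⟩ := (hasPadicExp_locMat p E n).exists_isExpNhd _ univ_mem
  refine ⟨exp '' (U ∩ {x | (∃ g, (ρ g).val = exp x) ↔ x ∈ W}), ?_, ?_⟩
  · rw [← (hasPadicExp_locMat p E n).map_exp_nhds_zero]
    exact image_mem_map (inter_mem hU.mem_nhds h.eventually_iff)
  have hmem : ∀ x ∈ W, matEmbAll x ∈
      Submodule.span (PadicAlgCl p) (matEmbAll '' (W : Set (LocMat p E n))) :=
    fun x hx => Submodule.subset_span ⟨x, hx, rfl⟩
  obtain ⟨P, hP | hP⟩ := hlm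
  · left
    rintro u ⟨x, ⟨hxU, hxW⟩, hxu⟩
    have hx : x ∈ W := hxW.1 ⟨u, hxu.symm⟩
    have h1 : matEmb l x = conjRingHom P (matEmb m x) := hP _ (hmem x hx)
    have hc : Continuous ((conjRingHom P).comp (matEmb (n := n) m).toRingHom) :=
      (continuous_const.mul (continuous_matEmb m)).mul continuous_const
    have h2 := hU.map_exp (matEmb (n := n) l).toRingHom (continuous_matEmb l) hxU
    have h3 := hU.map_exp ((conjRingHom P).comp (matEmb (n := n) m).toRingHom) hc hxU
    have h4 : matEmb l (exp x) = conjRingHom P (matEmb m (exp x)) :=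
      h2.trans ((congrArg exp h1).trans h3.symm)
    rw [← hxu, ← trace_matEmb, ← trace_matEmb, h4]
    exact Matrix.trace_units_conj P _
  · right
    rintro u ⟨x, ⟨hxU, hxW⟩, hxu⟩
    have hx : x ∈ W := hxW.1 ⟨u, hxu.symm⟩
    -- The relation is rewritten as the transpose of a ring homomorphism at `-x`, so that the
    -- exponential commutes with it.
    have h1 : matEmb l x = (conjRingHom (invTranspose P) (matEmb m (-x)))ᵀ := by
      refine (hP _ (hmem x hx)).trans ?_
      rw [map_neg]
      simp [conjRingHom, invTranspose, matEmbAll_apply, Matrix.transpose_mul, mul_assoc]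
    have hc : Continuous ((conjRingHom (invTranspose P)).comp (matEmb (n := n) m).toRingHom) :=
      (continuous_const.mul (continuous_matEmb m)).mul continuous_const
    have h2 := hU.map_exp (matEmb (n := n) l).toRingHom (continuous_matEmb l) hxU
    have h3 := hU.map_exp ((conjRingHom (invTranspose P)).comp (matEmb (n := n) m).toRingHom) hc
      (hU.neg_mem hxU)
    have h4 : matEmb l (exp x) = (conjRingHom (invTranspose P) (matEmb m (exp (-x))))ᵀ := by
      refine h2.trans ((congrArg exp h1).trans ?_)
      rw [Matrix.exp_transpose]
      exact congrArg transpose h3.symm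
    have h5 : (ρ u)⁻¹.val = exp (-x) :=
      Units.inv_eq_of_mul_eq_one_right (by rw [← hxu]; exact hU.exp_mul_exp_neg hxU)
    rw [h5, ← hxu, ← trace_matEmb, ← trace_matEmb, h4, Matrix.trace_transpose]
    exact Matrix.trace_units_conj _ _

/-- An embedding is injective on `E` though not on `E_p`, so the relation can be lifted at elements
whose traces lie in `E`. These accumulate at every point of the image near 1, and the lifted
relation is closed. -/
theorem locAut_trace_eq {ρ : G →* GL (Fin n) (Loc p E)} (hrat : HasRationalTraces ρ)
    (m : E →ₐ[ℚ] PadicAlgCl p) (σ : E ≃ₐ[ℚ] E)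
    {s : GL (Fin n) (Loc p E) → GL (Fin n) (Loc p E)} (hs : Continuous s)
    (hsr : ∀ y : GL (Fin n) (Loc p E),
      (∃ e : E, y.val.trace = Algebra.TensorProduct.includeRight e) →
      (∃ e : E, y⁻¹.val.trace = Algebra.TensorProduct.includeRight e) →
      ∃ e : E, (s y).val.trace = Algebra.TensorProduct.includeRight e)
    {O : Set (LocMat p E n)} (hO : O ∈ 𝓝 1)
    (h : ∀ u, (ρ u).val ∈ O →
      locEmb p (m.comp σ.toAlgHom) (ρ u).val.trace = locEmb p m (s (ρ u)).val.trace) :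
    ∃ O' ∈ 𝓝 (1 : LocMat p E n), ∀ u, (ρ u).val ∈ O' →
      locAut p σ (ρ u).val.trace = (s (ρ u)).val.trace := by
  obtain ⟨O₀, hO₀, hD⟩ := hrat
  refine ⟨interior O ∩ O₀, inter_mem (interior_mem_nhds.2 hO) hO₀, fun u hu => ?_⟩
  have hcl : IsClosed {y : GL (Fin n) (Loc p E) | locAut p σ y.val.trace = (s y).val.trace} :=
    isClosed_eq ((continuous_locAut σ).comp Units.continuous_val.matrix_trace)
      (Units.continuous_val.comp hs).matrix_trace
  refine hcl.closure_subset (mem_closure_iff_nhds.2 fun V hV => ?_)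
  have hV' : V ∩ Units.val ⁻¹' interior O ∈ 𝓝 (ρ u) :=
    inter_mem hV ((isOpen_interior.preimage Units.continuous_val).mem_nhds hu.1)
  obtain ⟨g, hg, hg1, hg2⟩ := hD u hu.2 _ hV'
  refine ⟨ρ g, hg.1, ?_⟩
  obtain ⟨e', he'⟩ := hsr _ hg1 hg2
  obtain ⟨e, he⟩ := hg1
  have h1 := h g (interior_subset hg.2)
  rw [he, he', locEmb_includeRight, locEmb_includeRight] at h1
  change locAut p σ (ρ g).val.trace = (s (ρ g)).val.trace
  have h2 : σ e = e' := m.toRingHom.injective h1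
  rw [he, he', ← h2]
  simp [locAut]

theorem matEmb_conjRep (ν : E →ₐ[ℚ] PadicAlgCl p) (σ : E ≃ₐ[ℚ] E)
    (ρ : G →* GL (Fin n) (Loc p E)) (g : G) :
    matEmb ν (conjRep σ ρ g).val = matEmb (ν.comp σ.toAlgHom) (ρ g).val := by
  ext i j
  exact locEmb_locAut ν σ _

theorem trace_conjRep (σ : E ≃ₐ[ℚ] E) (ρ : G →* GL (Fin n) (Loc p E)) (g : G) :
    (conjRep σ ρ g).val.trace = locAut p σ (ρ g).val.trace := by
  rw [Matrix.trace, Matrix.trace, map_sum]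
  rfl

theorem trace_dual (ρ : G →* GL (Fin n) (Loc p E)) (g : G) :
    (dual ρ g).val.trace = (ρ g)⁻¹.val.trace := Matrix.trace_transpose _

/-- Non-degeneracy of the trace form on the image of every neighbourhood of the identity, under all
embeddings. -/
def IsNondegenerate [TopologicalSpace G] (ρ : G →* GL (Fin n) (Loc p E)) : Prop :=
  ∀ (ν : E →ₐ[ℚ] PadicAlgCl p), ∀ V ∈ 𝓝 (1 : G), ∀ Z : Matrix (Fin n) (Fin n) (PadicAlgCl p),
    (∀ g ∈ V, (Z * matEmb ν (ρ g).val).trace = 0) → Z = 0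

theorem IsNondegenerate.conjRep [TopologicalSpace G] {ρ : G →* GL (Fin n) (Loc p E)}
    (h : IsNondegenerate ρ) (σ : E ≃ₐ[ℚ] E) : IsNondegenerate (conjRep σ ρ) := by
  intro ν V hV Z hZ
  simp only [matEmb_conjRep] at hZ
  exact h _ V hV Z hZ

variable [TopologicalSpace G] [IsTopologicalGroup G]

theorem IsNondegenerate.dual {ρ : G →* GL (Fin n) (Loc p E)} (h : IsNondegenerate ρ) :
    IsNondegenerate (dual ρ) := by
  intro ν V hV Z hZ
  rw [← Matrix.transpose_eq_zero]
  refine h ν V⁻¹ (inv_mem_nhds_one G hV) _ fun g hg => ?_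
  have h1 := hZ g⁻¹ hg
  have h2 : matEmb ν (BigImage.dual ρ g⁻¹).val = (matEmb ν (ρ g).val)ᵀ := by
    have : (BigImage.dual ρ g⁻¹).val = (ρ g).valᵀ := by
      change (((ρ g⁻¹)⁻¹).val)ᵀ = _
      rw [map_inv, inv_inv]
    rw [this]
    rfl
  rw [h2] at h1
  rw [← Matrix.trace_transpose, Matrix.transpose_mul, Matrix.transpose_transpose,
    Matrix.trace_mul_comm]
  exact h1

theorem IsNondegenerate.span_eq_top {ρ : G →* GL (Fin n) (Loc p E)} (h : IsNondegenerate ρ)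
    (N : Subgroup G) (hN : IsOpen (N : Set G)) :
    Submodule.span (Loc p E) (Set.range fun u : N => (ρ u).val) = ⊤ := by
  refine span_eq_top_of_nondegenerate fun ν Z hZ => ?_
  exact h ν N (hN.mem_nhds N.one_mem) Z fun g hg => hZ _ ⟨⟨g, hg⟩, rfl⟩

variable [CompactSpace G] [TotallyDisconnectedSpace G]

/-- Equal traces on an open normal subgroup give an isomorphism there, which Schur's lemma extends
up to a character. -/
theorem exists_iso_twist_of_trace (hn : 0 < n) {ρ ρ₂ : G →* GL (Fin n) (Loc p E)}
    (hρ : Continuous ρ) (hnd : IsNondegenerate ρ) (hnd₂ : IsNondegenerate ρ₂) (σ : E ≃ₐ[ℚ] E)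
    {O : Set (LocMat p E n)} (hO : O ∈ 𝓝 1)
    (h : ∀ u, (ρ u).val ∈ O → locAut p σ (ρ u).val.trace = (ρ₂ u).val.trace) :
    ∃ χ : G →* (Loc p E)ˣ, Continuous χ ∧ Iso (twist ρ₂ χ) (conjRep σ ρ) := by
  have hpre : (fun g => (ρ g).val) ⁻¹' O ∈ 𝓝 (1 : G) :=
    (Units.continuous_val.comp hρ).continuousAt.preimage_mem_nhds (by simpa using hO)
  obtain ⟨O', hOsub, hO', hO1⟩ := mem_nhds_iff.1 hpre
  obtain ⟨N, hN⟩ := ProfiniteGrp.exist_openNormalSubgroup_sub_open_nhds_of_one hO' hO1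
  have hNo : IsOpen ((N : Subgroup G) : Set G) := N.isOpen'
  have hNn : (N : Subgroup G).Normal := N.isNormal'
  refine exists_iso_twist hn (N : Subgroup G) hNo (hnd₂.span_eq_top _ hNo) ?_
  refine iso_of_trace_eq hn _ _ (hnd₂.span_eq_top _ hNo) ((hnd.conjRep σ).span_eq_top _ hNo) ?_
  intro u
  have := h u (hOsub (hN u.2))
  exact this.symm.trans (trace_conjRep σ ρ u).symm

/-- Embeddings whose components in the Lie algebra are related differ by an extra-twist. -/
theorem exists_extraTwist_of_conjRelated [IsGalois ℚ E] (hn : 0 < n)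
    {ρ : G →* GL (Fin n) (Loc p E)} (hρ : Continuous ρ) (hnd : IsNondegenerate ρ)
    (hrat : HasRationalTraces ρ) {W : Submodule ℚ_[p] (LocMat p E n)} (h : IsLieOf ρ W)
    {l m : E →ₐ[ℚ] PadicAlgCl p}
    (hlm : ConjRelated (Submodule.span (PadicAlgCl p) (matEmbAll '' (W : Set (LocMat p E n)))) l m) :
    ∃ σ ∈ extraTwists ρ, l = m.comp σ.toAlgHom := by
  obtain ⟨σ, rfl⟩ := exists_eq_comp l m
  refine ⟨σ, ?_, rfl⟩
  obtain ⟨O, hO, hrel | hrel⟩ := h.trace_relation hlm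
  · obtain ⟨O', hO', h'⟩ := locAut_trace_eq hrat m σ (s := id) continuous_id (fun y h _ => h) hO hrel
    obtain ⟨χ, hχ, hiso⟩ := exists_iso_twist_of_trace hn hρ hnd hnd σ hO' h'
    exact ⟨χ, Or.inl ⟨hχ, hiso⟩⟩
  · obtain ⟨O', hO', h'⟩ := locAut_trace_eq hrat m σ (s := fun y => y⁻¹) continuous_inv
      (fun y _ h => h) hO hrel
    obtain ⟨χ, hχ, hiso⟩ := exists_iso_twist_of_trace hn hρ hnd hnd.dual σ hO' fun u hu => by
      rw [trace_dual]; exact h' u hu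
    exact ⟨χ, Or.inr ⟨hχ, hiso⟩⟩

end ConjRelated

end

/-! ### The twisting cocycle and its tangent maps -/

section

open Filter Topology NormedSpace

section Cocycle

variable {p : ℕ} [Fact p.Prime] {E : Type*} [Field E] [NumberField E] {n : ℕ}
  {G : Type*} [Group G]

theorem invTranspose_invTranspose {A : Type*} [CommRing A] (g : GL (Fin n) A) :
    invTranspose (invTranspose g) = g := by
  ext1
  change (((invTranspose g)⁻¹).val)ᵀ = g.val
  rw [← map_inv]
  change (((g⁻¹)⁻¹).valᵀ)ᵀ = g.val
  rw [inv_inv, transpose_transpose]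

/-- On the common kernel of the characters an extra-twist is a plain conjugation by some `P`, and
`α` undoes it: `P⁻¹` in the inner case, `Pᵀ` in the outer case. -/
theorem nonempty_twistCocycle [TopologicalSpace G] (ρ : G →* GL (Fin n) (Loc p E)) :
    Nonempty (TwistCocycle ρ) := by
  classical
  -- A `σ` that occurs in both kinds of twist is treated as inner.
  let out : extraTwists ρ → Bool := fun σ => !decide (∃ χ, IsInnerTwist ρ σ χ)
  have hout : ∀ σ, out σ = true → ∃ χ, IsOuterTwist ρ σ χ := by
    intro σ h
    obtain ⟨χ, hχ | hχ⟩ := σ.2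
    · have : ¬ ∃ χ, IsInnerTwist ρ σ χ := by simpa [out] using h
      exact absurd ⟨χ, hχ⟩ this
    · exact ⟨χ, hχ⟩
  have hin : ∀ σ, out σ = false → ∃ χ, IsInnerTwist ρ σ χ := by
    intro σ h
    simpa [out] using h
  have hα : ∀ σ, ∃ a : GL (Fin n) (Loc p E), ∀ h ∈ twistKernel ρ,
      twistAut (out σ) a (conjRep σ ρ h) = ρ h := by
    intro σ
    rcases hb : out σ with _ | _
    · obtain ⟨χ, hχ⟩ := hin σ hb
      obtain ⟨P, hP⟩ := hχ.2
      refine ⟨P⁻¹, fun h hh => ?_⟩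
      have h1 : χ h = 1 := hh σ χ (Or.inl hχ)
      rw [hP h]
      simp [twistAut, twist, h1, mul_assoc]
    · obtain ⟨χ, hχ⟩ := hout σ hb
      obtain ⟨P, hP⟩ := hχ.2
      refine ⟨(invTranspose P)⁻¹, fun h hh => ?_⟩
      have h1 : χ h = 1 := hh σ χ (Or.inr hχ)
      rw [hP h]
      simp [twistAut, twist, h1, mul_assoc, dual, invTranspose_invTranspose]
  choose α hα using hα
  exact ⟨⟨out, hin, hout, α, hα⟩⟩

/-- An `n`-th root of unity that is not equal to one is bounded away from one, uniformly for the
characters of all extra-twists. -/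
theorem twistKernel_mem_nhds [TopologicalSpace G] [IsTopologicalGroup G] (hn : 0 < n)
    {ρ : G →* GL (Fin n) (Loc p E)} (hρ : Continuous ρ)
    (hdet : ∀ g, (ρ g).val.det = 1) : twistKernel ρ ∈ 𝓝 1 := by
  classical
  let Λ := E →ₐ[ℚ] PadicAlgCl p
  -- The non-trivial `n`-th roots of unity form a finite, hence closed, set missing 1.
  let F : Set (PadicAlgCl p) := {z | z ^ n = 1 ∧ z ≠ 1}
  have hF : F.Finite := by
    refine ((Polynomial.nthRoots n (1 : PadicAlgCl p)).toFinset.finite_toSet).subset fun z hz => ?_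
    rw [Finset.mem_coe, Multiset.mem_toFinset, Polynomial.mem_nthRoots hn]
    exact hz.1
  let tr : Λ → G → PadicAlgCl p := fun ν g => locEmb p ν (ρ g).val.trace
  have htr : ∀ ν, Continuous (tr ν) := fun ν =>
    (continuous_locEmb ν).comp (Units.continuous_val.comp hρ).matrix_trace
  have htr1 : ∀ ν, tr ν 1 = n := fun ν => by simp [tr]
  have hn' : (n : PadicAlgCl p) ≠ 0 := Nat.cast_ne_zero.2 hn.ne'
  have hne : ∀ f : G → PadicAlgCl p, Continuous f → f 1 = n → ∀ ν : Λ,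
      ∀ᶠ g in 𝓝 (1 : G), f g ≠ 0 ∧ tr ν g / f g ∉ F := by
    intro f hf hf1 ν
    have h1 : ContinuousAt (fun g => tr ν g / f g) 1 :=
      (htr ν).continuousAt.div hf.continuousAt (by rw [hf1]; exact hn')
    have h2 : Fᶜ ∈ 𝓝 (tr ν 1 / f 1) := by
      rw [htr1, hf1, div_self hn']
      exact hF.isClosed.isOpen_compl.mem_nhds fun h => h.2 rfl
    filter_upwards [hf.continuousAt.eventually_ne (by rw [hf1]; exact hn'), h1 h2] with g h3 h4
    exact ⟨h3, h4⟩
  have hev1 : ∀ᶠ g in 𝓝 (1 : G), ∀ ν μ : Λ, tr μ g ≠ 0 ∧ tr ν g / tr μ g ∉ F := by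
    rw [eventually_all]; intro ν
    rw [eventually_all]; intro μ
    exact hne _ (htr μ) (htr1 μ) ν
  have hev2 : ∀ᶠ g in 𝓝 (1 : G), ∀ ν μ : Λ, tr μ g⁻¹ ≠ 0 ∧ tr ν g / tr μ g⁻¹ ∉ F := by
    rw [eventually_all]; intro ν
    rw [eventually_all]; intro μ
    exact hne _ ((htr μ).comp continuous_inv) (by simp [htr1]) ν
  filter_upwards [hev1, hev2] with g h1 h2 σ χ hχ
  -- Determinants give `χ(g) ^ n = 1`. Taking traces writes `χ(g)`, under each embedding, as a
  -- quotient of two traces close to `n`; being close to 1, this root of unity is 1. The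
  -- neighbourhood does not depend on the twist.
  have key : ∀ (ρ₂ : G →* GL (Fin n) (Loc p E)), (ρ₂ g).val.det = 1 →
      (∀ ν μ : Λ, locEmb p μ (ρ₂ g).val.trace ≠ 0 ∧ tr ν g / locEmb p μ (ρ₂ g).val.trace ∉ F) →
      Iso (twist ρ₂ χ) (conjRep σ ρ) → χ g = 1 := by
    rintro ρ₂ hd₂ hF₂ ⟨P, hP⟩
    have hval : (twist ρ₂ χ g).val = (χ g).val • (ρ₂ g).val := by
      change Matrix.scalar (Fin n) (χ g).val * (ρ₂ g).val = _
      rw [Matrix.scalar_apply, ← Matrix.smul_eq_diagonal_mul]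
    have hPg := congrArg Units.val (hP g)
    rw [Units.val_mul, Units.val_mul, hval] at hPg
    have h3 : (χ g).val ^ n = 1 := by
      have h4 := congrArg Matrix.det hPg
      rw [Matrix.det_units_conj, Matrix.det_smul, hd₂, mul_one, Fintype.card_fin] at h4
      rw [← h4]
      have : (conjRep σ ρ g).val.det = locAut p σ (ρ g).val.det :=
        (AlgHom.map_det (locAut p σ) (ρ g).val).symm
      rw [this, hdet, map_one]
    have h5 : locAut p σ (ρ g).val.trace = (χ g).val * (ρ₂ g).val.trace := by
      have h4 := congrArg Matrix.trace hPg
      rwa [Matrix.trace_units_conj, Matrix.trace_smul, smul_eq_mul, trace_conjRep] at h4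
    refine Units.ext (locEmb_ext fun ν => ?_)
    rw [Units.val_one, map_one]
    by_contra hcon
    obtain ⟨h6, h7⟩ := hF₂ (ν.comp σ.toAlgHom) ν
    refine h7 ?_
    have h8 : tr (ν.comp σ.toAlgHom) g / locEmb p ν (ρ₂ g).val.trace = locEmb p ν (χ g).val := by
      rw [div_eq_iff h6, ← map_mul, ← h5, locEmb_locAut]
    rw [h8]
    exact ⟨by rw [← map_pow, h3, map_one], hcon⟩
  rcases hχ with hχ | hχ
  · exact key ρ (hdet g) h1 hχ.2
  · refine key (dual ρ) ?_ ?_ hχ.2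
    · change ((ρ g)⁻¹.valᵀ).det = 1
      rw [Matrix.det_transpose, ← map_inv, hdet]
    · intro ν μ
      rw [trace_dual, ← map_inv]
      exact h2 ν μ

/-- The derivative at the identity of `g ↦ f(^σ g)`. -/
def twistTangent (out : Bool) (a : GL (Fin n) (Loc p E)) (σ : E ≃ₐ[ℚ] E) :
    LocMat p E n →ₗ[ℚ_[p]] LocMat p E n where
  toFun x := if out then -(a.val * ((locAut p σ).mapMatrix x)ᵀ * (a⁻¹).val)
    else a.val * (locAut p σ).mapMatrix x * (a⁻¹).val
  map_add' x y := by
    split_ifs <;> (rw [map_add]; simp only [transpose_add, mul_add, add_mul, neg_add])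
  map_smul' c x := by
    split_ifs <;> rw [map_smul] <;> simp

theorem trace_twistTangent (out : Bool) (a : GL (Fin n) (Loc p E)) (σ : E ≃ₐ[ℚ] E)
    (x : LocMat p E n) : (twistTangent out a σ x).trace =
      if out then -locAut p σ x.trace else locAut p σ x.trace := by
  have h : ((locAut p σ).mapMatrix x).trace = locAut p σ x.trace := by
    rw [Matrix.trace, Matrix.trace, map_sum]; rfl
  cases out
  · simp only [twistTangent, LinearMap.coe_mk, AddHom.coe_mk, Bool.false_eq_true, if_false]
    rw [Matrix.trace_units_conj, h]
  · simp only [twistTangent, LinearMap.coe_mk, AddHom.coe_mk, if_true]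
    rw [Matrix.trace_neg, Matrix.trace_units_conj, Matrix.trace_transpose, h]

theorem matEmb_mapMatrix_locAut (ν : E →ₐ[ℚ] PadicAlgCl p) (σ : E ≃ₐ[ℚ] E) (x : LocMat p E n) :
    matEmb ν ((locAut p σ).mapMatrix x) = matEmb (ν.comp σ.toAlgHom) x := by
  ext i j
  exact locEmb_locAut ν σ _

/-- The map on matrices over `ℚ̄_p` that relates the components of a matrix fixed by a twist. -/
def twistTangentAt (ν : E →ₐ[ℚ] PadicAlgCl p) (out : Bool) (a : GL (Fin n) (Loc p E)) :
    Matrix (Fin n) (Fin n) (PadicAlgCl p) →ₗ[PadicAlgCl p]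
      Matrix (Fin n) (Fin n) (PadicAlgCl p) where
  toFun X := if out then -(matEmb ν a.val * Xᵀ * matEmb ν (a⁻¹).val)
    else matEmb ν a.val * X * matEmb ν (a⁻¹).val
  map_add' x y := by
    split_ifs <;> simp only [transpose_add, mul_add, add_mul]; abel
  map_smul' c x := by
    split_ifs <;> simp

theorem matEmb_twistTangent (ν : E →ₐ[ℚ] PadicAlgCl p) (out : Bool) (a : GL (Fin n) (Loc p E))
    (σ : E ≃ₐ[ℚ] E) (x : LocMat p E n) : matEmb ν (twistTangent out a σ x) =
      twistTangentAt ν out a (matEmb (ν.comp σ.toAlgHom) x) := by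
  cases out
  · simp only [twistTangent, twistTangentAt, LinearMap.coe_mk, AddHom.coe_mk, Bool.false_eq_true, if_false]
    rw [map_mul, map_mul, matEmb_mapMatrix_locAut]
  · simp only [twistTangent, twistTangentAt, LinearMap.coe_mk, AddHom.coe_mk, if_true]
    rw [map_neg, map_mul, map_mul, ← matEmb_mapMatrix_locAut]
    rfl

theorem exp_twistTangent {U : Set (LocMat p E n)} (hU : IsExpNhd (p := p) U) (out : Bool)
    (a : GL (Fin n) (Loc p E)) (σ : E ≃ₐ[ℚ] E) {x : LocMat p E n} (hx : x ∈ U)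
    {y : GL (Fin n) (Loc p E)} (hy : y.val = exp x) :
    exp (twistTangent out a σ x) =
      (twistAut out a (GeneralLinearGroup.map (locAut p σ).toRingHom y)).val := by
  have hσ : Continuous ((locAut p σ).mapMatrix : LocMat p E n →ₐ[ℚ_[p]] LocMat p E n) :=
    continuous_id.matrix_map (continuous_locAut σ)
  have hc : ∀ b : GL (Fin n) (Loc p E), Continuous ((conjRingHom b).comp
      ((locAut p σ).mapMatrix : LocMat p E n →ₐ[ℚ_[p]] LocMat p E n).toRingHom) := fun b =>
    (continuous_const.mul hσ).mul continuous_const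
  have hyi : (y⁻¹).val = exp (-x) :=
    Units.inv_eq_of_mul_eq_one_right (by rw [hy]; exact hU.exp_mul_exp_neg hx)
  cases out
  · have h3 := hU.map_exp _ (hc a) hx
    rw [← hy] at h3
    refine Eq.trans ?_ (h3.symm.trans ?_)
    · simp [twistTangent, conjRingHom]
    · simp [twistAut, conjRingHom]
  · have h3 := hU.map_exp _ (hc (invTranspose a)) (hU.neg_mem hx)
    rw [← hyi] at h3
    have h4 : twistTangent true a σ x =
        (((conjRingHom (invTranspose a)).comp
          ((locAut p σ).mapMatrix : LocMat p E n →ₐ[ℚ_[p]] LocMat p E n).toRingHom) (-x))ᵀ := by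
      rw [map_neg]
      simp [twistTangent, conjRingHom, invTranspose, Matrix.transpose_mul, mul_assoc]
    have h5 : ((GeneralLinearGroup.map (locAut p σ).toRingHom y)⁻¹).val =
        (locAut p σ).mapMatrix (y⁻¹).val := by
      rw [← map_inv]
      rfl
    rw [h4, Matrix.exp_transpose, ← h3]
    change ((invTranspose a).val * (locAut p σ).mapMatrix (y⁻¹).val * ((invTranspose a)⁻¹).val)ᵀ =
      a.val * (((GeneralLinearGroup.map (locAut p σ).toRingHom y)⁻¹).val)ᵀ * (a⁻¹).val
    rw [h5, Matrix.transpose_mul, Matrix.transpose_mul, ← map_inv, mul_assoc]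
    change ((a⁻¹)⁻¹.valᵀ)ᵀ * (_ * ((a⁻¹).valᵀ)ᵀ) = _
    rw [inv_inv, transpose_transpose, transpose_transpose]

end Cocycle

end

/-! ### The Lie algebra is cut out by the twists -/

section

open Filter Topology NormedSpace

section BracketSpan

variable {k A : Type*} [Field k] [Ring A] [Algebra k A]

/-- Brackets of elements of a span are combinations of brackets of generators. -/
theorem lie_mem_span_lie {s : Set A} {a b : A} (ha : a ∈ Submodule.span k s)
    (hb : b ∈ Submodule.span k s) :
    a * b - b * a ∈ Submodule.span k {c | ∃ x ∈ s, ∃ y ∈ s, c = x * y - y * x} := by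
  induction ha using Submodule.span_induction with
  | mem x hx =>
    induction hb using Submodule.span_induction with
    | mem y hy => exact Submodule.subset_span ⟨x, hx, y, hy, rfl⟩
    | zero => simp
    | add y z _ _ hy hz =>
      rw [show x * (y + z) - (y + z) * x = (x * y - y * x) + (x * z - z * x) by
        rw [mul_add, add_mul]; abel]
      exact Submodule.add_mem _ hy hz
    | smul c y _ hy =>
      rw [show x * (c • y) - (c • y) * x = c • (x * y - y * x) by simp [smul_sub]]
      exact Submodule.smul_mem _ _ hy
  | zero => simp
  | add y z _ _ hy hz =>
    rw [show (y + z) * b - b * (y + z) = (y * b - b * y) + (z * b - b * z) by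
      rw [mul_add, add_mul]; abel]
    exact Submodule.add_mem _ hy hz
  | smul c y _ hy =>
    rw [show (c • y) * b - b * (c • y) = c • (y * b - b * y) by simp [smul_sub]]
    exact Submodule.smul_mem _ _ hy

end BracketSpan

section TwistLie

variable {p : ℕ} [Fact p.Prime] {E : Type*} [Field E] [NumberField E] {n : ℕ}
  {G : Type*} [Group G] [TopologicalSpace G] [IsTopologicalGroup G] [CompactSpace G]
  {ρ : G →* GL (Fin n) (Loc p E)} {W : Submodule ℚ_[p] (LocMat p E n)}

theorem continuous_twistTangent (out : Bool) (a : GL (Fin n) (Loc p E)) (σ : E ≃ₐ[ℚ] E) :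
    Continuous (twistTangent out a σ) :=
  IsModuleTopology.continuous_of_linearMap (R := ℚ_[p]) _

/-- For small `t` the element `exp(tx)` is the image of some `g` in the common kernel, where the
twisted action fixes it; injectivity of `exp` carries this over to `tx`. -/
theorem IsLieOf.twistTangent_eq_of_mem (h : IsLieOf ρ W) (hρ : Continuous ρ)
    (hker : twistKernel ρ ∈ 𝓝 1) (f : TwistCocycle ρ) (σ : extraTwists ρ) {x : LocMat p E n}
    (hx : x ∈ W) : twistTangent (f.out σ) (f.α σ) σ x = x := by
  obtain ⟨U, -, hU⟩ := (hasPadicExp_locMat p E n).exists_isExpNhd _ univ_mem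
  set D := twistTangent (f.out σ) (f.α σ) (σ : E ≃ₐ[ℚ] E) with hD
  have hDU : D ⁻¹' U ∈ 𝓝 (0 : LocMat p E n) :=
    (continuous_twistTangent _ _ _).continuousAt.preimage_mem_nhds (by
      rw [map_zero]; exact hU.mem_nhds)
  have h1 := eventually_smul_mem (p := p)
    (inter_mem hU.mem_nhds (inter_mem hDU (h.eventually_exists hρ hker))) x
  obtain ⟨t, ⟨htU, htD, htg⟩, ht0⟩ :=
    ((h1.filter_mono nhdsWithin_le_nhds).and (self_mem_nhdsWithin (s := {0}ᶜ))).exists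
  obtain ⟨g, hg, hgx⟩ := htg (W.smul_mem t hx)
  have h2 : exp (D (t • x)) = exp (t • x) := by
    rw [hD, exp_twistTangent hU _ _ _ htU hgx, ← hgx]
    exact congrArg Units.val (f.apply_conjRep σ g hg)
  have h3 := hU.injOn htD htU h2
  rw [map_smul] at h3
  exact smul_right_injective _ ht0 h3

theorem trace_eq_zero_of_mem
    (hsl : ∀ ν : E →ₐ[ℚ] PadicAlgCl p,
      Submodule.span (PadicAlgCl p) (matEmb ν '' (W : Set (LocMat p E n))) =
      LinearMap.ker (traceLinearMap (Fin n) (PadicAlgCl p) (PadicAlgCl p)))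
    {x : LocMat p E n} (hx : x ∈ W) : x.trace = 0 := by
  refine locEmb_ext fun ν => ?_
  have : matEmb ν x ∈ LinearMap.ker (traceLinearMap (Fin n) (PadicAlgCl p) (PadicAlgCl p)) := by
    rw [← hsl]; exact Submodule.subset_span ⟨x, hx, rfl⟩
  rw [map_zero, ← trace_matEmb]
  exact this

/-- Two elements of the product over all embeddings that satisfy the linear relations given by the
twists and agree at a set of representatives are equal. -/
theorem eq_of_twistRelation {Λ A : Type*} [AddGroup A] {R : Finset Λ} {w w' : Λ → A}
    (hR : ∀ r ∈ R, w r = w' r)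
    (h : ∀ l, l ∈ R ∨ ∃ r ∈ R, ∃ φ : A → A, Function.Injective φ ∧
      ((w l = φ (w r) ∧ w' l = φ (w' r)) ∨ (w r = φ (w l) ∧ w' r = φ (w' l)))) : w = w' := by
  funext l
  rcases h l with hl | ⟨r, hr, φ, hφ, ⟨h1, h2⟩ | ⟨h1, h2⟩⟩
  · exact hR l hl
  · rw [h1, h2, hR r hr]
  · exact hφ (by rw [← h1, ← h2, hR r hr])

theorem twistTangentAt_injective (ν : E →ₐ[ℚ] PadicAlgCl p) (out : Bool)
    (a : GL (Fin n) (Loc p E)) : Function.Injective (twistTangentAt ν out a) := by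
  have h1 : matEmb ν (a⁻¹).val * matEmb ν a.val = 1 := by
    rw [← map_mul, ← Units.val_mul, inv_mul_cancel, Units.val_one, map_one]
  have key : ∀ X Y : Matrix (Fin n) (Fin n) (PadicAlgCl p),
      matEmb ν a.val * X * matEmb ν (a⁻¹).val = matEmb ν a.val * Y * matEmb ν (a⁻¹).val → X = Y := by
    intro X Y h
    have h2 := congrArg (fun Z => matEmb ν (a⁻¹).val * Z * matEmb ν a.val) h
    simpa only [mul_assoc, h1, mul_one, ← mul_assoc (matEmb ν (a⁻¹).val), one_mul] using h2
  intro X Y h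
  cases out
  · exact key X Y (by simpa [twistTangentAt] using h)
  · exact Matrix.transpose_injective (key _ _ (by simpa [twistTangentAt] using h))

variable [TotallyDisconnectedSpace G]

/-- The traceless matrices fixed by all twists are sums of brackets of elements of the Lie
algebra. -/
theorem IsLieOf.mem_span_lie_of_twistTangent_eq [IsGalois ℚ E] (hn : 0 < n) (h : IsLieOf ρ W)
    (hρ : Continuous ρ) (hrat : HasRationalTraces ρ) (hker : twistKernel ρ ∈ 𝓝 1)
    (hsl : ∀ ν : E →ₐ[ℚ] PadicAlgCl p,
      Submodule.span (PadicAlgCl p) (matEmb ν '' (W : Set (LocMat p E n))) =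
      LinearMap.ker (traceLinearMap (Fin n) (PadicAlgCl p) (PadicAlgCl p)))
    (f : TwistCocycle ρ) {x : LocMat p E n} (hx : x.trace = 0)
    (hfx : ∀ σ : extraTwists ρ, twistTangent (f.out σ) (f.α σ) σ x = x) :
    x ∈ Submodule.span ℚ_[p] {c | ∃ a ∈ W, ∃ b ∈ W, c = a * b - b * a} := by
  have hnd : IsNondegenerate ρ := fun ν V hV Z hZ =>
    h.eq_zero_of_trace_mul_eq_zero hn hρ (hsl ν) hV hZ
  set S : Set ((E →ₐ[ℚ] PadicAlgCl p) → Matrix (Fin n) (Fin n) (PadicAlgCl p)) :=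
    matEmbAll '' (W : Set (LocMat p E n)) with hS
  set g := Submodule.span (PadicAlgCl p) S with hg
  have hmul : ∀ a b : LocMat p E n, matEmbAll (a * b - b * a) =
      matEmbAll a * matEmbAll b - matEmbAll b * matEmbAll a := by
    intro a b
    funext ν
    simp only [Pi.sub_apply, Pi.mul_apply, matEmbAll_apply, map_sub, map_mul]
  have hbr : ∀ c, (∃ a ∈ S, ∃ b ∈ S, c = a * b - b * a) ↔
      c ∈ matEmbAll '' {c | ∃ a ∈ W, ∃ b ∈ W, c = a * b - b * a} := by
    intro c
    constructor
    · rintro ⟨_, ⟨a, ha, rfl⟩, _, ⟨b, hb, rfl⟩, rfl⟩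
      exact ⟨_, ⟨a, ha, b, hb, rfl⟩, hmul a b⟩
    · rintro ⟨_, ⟨a, ha, b, hb, rfl⟩, rfl⟩
      exact ⟨_, ⟨a, ha, rfl⟩, _, ⟨b, hb, rfl⟩, hmul a b⟩
  have hbr' : ∀ a ∈ g, ∀ b ∈ g, a * b - b * a ∈ Submodule.span (PadicAlgCl p)
      (matEmbAll '' {c | ∃ a ∈ W, ∃ b ∈ W, c = a * b - b * a}) := by
    intro a ha b hb
    have := lie_mem_span_lie ha hb
    rwa [show {c | ∃ x ∈ S, ∃ y ∈ S, c = x * y - y * x} = _ from Set.ext hbr] at this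
  have hle : Submodule.span (PadicAlgCl p)
      (matEmbAll '' {c | ∃ a ∈ W, ∃ b ∈ W, c = a * b - b * a}) ≤ g := by
    refine Submodule.span_mono (Set.image_mono ?_)
    rintro _ ⟨a, ha, b, hb, rfl⟩
    exact h.lie_mem a ha b hb
  have hmap : ∀ ν, g.map (LinearMap.proj ν) =
      LinearMap.ker (traceLinearMap (Fin n) (PadicAlgCl p) (PadicAlgCl p)) := by
    intro ν
    rw [hg, Submodule.map_span, hS, ← Set.image_comp, ← hsl ν]
    rfl
  obtain ⟨R, hR, hRw⟩ := exists_finset_conjRelated (g := g)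
    (fun a ha b hb => hle (hbr' a ha b hb))
    (fun w hw l => by
      have : w l ∈ g.map (LinearMap.proj l) := ⟨w, hw, rfl⟩
      rw [hmap] at this
      exact this)
    (fun l Z hZ => by
      have : Z ∈ g.map (LinearMap.proj l) := by rw [hmap]; exact hZ
      exact this)
  -- An element of the span of brackets with the components of `x` at the representatives.
  obtain ⟨w, hw, hwR⟩ := hRw (matEmbAll x) fun l => by
    rw [matEmbAll_apply, trace_matEmb, hx, map_zero]
  have hwT : w ∈ Submodule.span (PadicAlgCl p)
      (matEmbAll '' {c | ∃ a ∈ W, ∃ b ∈ W, c = a * b - b * a}) := by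
    refine Submodule.span_le.2 ?_ hw
    rintro _ ⟨a, ha, b, hb, rfl⟩
    exact hbr' a ha b hb
  have hwg : w ∈ g := hle hwT
  -- the relations between components
  have hrel : ∀ (σ : extraTwists ρ) (ν : E →ₐ[ℚ] PadicAlgCl p), ∀ w ∈ g,
      w ν = twistTangentAt ν (f.out σ) (f.α σ) (w (ν.comp (σ : E ≃ₐ[ℚ] E).toAlgHom)) := by
    intro σ ν w hw
    induction hw using Submodule.span_induction with
    | mem y hy =>
      obtain ⟨y, hy, rfl⟩ := hy
      rw [matEmbAll_apply, matEmbAll_apply, ← matEmb_twistTangent,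
        h.twistTangent_eq_of_mem hρ hker f σ hy]
    | zero => simp
    | add a b _ _ ha hb => rw [Pi.add_apply, Pi.add_apply, map_add, ← ha, ← hb]
    | smul c a _ ha => rw [Pi.smul_apply, Pi.smul_apply, map_smul, ← ha]
  have hrelx : ∀ (σ : extraTwists ρ) (ν : E →ₐ[ℚ] PadicAlgCl p),
      matEmbAll x ν = twistTangentAt ν (f.out σ) (f.α σ)
        (matEmbAll x (ν.comp (σ : E ≃ₐ[ℚ] E).toAlgHom)) := by
    intro σ ν
    rw [matEmbAll_apply, matEmbAll_apply, ← matEmb_twistTangent, hfx σ]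
  -- Any other component is linked to one in `R`, hence by an extra-twist. Both `w` and `x` satisfy
  -- the relation of that twist, so they agree there too.
  have hwx : w = matEmbAll x := by
    refine eq_of_twistRelation hwR fun l => (hR l).imp_right ?_
    rintro ⟨r, hr, hlr | hrl⟩
    · obtain ⟨σ, hσ, rfl⟩ := exists_extraTwist_of_conjRelated hn hρ hnd hrat h hlr
      exact ⟨r, hr, _, twistTangentAt_injective r (f.out ⟨σ, hσ⟩) (f.α ⟨σ, hσ⟩),
        Or.inr ⟨hrel ⟨σ, hσ⟩ r w hwg, hrelx ⟨σ, hσ⟩ r⟩⟩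
    · obtain ⟨σ, hσ, rfl⟩ := exists_extraTwist_of_conjRelated hn hρ hnd hrat h hrl
      exact ⟨_, hr, _, twistTangentAt_injective l (f.out ⟨σ, hσ⟩) (f.α ⟨σ, hσ⟩),
        Or.inl ⟨hrel ⟨σ, hσ⟩ l w hwg, hrelx ⟨σ, hσ⟩ l⟩⟩
  refine mem_of_matEmbAll_mem_span ?_
  rw [← hwx]
  exact Submodule.span_mono (Set.image_mono Submodule.subset_span) hwT

end TwistLie

end

/-! ### Rational points of `H` and scalars -/

section

open Filter Topology NormedSpace

section RationalPoints

theorem twistAut_map {A B : Type*} [CommRing A] [CommRing B] {n : ℕ} (φ : A →+* B) (out : Bool)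
    (a y : GL (Fin n) A) : twistAut out (GeneralLinearGroup.map φ a) (GeneralLinearGroup.map φ y) =
      GeneralLinearGroup.map φ (twistAut out a y) := by
  cases out
  · simp [twistAut]
  · have : invTranspose (GeneralLinearGroup.map φ y) = GeneralLinearGroup.map φ (invTranspose y) := by
      ext1
      change ((GeneralLinearGroup.map φ y)⁻¹.val)ᵀ = _
      rw [← map_inv]
      rfl
    simp [twistAut, this]

variable {p : ℕ} [Fact p.Prime] {E : Type*} [Field E] [NumberField E] {n : ℕ}
  {G : Type*} [Group G] [TopologicalSpace G] {ρ : G →* GL (Fin n) (Loc p E)}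

theorem act_map_includeLeft (f : TwistCocycle ρ) (σ : extraTwists ρ) (y : GL (Fin n) (Loc p E)) :
    f.act (Loc p (twistField ρ)) σ (GeneralLinearGroup.map
      (Algebra.TensorProduct.includeLeftRingHom :
        Loc p E →+* Loc p E ⊗[Loc p (twistField ρ)] Loc p (twistField ρ)) y) =
      GeneralLinearGroup.map Algebra.TensorProduct.includeLeftRingHom
        (twistAut (f.out σ) (f.α σ)
          (GeneralLinearGroup.map (locAut p (σ : E ≃ₐ[ℚ] E)).toRingHom y)) := by
  rw [← twistAut_map, TwistCocycle.act, MonoidHom.comp_apply]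
  congr 1

/-- The identification `E_p ⊗_{F_p} F_p = E_p` removes the base change from the definition. -/
theorem mem_rationalPoints_iff (f : TwistCocycle ρ) (y : GL (Fin n) (Loc p E)) :
    y ∈ f.rationalPoints ↔ y.val.det = 1 ∧ ∀ σ : extraTwists ρ, twistAut (f.out σ) (f.α σ)
      (GeneralLinearGroup.map (locAut p (σ : E ≃ₐ[ℚ] E)).toRingHom y) = y := by
  have hinj : Function.Injective (GeneralLinearGroup.map (n := Fin n)
      (Algebra.TensorProduct.includeLeftRingHom :
        Loc p E →+* Loc p E ⊗[Loc p (twistField ρ)] Loc p (twistField ρ))) := by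
    intro a b hab
    ext i j
    have h := congrArg (fun u : GL (Fin n) _ => Algebra.TensorProduct.rid
      (Loc p (twistField ρ)) (Loc p (twistField ρ)) (Loc p E) (u.val i j)) hab
    simpa using h
  have key : ∀ g : SpecialLinearGroup (Fin n) (Loc p E),
      SpecialLinearGroup.map (Algebra.TensorProduct.includeLeftRingHom :
        Loc p E →+* Loc p E ⊗[Loc p (twistField ρ)] Loc p (twistField ρ)) g ∈
          f.points (Loc p (twistField ρ)) ↔
      ∀ σ : extraTwists ρ, twistAut (f.out σ) (f.α σ)
        (GeneralLinearGroup.map (locAut p (σ : E ≃ₐ[ℚ] E)).toRingHom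
          (SpecialLinearGroup.toGL g)) = SpecialLinearGroup.toGL g := by
    intro g
    refine forall_congr' fun σ => ?_
    have h1 : SpecialLinearGroup.toGL (SpecialLinearGroup.map
        (Algebra.TensorProduct.includeLeftRingHom :
        Loc p E →+* Loc p E ⊗[Loc p (twistField ρ)] Loc p (twistField ρ)) g) =
        GeneralLinearGroup.map Algebra.TensorProduct.includeLeftRingHom
          (SpecialLinearGroup.toGL g) := by
      ext i j
      rfl
    rw [h1, act_map_includeLeft]
    exact hinj.eq_iff
  constructor
  · rintro ⟨g, hg, rfl⟩
    exact ⟨g.2, (key g).1 hg⟩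
  · rintro ⟨hd, hy⟩
    have h1 : SpecialLinearGroup.toGL ⟨y.val, hd⟩ = y := by ext i j; rfl
    refine ⟨⟨y.val, hd⟩, (key _).2 ?_, h1⟩
    rw [h1]
    exact hy

theorem apply_mem_rationalPoints (f : TwistCocycle ρ) (hdet : ∀ g, (ρ g).val.det = 1) {g : G}
    (hg : g ∈ twistKernel ρ) : ρ g ∈ f.rationalPoints :=
  (mem_rationalPoints_iff f _).2 ⟨hdet g, fun σ => f.apply_conjRep σ g hg⟩

/-- The scalar matrix given by a `p`-adic number. -/
def padicScalar (p : ℕ) [Fact p.Prime] (E : Type*) [Field E] [CharZero E] (n : ℕ) :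
    ℚ_[p]ˣ →* GL (Fin n) (Loc p E) :=
  (GeneralLinearGroup.scalar (Fin n)).comp (Units.map (algebraMap ℚ_[p] (Loc p E)).toMonoidHom)

theorem padicScalar_val (z : ℚ_[p]ˣ) :
    (padicScalar p E n z).val = algebraMap ℚ_[p] (LocMat p E n) z := rfl

theorem padicScalar_commute (z : ℚ_[p]ˣ) (g : GL (Fin n) (Loc p E)) :
    Commute (padicScalar p E n z) g := GeneralLinearGroup.scalar_commute _ g

theorem locAut_padicScalar (σ : E ≃ₐ[ℚ] E) (z : ℚ_[p]ˣ) :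
    GeneralLinearGroup.map (locAut p σ).toRingHom (padicScalar p E n z) = padicScalar p E n z := by
  ext i j
  change ((locAut p σ).mapMatrix (algebraMap ℚ_[p] (LocMat p E n) z)) i j = _
  rw [AlgHom.commutes]
  rfl

theorem twistAut_padicScalar (out : Bool) (a : GL (Fin n) (Loc p E)) (z : ℚ_[p]ˣ) :
    twistAut out a (padicScalar p E n z) = padicScalar p E n (if out then z⁻¹ else z) := by
  have hconj : ∀ z, MulAut.conj a (padicScalar p E n z) = padicScalar p E n z := fun z => by
    rw [MulAut.conj_apply, ← (padicScalar_commute z a).eq, mul_inv_cancel_right]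
  cases out
  · exact hconj z
  · have : invTranspose (padicScalar p E n z) = padicScalar p E n z⁻¹ := by
      ext1
      change ((padicScalar p E n z)⁻¹.val)ᵀ = _
      rw [← map_inv, padicScalar_val, Matrix.algebraMap_eq_diagonal, Matrix.diagonal_transpose]
    change MulAut.conj a (invTranspose (padicScalar p E n z)) = _
    rw [this, hconj]
    rfl

/-- The group `H(F_p) · ℚ_p^×`. -/
def rationalSimilitudes (f : TwistCocycle ρ) : Subgroup (GL (Fin n) (Loc p E)) where
  carrier := (f.rationalPoints : Set (GL (Fin n) (Loc p E))) * (padicScalars p E n : Set _)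
  one_mem' := Set.mem_mul.2 ⟨1, one_mem _, 1, one_mem _, one_mul 1⟩
  mul_mem' := by
    rintro _ _ ⟨a, ha, _, ⟨z, rfl⟩, rfl⟩ ⟨b, hb, _, ⟨w, rfl⟩, rfl⟩
    refine ⟨a * b, mul_mem ha hb, padicScalar p E n (z * w), ⟨z * w, rfl⟩, ?_⟩
    change a * b * padicScalar p E n (z * w) = a * padicScalar p E n z * (b * padicScalar p E n w)
    rw [map_mul, mul_assoc, mul_assoc, ← mul_assoc b, ← (padicScalar_commute z b).eq, mul_assoc]
  inv_mem' := by
    rintro _ ⟨a, ha, _, ⟨z, rfl⟩, rfl⟩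
    refine ⟨a⁻¹, inv_mem ha, padicScalar p E n z⁻¹, ⟨z⁻¹, rfl⟩, ?_⟩
    change a⁻¹ * padicScalar p E n z⁻¹ = (a * padicScalar p E n z)⁻¹
    rw [_root_.mul_inv_rev, map_inv, ((padicScalar_commute z a⁻¹).inv_left).eq]

end RationalPoints

end

/-! ### Restoring the twist, and logarithms in `H(F_p) · ℚ_p^×` -/

section

open Filter Topology NormedSpace

section ScalarExp

variable {p : ℕ} [Fact p.Prime]

/-- A continuous linear retraction of the structure map of a finite-dimensional algebra. -/
theorem exists_retraction (B : Type*) [Ring B] [Nontrivial B] [Algebra ℚ_[p] B] [TopologicalSpace B]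
    [IsTopologicalRing B] [IsModuleTopology ℚ_[p] B] :
    ∃ π : B → ℚ_[p], Continuous π ∧ ∀ t, π (algebraMap ℚ_[p] B t) = t := by
  obtain ⟨π, hπ⟩ := (Algebra.linearMap ℚ_[p] B).exists_leftInverse_of_injective
    (LinearMap.ker_eq_bot.2 (algebraMap ℚ_[p] B).injective)
  exact ⟨π, IsModuleTopology.continuous_of_linearMap (R := ℚ_[p]) π, fun t => LinearMap.congr_fun hπ t⟩

theorem continuous_algebraMap_of_isModuleTopology (B : Type*) [Ring B] [Algebra ℚ_[p] B]
    [TopologicalSpace B] [IsTopologicalRing B] [IsModuleTopology ℚ_[p] B] :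
    Continuous (algebraMap ℚ_[p] B) :=
  IsModuleTopology.continuous_of_linearMap (R := ℚ_[p]) (Algebra.linearMap ℚ_[p] B)

/-- `p`-adic numbers close to one are exponentials of small numbers. -/
theorem eventually_exists_exp_algebraMap {B : Type*} [Ring B] [Algebra ℚ_[p] B]
    [TopologicalSpace B] [IsTopologicalRing B] [T2Space B] [IsModuleTopology ℚ_[p] B] {S : Set B}
    (hS : S ∈ 𝓝 0) : ∀ᶠ z in 𝓝 (1 : ℚ_[p]), ∃ t : ℚ_[p], algebraMap ℚ_[p] B t ∈ S ∧
      exp t = z ∧ exp (algebraMap ℚ_[p] B t) = algebraMap ℚ_[p] B z := by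
  have hQ : HasPadicExp p ℚ_[p] := hasPadicExp _
  have hc := continuous_algebraMap_of_isModuleTopology (p := p) B
  have hS' : algebraMap ℚ_[p] B ⁻¹' S ∈ 𝓝 (0 : ℚ_[p]) :=
    hc.continuousAt.preimage_mem_nhds (by rwa [map_zero])
  obtain ⟨U, -, hU⟩ := hQ.exists_isExpNhd _ univ_mem
  have := image_mem_map (m := exp) (inter_mem hU.mem_nhds hS')
  rw [hQ.map_exp_nhds_zero] at this
  filter_upwards [this]
  rintro _ ⟨t, ⟨htU, htS⟩, rfl⟩
  exact ⟨t, htS, rfl, (hU.map_exp (algebraMap ℚ_[p] B) hc htU).symm⟩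

end ScalarExp

section TwistedLie

variable {p : ℕ} [Fact p.Prime] {E : Type*} [Field E] [NumberField E] {n : ℕ}
  {G : Type*} [Group G]

/-- The twist of `ρ` by a `ℚ_p^×`-valued character. -/
def padicTwist (ρ : G →* GL (Fin n) (Loc p E)) (c : G →* ℚ_[p]ˣ) : G →* GL (Fin n) (Loc p E) :=
  twist ρ ((Units.map (algebraMap ℚ_[p] (Loc p E)).toMonoidHom).comp c)

theorem padicTwist_apply (ρ : G →* GL (Fin n) (Loc p E)) (c : G →* ℚ_[p]ˣ) (g : G) :
    padicTwist ρ c g = padicScalar p E n (c g) * ρ g := rfl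

variable [TopologicalSpace G]

theorem continuous_padicScalar : Continuous (padicScalar p E n) := by
  have h := continuous_algebraMap_of_isModuleTopology (p := p) (LocMat p E n)
  refine Units.continuous_iff.2 ⟨h.comp Units.continuous_val, ?_⟩
  have : (fun z => ((padicScalar p E n z)⁻¹).val) =
      fun z => algebraMap ℚ_[p] (LocMat p E n) (z⁻¹ : ℚ_[p]ˣ) := by
    funext z
    rw [← map_inv]; rfl
  exact this ▸ h.comp (Units.continuous_val.comp continuous_inv)

theorem continuous_padicTwist {ρ : G →* GL (Fin n) (Loc p E)} {c : G →* ℚ_[p]ˣ}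
    (hρ : Continuous ρ) (hc : Continuous c) : Continuous (padicTwist ρ c) :=
  (continuous_padicScalar.comp hc).mul hρ

variable {ρ : G →* GL (Fin n) (Loc p E)} {W W' : Submodule ℚ_[p] (LocMat p E n)} {c : G →* ℚ_[p]ˣ} {N : Subgroup G}

/-- If `ρ(g)` and `c(g)` are exponentials of small elements then so is their product. -/
theorem exists_nhds_add_mem (hc : Continuous c)
    (h' : IsLieOf ((padicTwist ρ c).comp N.subtype) W') :
    ∃ U ∈ 𝓝 (0 : LocMat p E n), ∃ V ∈ 𝓝 (1 : G), ∀ x ∈ U, ∀ g ∈ V, g ∈ N → (ρ g).val = exp x →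
      ∃ t : ℚ_[p], exp t = (c g : ℚ_[p]) ∧ x + algebraMap ℚ_[p] (LocMat p E n) t ∈ W' := by
  obtain ⟨V, hV, hVadd⟩ : ∃ V ∈ 𝓝 (0 : LocMat p E n), ∀ a ∈ V, ∀ b ∈ V,
      (∃ g, (((padicTwist ρ c).comp N.subtype) g).val = exp (a + b)) ↔ a + b ∈ W' := by
    have := (continuous_add.tendsto' ((0 : LocMat p E n), (0 : LocMat p E n)) 0 (add_zero 0))
      h'.eventually_iff
    rw [mem_map, nhds_prod_eq, mem_prod_same_iff] at this
    obtain ⟨V, hV, hsub⟩ := this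
    exact ⟨V, hV, fun a ha b hb => hsub (Set.mk_mem_prod ha hb)⟩
  obtain ⟨U, hUV, hU⟩ := (hasPadicExp_locMat p E n).exists_isExpNhd V hV
  refine ⟨U, hU.mem_nhds, _, ((Units.continuous_val.comp hc).tendsto' 1 1 (by simp)).eventually
      (eventually_exists_exp_algebraMap hU.mem_nhds), fun x hx g hg hgN hgx => ?_⟩
  obtain ⟨t, htU, ht, hte⟩ := hg
  refine ⟨t, ht, (hVadd x (hUV hx) _ (hUV htU)).1 ⟨⟨g, hgN⟩, ?_⟩⟩
  rw [hU.exp_add _ hx _ htU (Algebra.commutes' t x).symm, hte, ← hgx]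
  exact Algebra.commutes' _ _

/-- Twisting alters logarithms by unknown scalars, which disappear in brackets; `W` is recovered
from its brackets. -/
theorem le_of_padicTwist [IsTopologicalGroup G] [CompactSpace G] (hρ : Continuous ρ)
    (hc : Continuous c) (hN : IsOpen (N : Set G)) (h : IsLieOf ρ W) (h' : IsLieOf ((padicTwist ρ c).comp N.subtype) W')
    (hW : W ≤ Submodule.span ℚ_[p] {c | ∃ a ∈ W, ∃ b ∈ W, c = a * b - b * a}) : W ≤ W' := by
  have hadd : ∀ x ∈ W, ∃ t : ℚ_[p], x + algebraMap ℚ_[p] (LocMat p E n) t ∈ W' := by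
    intro x hx
    obtain ⟨U, hU, V, hV, hUV⟩ := exists_nhds_add_mem hc h'
    have hev := eventually_smul_mem (p := p) (inter_mem hU
      (h.eventually_exists hρ (inter_mem hV (hN.mem_nhds N.one_mem)))) x
    obtain ⟨t, ⟨htU, htg⟩, ht0⟩ :=
      ((hev.filter_mono nhdsWithin_le_nhds).and (self_mem_nhdsWithin (s := {0}ᶜ))).exists
    obtain ⟨g, ⟨hgV, hgN⟩, hgx⟩ := htg (W.smul_mem t hx)
    obtain ⟨s, -, hs⟩ := hUV _ htU g hgV hgN hgx
    refine ⟨t⁻¹ * s, ?_⟩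
    have h1 := W'.smul_mem t⁻¹ hs
    have ht0' : t ≠ 0 := ht0
    rwa [smul_add, smul_smul, inv_mul_cancel₀ ht0', one_smul, Algebra.algebraMap_eq_smul_one, smul_smul,
      ← Algebra.algebraMap_eq_smul_one] at h1
  refine hW.trans (Submodule.span_le.2 ?_)
  rintro _ ⟨a, ha, b, hb, rfl⟩
  obtain ⟨s, hs⟩ := hadd a ha
  obtain ⟨t, ht⟩ := hadd b hb
  have := h'.lie_mem _ hs _ ht
  have hcomm : ∀ (u : ℚ_[p]) (x : LocMat p E n), algebraMap ℚ_[p] (LocMat p E n) u * x =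
    x * algebraMap ℚ_[p] (LocMat p E n) u := Algebra.commutes'
  rw [show a * b - b * a = (a + algebraMap ℚ_[p] (LocMat p E n) s) *
    (b + algebraMap ℚ_[p] (LocMat p E n) t) - (b + algebraMap ℚ_[p] (LocMat p E n) t) *
    (a + algebraMap ℚ_[p] (LocMat p E n) s) by
      rw [add_mul, add_mul, mul_add, mul_add, mul_add, mul_add, hcomm s, hcomm t, hcomm t]
      abel]
  exact this

/-- An element near 1 with `c g ≠ 1` has a twisted logarithm `x + s` with `x ∈ W ⊆ W'` and `s ≠ 0`,
so `W'` contains a non-zero scalar. -/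
theorem algebraMap_mem_of_padicTwist (hρ : Continuous ρ) (hc : Continuous c)
    (hc1 : ∀ V ∈ 𝓝 (1 : G), ∃ g ∈ V, c g ≠ 1) (hN : IsOpen (N : Set G))
    (h : IsLieOf ρ W) (h' : IsLieOf ((padicTwist ρ c).comp N.subtype) W') (hle : W ≤ W')
    (t : ℚ_[p]) : algebraMap ℚ_[p] (LocMat p E n) t ∈ W' := by
  obtain ⟨U, hU, V, hV, hUV⟩ := exists_nhds_add_mem hc h'
  have h1 : (fun g => (ρ g).val) ⁻¹' (exp '' (U ∩ {x | (∃ g, (ρ g).val = exp x) ↔ x ∈ W})) ∈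
      𝓝 (1 : G) := by
    refine (Units.continuous_val.comp hρ).continuousAt.preimage_mem_nhds ?_
    rw [show (Units.val ∘ ρ) 1 = 1 by simp, ← (hasPadicExp_locMat p E n).map_exp_nhds_zero]
    exact image_mem_map (inter_mem hU h.eventually_iff)
  obtain ⟨g, ⟨⟨hgV, hgN⟩, x, ⟨hxU, hxW⟩, hxg⟩, hg1⟩ :=
    hc1 _ (inter_mem (inter_mem hV (hN.mem_nhds N.one_mem)) h1)
  have hx : x ∈ W := hxW.1 ⟨g, hxg.symm⟩
  obtain ⟨s, hs, hsW⟩ := hUV x hxU g hgV hgN hxg.symm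
  have hs0 : s ≠ 0 := by
    rintro rfl
    rw [exp_zero] at hs
    exact hg1 (Units.ext hs.symm)
  have h2 := W'.smul_mem (t * s⁻¹) ((Submodule.add_mem_iff_right _ (hle hx)).1 hsW)
  rwa [Algebra.algebraMap_eq_smul_one, smul_smul, mul_assoc, inv_mul_cancel₀ hs0, mul_one,
    ← Algebra.algebraMap_eq_smul_one] at h2

end TwistedLie

section Openness

variable {p : ℕ} [Fact p.Prime] {E : Type*} [Field E] [NumberField E] {n : ℕ}
  {G : Type*} [Group G] [TopologicalSpace G] {ρ : G →* GL (Fin n) (Loc p E)}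
  {W : Submodule ℚ_[p] (LocMat p E n)}

theorem det_padicScalar (z : ℚ_[p]ˣ) :
    (padicScalar p E n z).val.det = algebraMap ℚ_[p] (Loc p E) ((z : ℚ_[p]) ^ n) := by
  have : (padicScalar p E n z).val = algebraMap ℚ_[p] (Loc p E) z • (1 : LocMat p E n) := by
    rw [padicScalar_val, Algebra.algebraMap_eq_smul_one, algebraMap_smul]
  rw [this, Matrix.det_smul, Matrix.det_one, mul_one, Fintype.card_fin, map_pow]

theorem twistTangent_smul_one (out : Bool) (a : GL (Fin n) (Loc p E)) (σ : E ≃ₐ[ℚ] E)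
    (s : Loc p E) : twistTangent out a σ (s • (1 : LocMat p E n)) =
      (if out then -locAut p σ s else locAut p σ s) • (1 : LocMat p E n) := by
  have h1 : (locAut p σ).mapMatrix (s • (1 : LocMat p E n)) = locAut p σ s • (1 : LocMat p E n) := by
    ext i j
    simp [Matrix.one_apply, apply_ite (locAut p σ)]
  have h2 : a.val * (a⁻¹).val = 1 := by rw [← Units.val_mul, mul_inv_cancel, Units.val_one]
  cases out
  · simp only [twistTangent, LinearMap.coe_mk, AddHom.coe_mk, Bool.false_eq_true, if_false]
    rw [h1, Matrix.mul_smul, mul_one, Matrix.smul_mul, h2]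
  · simp only [twistTangent, LinearMap.coe_mk, AddHom.coe_mk, if_true]
    rw [h1, Matrix.transpose_smul, Matrix.transpose_one, Matrix.mul_smul, mul_one, Matrix.smul_mul,
      h2, neg_smul]

/-- The logarithm of an element of `H(F_p) · ℚ_p^×` is fixed by the twists up to a scalar. -/
theorem eventually_twistTangent_eq (hn : 0 < n) (f : TwistCocycle ρ) (σ : extraTwists ρ) :
    ∀ᶠ x in 𝓝 (0 : LocMat p E n), ∀ y ∈ rationalSimilitudes f, y.val = exp x →
      ∃ t : ℚ_[p], twistTangent (f.out σ) (f.α σ) σ x + algebraMap ℚ_[p] (LocMat p E n) t = x := by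
  have : Nonempty (Fin n) := ⟨⟨0, hn⟩⟩
  set D := twistTangent (f.out σ) (f.α σ) (σ : E ≃ₐ[ℚ] E) with hD
  have hDc : Continuous D := continuous_twistTangent _ _ _
  obtain ⟨U', -, hU'⟩ := (hasPadicExp_locMat p E n).exists_isExpNhd _ univ_mem
  obtain ⟨V, hV, hVadd⟩ := exists_nhds_zero_half hU'.mem_nhds
  obtain ⟨U, hUV, hU⟩ := (hasPadicExp_locMat p E n).exists_isExpNhd V hV
  obtain ⟨π, hπc, hπ⟩ := exists_retraction (p := p) (LocMat p E n)
  have hDU : ∀ᶠ x in 𝓝 (0 : LocMat p E n), D x ∈ U :=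
    (hDc.tendsto' 0 0 (map_zero D)).eventually hU.mem_nhds
  -- The factor `z` of an element of the product need not be close to 1. What is controlled is the
  -- scalar ratio of `exp x` and its twist, read off through the retraction `π`.
  have hlim : Tendsto (fun x : LocMat p E n => π (exp (-D x) * exp x)) (𝓝 0) (𝓝 1) := by
    have h1 : Tendsto (fun x : LocMat p E n => exp (-D x) * exp x) (𝓝 0) (𝓝 (1 * 1)) :=
      (tendsto_exp_locMat.comp (hDc.neg.tendsto' 0 0 (by simp))).mul tendsto_exp_locMat
    have h2 := (hπc.tendsto (1 * 1)).comp h1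
    rwa [mul_one, ← map_one (algebraMap ℚ_[p] (LocMat p E n)), hπ] at h2
  filter_upwards [hU.mem_nhds, hDU, hlim.eventually (eventually_exists_exp_algebraMap hU.mem_nhds)]
    with x hx hDx hxπ
  rintro _ ⟨b, hb, _, ⟨z, rfl⟩, rfl⟩ hy
  obtain ⟨ζ, hζ⟩ : ∃ ζ : ℚ_[p], exp (D x) * algebraMap ℚ_[p] (LocMat p E n) ζ = exp x := by
    -- An outer twist inverts scalars, so the ratio is `z / z⁻¹`; an inner twist fixes them.
    let ζ : ℚ_[p]ˣ := if f.out σ then z * z else 1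
    refine ⟨ζ, ?_⟩
    change (b * padicScalar p E n z).val = exp x at hy
    rw [hD, exp_twistTangent hU _ _ _ hx hy, map_mul, map_mul, locAut_padicScalar,
      twistAut_padicScalar, ((mem_rationalPoints_iff f b).1 hb).2 σ, ← padicScalar_val,
      ← Units.val_mul, mul_assoc, ← map_mul, ← hy]
    congr 3
    simp only [ζ]
    split_ifs <;> simp
  have hζ' : algebraMap ℚ_[p] (LocMat p E n) ζ = exp (-D x) * exp x := by
    rw [← hζ, ← mul_assoc, hU.exp_neg_mul_exp hDx, one_mul]
  rw [← hζ', hπ] at hxπ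
  obtain ⟨t, htU, -, hte⟩ := hxπ
  have hxU' : x ∈ U' := by
    have := hVadd x (hUV hx) 0 (mem_of_mem_nhds hV)
    rwa [add_zero] at this
  refine ⟨t, hU'.injOn (hVadd _ (hUV hDx) _ (hUV htU)) hxU' ?_⟩
  rw [hU.exp_add _ hDx _ htU (Algebra.commutes' t (D x)).symm, hte, hζ]

/-- The logarithm of an element of `H(F_p) · ℚ_p^×` is the sum of an element of the Lie algebra and
a `p`-adic scalar. -/
theorem eventually_exists_add_algebraMap (hn : 0 < n) (h : IsLieOf ρ W)
    (hdet : ∀ g, (ρ g).val.det = 1) (f : TwistCocycle ρ)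
    (hW : ∀ x : LocMat p E n, x.trace = 0 →
      (∀ σ : extraTwists ρ, twistTangent (f.out σ) (f.α σ) σ x = x) → x ∈ W) :
    ∀ᶠ x in 𝓝 (0 : LocMat p E n), ∀ y ∈ rationalSimilitudes f, y.val = exp x →
      ∃ x₀ ∈ W, ∃ t : ℚ_[p], x = x₀ + algebraMap ℚ_[p] (LocMat p E n) t := by
  have hn0 : (n : ℚ_[p]) ≠ 0 := Nat.cast_ne_zero.2 hn.ne'
  have hL : HasPadicExp p (Loc p E) := hasPadicExp _
  obtain ⟨U, -, hU⟩ := (hasPadicExp_locMat p E n).exists_isExpNhd _ univ_mem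
  obtain ⟨UL, -, hUL⟩ := hL.exists_isExpNhd _ univ_mem
  obtain ⟨π, hπc, hπ⟩ := exists_retraction (p := p) (Loc p E)
  -- Subtracting the scalar `tr x / n` leaves the traceless part, which will lie in `W`.
  let s : LocMat p E n → Loc p E := fun x => (n : ℚ_[p])⁻¹ • x.trace
  have hsc : Continuous s := IsModuleTopology.continuous_of_linearMap (R := ℚ_[p])
    ((n : ℚ_[p])⁻¹ • traceLinearMap (Fin n) ℚ_[p] (Loc p E))
  let S : Loc p E →ₐ[ℚ_[p]] LocMat p E n := IsScalarTower.toAlgHom ℚ_[p] (Loc p E) (LocMat p E n)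
  have hSc : Continuous S := IsModuleTopology.continuous_of_linearMap (R := ℚ_[p]) S.toLinearMap
  have hS1 : ∀ r, S r = r • (1 : LocMat p E n) := fun r => Algebra.algebraMap_eq_smul_one r
  have hs0 : s 0 = 0 := by simp [s]
  have hlim : Tendsto (fun x => π (exp ((n : ℚ_[p]) • s x))) (𝓝 (0 : LocMat p E n)) (𝓝 1) := by
    have h1 : Tendsto (fun x => exp ((n : ℚ_[p]) • s x)) (𝓝 (0 : LocMat p E n)) (𝓝 1) := by
      refine Tendsto.comp (y := 𝓝 0) hL.map_exp_nhds_zero.le ?_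
      exact (hsc.const_smul (n : ℚ_[p])).tendsto' 0 0 (by simp [hs0])
    have h2 := (hπc.tendsto 1).comp h1
    rwa [← map_one (algebraMap ℚ_[p] (Loc p E)), hπ] at h2
  have hx0c : Tendsto (fun x : LocMat p E n => x - S (s x)) (𝓝 0) (𝓝 0) :=
    (continuous_id.sub (hSc.comp hsc)).tendsto' 0 0 (by simp [hs0])
  filter_upwards [eventually_all.2 fun σ => eventually_twistTangent_eq hn f σ,
    hx0c.eventually hU.mem_nhds, hx0c.eventually h.eventually_iff,
    ((hSc.comp hsc).tendsto' 0 0 (by simp [hs0])).eventually hU.mem_nhds,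
    (hsc.tendsto' 0 0 hs0).eventually hUL.mem_nhds,
    hlim.eventually (eventually_exists_exp_algebraMap hUL.mem_nhds)]
    with x hσ hx0U hx0W hsU hsUL hxπ y hyH hy
  have hns : (n : ℚ_[p]) • s x = x.trace := by rw [smul_smul, mul_inv_cancel₀ hn0, one_smul]
  have htr : (x - S (s x)).trace = 0 := by
    rw [Matrix.trace_sub, hS1, Matrix.trace_smul, Matrix.trace_one, Fintype.card_fin, ← hns,
      smul_eq_mul, Algebra.smul_def, map_natCast, mul_comm, sub_self]
  have hfix : ∀ σ : extraTwists ρ, twistTangent (f.out σ) (f.α σ) σ (x - S (s x)) = x - S (s x) := by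
    intro σ
    obtain ⟨t, ht⟩ := hσ σ y hyH hy
    -- The normalized trace of the relation for `x` is the same relation for `s x`. Subtracting the
    -- two leaves the traceless part exactly fixed.
    have h1 : (if f.out σ then -locAut p σ (s x) else locAut p σ (s x)) +
        algebraMap ℚ_[p] (Loc p E) t = s x := by
      have h2 := congrArg (fun w : LocMat p E n => (n : ℚ_[p])⁻¹ • w.trace) ht
      simp only [Matrix.trace_add, trace_twistTangent, smul_add] at h2
      refine Eq.trans ?_ h2
      congr 1
      · split_ifs
        · rw [smul_neg, ← map_smul]
        · rw [← map_smul]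
      · rw [Algebra.algebraMap_eq_smul_one (A := LocMat p E n), Matrix.trace_smul, Matrix.trace_one,
          Fintype.card_fin, Algebra.smul_def, Algebra.smul_def,
          ← map_natCast (algebraMap ℚ_[p] (Loc p E)), ← map_mul, ← map_mul, mul_comm t,
          ← mul_assoc, inv_mul_cancel₀ hn0, one_mul]
    have h3 := congrArg (fun r : Loc p E => r • (1 : LocMat p E n)) h1
    simp only [add_smul, algebraMap_smul, ← Algebra.algebraMap_eq_smul_one (R := ℚ_[p])] at h3
    rw [map_sub, hS1, twistTangent_smul_one, ← h3, eq_sub_of_add_eq ht, sub_sub, add_comm]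
  have hx0 : x - S (s x) ∈ W := hW _ htr hfix
  obtain ⟨g, hg⟩ := hx0W.2 hx0
  have hexp : y.val = (ρ g).val * S (exp (s x)) := by
    have h1 : S (exp (s x)) = exp (S (s x)) := hUL.map_exp S.toRingHom hSc hsUL
    have hcomm : Commute (x - S (s x)) (S (s x)) := (Algebra.commutes' (s x) _).symm
    rw [hy, hg, h1, ← hU.exp_add _ hx0U (S (s x)) hsU hcomm, sub_add_cancel]
  -- So far `s x` is only known to lie in `E_p`. The determinant of `y` is in `ℚ_p` and equals `exp
  -- (n s)`, and injectivity of `exp` forces `s x` into `ℚ_p`.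
  obtain ⟨z, hz⟩ : ∃ z : ℚ_[p], algebraMap ℚ_[p] (Loc p E) z = y.val.det := by
    obtain ⟨b, hb, _, ⟨z, rfl⟩, rfl⟩ := hyH
    refine ⟨(z : ℚ_[p]) ^ n, ?_⟩
    change _ = (b * padicScalar p E n z).val.det
    rw [Units.val_mul, Matrix.det_mul, ((mem_rationalPoints_iff f b).1 hb).1, one_mul,
      det_padicScalar]
  have hz' : algebraMap ℚ_[p] (Loc p E) z = exp ((n : ℚ_[p]) • s x) := by
    rw [hz, hexp, Matrix.det_mul, hdet, one_mul, hS1, Matrix.det_smul, Matrix.det_one, mul_one,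
      Fintype.card_fin, hUL.exp_natCast_smul hsUL]
  rw [← hz', hπ] at hxπ
  obtain ⟨t, htU, -, hte⟩ := hxπ
  have hnsU : (n : ℚ_[p]) • s x ∈ UL := hUL.smul_mem _ (by
    simpa using Padic.norm_int_le_one (p := p) (n : ℤ)) _ hsUL
  have ht : algebraMap ℚ_[p] (Loc p E) t = (n : ℚ_[p]) • s x :=
    hUL.injOn htU hnsU (hte.trans hz')
  refine ⟨_, hx0, (n : ℚ_[p])⁻¹ * t, ?_⟩
  have h3 : s x = algebraMap ℚ_[p] (Loc p E) ((n : ℚ_[p])⁻¹ * t) := by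
    rw [map_mul, ht, ← Algebra.smul_def, smul_smul, inv_mul_cancel₀ hn0, one_smul]
  have h4 : S (s x) = algebraMap ℚ_[p] (LocMat p E n) ((n : ℚ_[p])⁻¹ * t) := by
    rw [h3, AlgHom.commutes]
  rw [← h4, sub_add_cancel]

end Openness

end

/-! ### Openness of the image -/

section

open Filter Topology NormedSpace

section OpenImage

theorem isOpen_subtype_of_eventually {Γ : Type*} [Group Γ] [TopologicalSpace Γ]
    [IsTopologicalGroup Γ] {T S : Subgroup Γ} (h : ∀ᶠ y in 𝓝 (1 : Γ), y ∈ S → y ∈ T) :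
    IsOpen {x : S | (x : Γ) ∈ T} := by
  refine Subgroup.isOpen_of_mem_nhds (T.subgroupOf S) (g := 1) ?_
  have := (continuous_subtype_val.tendsto' (1 : S) 1 rfl).eventually h
  filter_upwards [this] with x hx
  exact hx x.2

variable {p : ℕ} [Fact p.Prime] {E : Type*} [Field E] [NumberField E] {n : ℕ}
  {G : Type*} [Group G] [TopologicalSpace G]

theorem map_padicTwist_le {ρ : G →* GL (Fin n) (Loc p E)} (hdet : ∀ g, (ρ g).val.det = 1)
    (c : G →* ℚ_[p]ˣ) (f : TwistCocycle ρ) {N : Subgroup G} (hN : (N : Set G) ⊆ twistKernel ρ) :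
    N.map (padicTwist ρ c) ≤ rationalSimilitudes f := by
  rintro _ ⟨g, hg, rfl⟩
  refine ⟨ρ g, apply_mem_rationalPoints f hdet (hN hg), _, ⟨c g, rfl⟩, ?_⟩
  exact (padicScalar_commute (c g) (ρ g)).eq.symm

/-- Near 1 the logarithm of an element of `H(F_p) · ℚ_p^×` lies in `W + ℚ_p`, and the Lie algebra of
the twisted image of `N` contains both summands. -/
theorem eventually_mem_map_padicTwist [IsGalois ℚ E] [IsTopologicalGroup G] [CompactSpace G]
    [TotallyDisconnectedSpace G] (hn : 0 < n) {ρ : G →* GL (Fin n) (Loc p E)}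
    (hρ : Continuous ρ) (hdet : ∀ g, (ρ g).val.det = 1) (hrat : HasRationalTraces ρ)
    (hsl : ∀ ν : E →ₐ[ℚ] PadicAlgCl p,
      Submodule.span (PadicAlgCl p) (lieAlg (repAt ρ ν).range) =
      LinearMap.ker (traceLinearMap (Fin n) (PadicAlgCl p) (PadicAlgCl p)))
    {c : G →* ℚ_[p]ˣ} (hc : Continuous c) (hc1 : ∀ V ∈ 𝓝 (1 : G), ∃ g ∈ V, c g ≠ 1)
    (f : TwistCocycle ρ) {N : Subgroup G} (hN : IsOpen (N : Set G)) :
    ∀ᶠ y in 𝓝 (1 : GL (Fin n) (Loc p E)),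
      y ∈ rationalSimilitudes f → y ∈ N.map (padicTwist ρ c) := by
  obtain ⟨W, h⟩ := exists_isLieOf hρ
  have hsl' := fun ν => h.span_matEmb_eq hρ (hsl ν)
  have hker := twistKernel_mem_nhds hn hρ hdet
  have hspan := fun x => h.mem_span_lie_of_twistTangent_eq hn hρ hrat hker hsl' f (x := x)
  have : CompactSpace N :=
    isCompact_iff_compactSpace.1 (Subgroup.isClosed_of_isOpen N hN).isCompact
  obtain ⟨W', h'⟩ := exists_isLieOf (ρ := (padicTwist ρ c).comp N.subtype)
    ((continuous_padicTwist hρ hc).comp continuous_subtype_val)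
  have hle : W ≤ W' := le_of_padicTwist hρ hc hN h h' fun x hx =>
    hspan x (trace_eq_zero_of_mem hsl' hx) fun σ => h.twistTangent_eq_of_mem hρ hker f σ hx
  have hscal := algebraMap_mem_of_padicTwist hρ hc hc1 hN h h' hle
  have hlie : Submodule.span ℚ_[p] {c | ∃ a ∈ W, ∃ b ∈ W, c = a * b - b * a} ≤ W := by
    refine Submodule.span_le.2 ?_
    rintro _ ⟨a, ha, b, hb, rfl⟩
    exact h.lie_mem a ha b hb
  have hlog := eventually_exists_add_algebraMap hn h hdet f
    fun x hx hfx => hlie (hspan x hx hfx)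
  have hnhds : exp '' {x : LocMat p E n | (∀ y ∈ rationalSimilitudes f, y.val = exp x →
      ∃ x₀ ∈ W, ∃ t : ℚ_[p], x = x₀ + algebraMap ℚ_[p] (LocMat p E n) t) ∧
      ((∃ g, (((padicTwist ρ c).comp N.subtype) g).val = exp x) ↔ x ∈ W')} ∈
      𝓝 (1 : LocMat p E n) := by
    rw [← (hasPadicExp_locMat p E n).map_exp_nhds_zero]
    exact image_mem_map (hlog.and h'.eventually_iff)
  filter_upwards [(Units.continuous_val.tendsto' (1 : GL (Fin n) (Loc p E)) 1 rfl).eventually hnhds]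
  rintro y ⟨x, ⟨hx1, hx2⟩, hxy⟩ hy
  obtain ⟨x₀, hx₀, t, rfl⟩ := hx1 y hy hxy.symm
  obtain ⟨g, hg⟩ := hx2.2 (W'.add_mem (hle hx₀) (hscal t))
  exact ⟨g, g.2, Units.ext (hg.trans hxy)⟩

end OpenImage

/-! ### The cyclotomic character and restriction to subfields -/

section Cyclotomic

variable {K Ω : Type*} [Field K] [NumberField K] [Field Ω] [Algebra K Ω] [IsAlgClosure K Ω]

/-- The cyclotomic character of a number field has infinite image. -/
theorem exists_cyclotomicCharacter_ne_one (p : ℕ) [Fact p.Prime] {V : Set Gal(Ω/K)}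
    (hV : V ∈ 𝓝 1) : ∃ g ∈ V, cyclotomicCharacter Ω p g.toRingEquiv ≠ 1 := by
  have hp : p.Prime := Fact.out
  have hgal := isGalois_of_isAlgClosure K Ω
  have := IsAlgClosure.isAlgClosed (R := K) (K := Ω)
  have : CharZero Ω := charZero_of_injective_algebraMap (algebraMap K Ω).injective
  by_contra! hcon
  obtain ⟨F, hF, hFV⟩ := (krullTopology_mem_nhds_one_iff K Ω V).1 hV
  have : NumberField F := NumberField.of_module_finite K F
  let d := Module.finrank ℚ F
  -- A field of degree `d` cannot contain these roots of unity, whose degree is `p ^ d * (p - 1) ≥ p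
  -- ^ d > d`.
  obtain ⟨ζ, hζ⟩ := HasEnoughRootsOfUnity.exists_primitiveRoot Ω (p ^ (d + 1))
  have hζF : ζ ∈ F := by
    rw [← InfiniteGalois.fixedField_fixingSubgroup F]
    rintro ⟨g, hg⟩
    have h1 := cyclotomicCharacter.spec p g.toRingEquiv ζ hζ.pow_eq_one
    rw [hcon g (hFV hg), Units.val_one, map_one, ZMod.val_one'', pow_one] at h1
    · exact h1
    · exact (Nat.one_lt_pow (by lia) hp.one_lt).ne'
  have hζ' : IsPrimitiveRoot (⟨ζ, hζF⟩ : F) (p ^ (d + 1)) :=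
    IsPrimitiveRoot.of_map_of_injective (f := F.val) hζ F.val.toRingHom.injective
  have h1 := hζ'.totient_le_degree_minpoly
  have hζint : IsIntegral ℤ (⟨ζ, hζF⟩ : F) := hζ'.isIntegral (pow_pos hp.pos _)
  have h2 : (minpoly ℤ (⟨ζ, hζF⟩ : F)).natDegree ≤ d := by
    have := minpoly.natDegree_le (A := ℚ) (⟨ζ, hζF⟩ : F)
    rwa [minpoly.isIntegrallyClosed_eq_field_fractions' ℚ hζint,
      (minpoly.monic hζint).natDegree_map] at this
  rw [Nat.totient_prime_pow_succ hp] at h1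
  have h3 : d < p ^ d := Nat.lt_pow_self hp.one_lt
  have h4 : 1 ≤ p - 1 := Nat.le_sub_one_of_lt hp.one_lt
  nlinarith [Nat.mul_le_mul_left (p ^ d) h4]

/-- The `m`-th roots of unity in `ℤ_p` are finite in number, so those different from 1 stay away
from 1. -/
theorem eventually_eq_one_of_zpow_eq_one {p : ℕ} [Fact p.Prime] {m : ℤ} (hm : m ≠ 0) :
    ∀ᶠ z in 𝓝 (1 : ℤ_[p]ˣ), z ^ m = 1 → z = 1 := by
  classical
  let S : Set ℤ_[p] := {z | z ^ m.natAbs = 1 ∧ z ≠ 1}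
  have hS : S.Finite := by
    refine ((Polynomial.nthRoots m.natAbs (1 : ℤ_[p])).toFinset.finite_toSet).subset fun z hz => ?_
    rw [Finset.mem_coe, Multiset.mem_toFinset, Polynomial.mem_nthRoots (Int.natAbs_pos.2 hm)]
    exact hz.1
  have h1 : Sᶜ ∈ 𝓝 (1 : ℤ_[p]) := hS.isClosed.isOpen_compl.mem_nhds fun h => h.2 rfl
  filter_upwards [(Units.continuous_val.tendsto' (1 : ℤ_[p]ˣ) 1 rfl).eventually h1] with z hz hzm
  by_contra hne
  refine hz ⟨?_, fun h => hne (Units.ext h)⟩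
  have : z ^ m.natAbs = 1 := by
    rcases Int.natAbs_eq m with h | h <;> rw [h] at hzm
    · exact_mod_cast hzm
    · rw [_root_.zpow_neg, inv_eq_one] at hzm
      exact_mod_cast hzm
  rw [← Units.val_pow_eq_pow_val, this, Units.val_one]

end Cyclotomic

section Restrict

variable {K Ω : Type*} [Field K] [Field Ω] [Algebra K Ω] [Algebra.IsAlgebraic K Ω]

/-- Fixing a finite extension of `K` means fixing a finite basis, and each basis element has an open
stabilizer. -/
theorem continuous_restrictScalarsHom (M : IntermediateField K Ω) :
    Continuous (AlgEquiv.restrictScalarsHom K : Gal(Ω/M) →* Gal(Ω/K)) := by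
  refine continuous_of_continuousAt_one _ ?_
  rw [ContinuousAt, map_one]
  intro V hV
  obtain ⟨F, hF, hFV⟩ := (krullTopology_mem_nhds_one_iff K Ω V).1 hV
  let b := Module.finBasis K F
  have h1 : ∀ᶠ g in 𝓝 (1 : Gal(Ω/M)), ∀ i, g (b i : Ω) = (b i : Ω) := by
    rw [eventually_all]
    intro i
    have := Algebra.IsAlgebraic.tower_top (K := K) M (A := Ω)
    exact (stabilizer_isOpen_of_isIntegral (K := M) (b i : Ω)).mem_nhds (one_mem _)
  rw [mem_map]
  filter_upwards [h1] with g hg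
  refine hFV fun x => ?_
  have h2 : ((g.restrictScalars K : Gal(Ω/K)).toLinearMap).comp F.val.toLinearMap =
      F.val.toLinearMap := b.ext hg
  exact LinearMap.congr_fun h2 x

end Restrict

end

/-! ### Twisting by a root of the cyclotomic character -/

section

open Filter Topology NormedSpace

section DetTwist

variable {p : ℕ} [Fact p.Prime] {E K Ω : Type*} [Field E] [NumberField E] [Field K]
  [Field Ω] [Algebra K Ω] {n : ℕ}

/-- The character `δ^m` with values in `ℚ_p^×`. -/
def rootChar {G : Type*} [Group G] (δ : G →* ℤ_[p]ˣ) (m : ℤ) : G →* ℚ_[p]ˣ :=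
  (Units.map (PadicInt.Coe.ringHom (p := p)).toMonoidHom).comp (δ ^ m)

theorem continuous_rootChar {G : Type*} [Group G] [TopologicalSpace G] {δ : G →* ℤ_[p]ˣ}
    (hδ : Continuous δ) (m : ℤ) : Continuous (rootChar δ m) :=
  (Continuous.units_map (PadicInt.Coe.ringHom (p := p)).toMonoidHom continuous_subtype_val).comp
    (hδ.zpow m)

theorem detTwist_eq_padicTwist (M : IntermediateField K Ω)
    (ρ : Gal(Ω/K) →* GL (Fin n) (Loc p E)) (δ : Gal(Ω/M) →* ℤ_[p]ˣ) (m : ℤ) :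
    detTwist M ρ δ m = padicTwist (restrictTo M ρ) (rootChar δ (-m)) := rfl

theorem padicTwist_detTwist (M : IntermediateField K Ω)
    (ρ : Gal(Ω/K) →* GL (Fin n) (Loc p E)) (δ : Gal(Ω/M) →* ℤ_[p]ˣ) (m : ℤ) :
    padicTwist (detTwist M ρ δ m) (rootChar δ m) = restrictTo M ρ := by
  ext1 g
  rw [padicTwist_apply, detTwist_eq_padicTwist, padicTwist_apply, ← mul_assoc, ← map_mul]
  have : rootChar δ m g * rootChar δ (-m) g = 1 := by
    simp only [rootChar, MonoidHom.comp_apply, ← map_mul, MonoidHom.zpow_apply]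
    rw [← _root_.zpow_add, add_neg_cancel, _root_.zpow_zero, map_one]
  rw [this, map_one, one_mul]

theorem continuous_restrictTo [Algebra.IsAlgebraic K Ω] (M : IntermediateField K Ω)
    {ρ : Gal(Ω/K) →* GL (Fin n) (Loc p E)} (hρ : Continuous ρ) : Continuous (restrictTo M ρ) :=
  hρ.comp (continuous_restrictScalarsHom M)

theorem map_fixingSubgroup_restrictTo (M : IntermediateField K Ω) (F : IntermediateField M Ω)
    (ρ : Gal(Ω/K) →* GL (Fin n) (Loc p E)) :
    (F.fixingSubgroup.map (restrictTo M ρ) : Set (GL (Fin n) (Loc p E))) =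
      ρ '' ((F.restrictScalars K).fixingSubgroup : Set Gal(Ω/K)) := by
  ext y
  constructor
  · rintro ⟨g, hg, rfl⟩
    exact ⟨AlgEquiv.restrictScalarsHom K g, fun x => hg x, rfl⟩
  · rintro ⟨g, hg, rfl⟩
    let g' : Gal(Ω/M) := { g.toRingEquiv with
      commutes' := fun a => hg ⟨algebraMap M Ω a, F.algebraMap_mem a⟩ }
    exact ⟨g', fun x => hg x, rfl⟩

end DetTwist

section Nontrivial

variable {p : ℕ} [Fact p.Prime] {K Ω : Type*} [Field K] [NumberField K] [Field Ω] [Algebra K Ω]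
  [IsAlgClosure K Ω]

/-- Near 1 the triviality of `δ^m` would force that of `δ`, hence of the cyclotomic character `δ^n`.
-/
theorem exists_rootChar_ne_one {n : ℕ} {δ : Gal(Ω/K) →* ℤ_[p]ˣ} (hδ : Continuous δ)
    (hcyc : ∀ g : Gal(Ω/K), δ g ^ n = cyclotomicCharacter Ω p g.toRingEquiv) {m : ℤ} (hm : m ≠ 0)
    {V : Set Gal(Ω/K)} (hV : V ∈ 𝓝 1) : ∃ g ∈ V, rootChar δ m g ≠ 1 := by
  obtain ⟨g, ⟨hgV, hg⟩, hne⟩ := exists_cyclotomicCharacter_ne_one p (inter_mem hV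
    ((hδ.tendsto' 1 1 (map_one δ)).eventually (eventually_eq_one_of_zpow_eq_one hm)))
  refine ⟨g, hgV, fun h => hne ?_⟩
  have h1 : δ g ^ m = 1 := Units.map_injective
    (f := (PadicInt.Coe.ringHom (p := p)).toMonoidHom) Subtype.val_injective (by rw [map_one]; exact h)
  rw [← hcyc, hg h1, one_pow]

end Nontrivial

end

end BigImage

end

open BigImage in
theorem mainTheorem3 (p : ℕ) [Fact p.Prime]
    (K Ω : Type*) [Field K] [NumberField K] [Field Ω] [Algebra K Ω] [IsAlgClosure K Ω]
    (E : Type*) [Field E] [NumberField E] [IsGalois ℚ E]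
    (n : ℕ) (hn : 0 < n)
    (ρ : Gal(Ω/K) →* GL (Fin n) (Loc p E)) (hρ : Continuous ρ)
    (M : IntermediateField K Ω) [FiniteDimensional K M]
    (δ : Gal(Ω/M) →* ℤ_[p]ˣ) (hδ : IsCyclotomicRoot n M δ)
    (m : ℤ) (hm : m ≠ 0)
    (hvalid : IsValid (detTwist M ρ δ m)) :
    Nonempty (TwistCocycle (detTwist M ρ δ m)) ∧
    ∀ f : TwistCocycle (detTwist M ρ δ m),
      ∃ L : IntermediateField K Ω, FiniteDimensional K L ∧
        ρ '' (L.fixingSubgroup : Set Gal(Ω/K)) ⊆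
          (f.rationalPoints : Set (GL (Fin n) (Loc p E))) * (padicScalars p E n : Set _) ∧
        IsOpen ({x | (x : GL (Fin n) (Loc p E)) ∈ ρ '' (L.fixingSubgroup : Set Gal(Ω/K))} :
          Set ↥((f.rationalPoints : Set (GL (Fin n) (Loc p E))) *
            (padicScalars p E n : Set (GL (Fin n) (Loc p E))))) := by
  have := IsAlgClosure.isAlgClosed (R := K) (K := Ω)
  have := IsAlgClosure.isAlgebraic (R := K) (K := Ω)
  have : NumberField M := NumberField.of_module_finite K M
  have : IsAlgClosure M Ω := ⟨inferInstance, Algebra.IsAlgebraic.tower_top (K := K) M⟩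
  have hgal := isGalois_of_isAlgClosure M Ω
  refine ⟨nonempty_twistCocycle _, fun f => ?_⟩
  have hρ' : Continuous (detTwist M ρ δ m) := by
    rw [detTwist_eq_padicTwist]
    exact continuous_padicTwist (continuous_restrictTo M hρ) (continuous_rootChar hδ.1 (-m))
  -- A finite extension of `M` over which all twisting characters are trivial; it serves as `L`.
  obtain ⟨F, hF, hFV⟩ := (krullTopology_mem_nhds_one_iff M Ω _).1
    (twistKernel_mem_nhds hn hρ' hvalid.det_eq_one)
  have hmap := map_fixingSubgroup_restrictTo M F ρ
  rw [← padicTwist_detTwist M ρ δ m] at hmap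
  refine ⟨F.restrictScalars K, (Module.Finite.trans M F : Module.Finite K F), ?_, ?_⟩
  · rw [← hmap]
    exact map_padicTwist_le hvalid.det_eq_one _ f hFV
  · rw [← hmap]
    exact isOpen_subtype_of_eventually (S := rationalSimilitudes f)
      (eventually_mem_map_padicTwist hn hρ' hvalid.det_eq_one (hasRationalTraces hρ' hvalid)
        hvalid.lie_eq_sl (continuous_rootChar hδ.1 m)
        (fun V hV => exists_rootChar_ne_one hδ.1 hδ.2 hm hV) f F.fixingSubgroup_isOpen)
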